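/- **Setting.** Let $d\ge 2$ and let $\Omega\subset\mathbb R^d$ be a bounded domain whose boundary is a disjoint union $\partial\Omega=\Gamma_D\,\dot\cup\,\Gamma_N\,\dot\cup\,\Gamma_{\rm d}$ with $\Gamma_D$ closed; let $\Sigma\subset\Omega$. A set $M\subset\mathbb R^d$ is an $m$-dimensional Lipschitz submanifold if every $x\in M$ has an open neighbourhood $V$ with a bi-Lipschitz map $\varphi:V\to\mathbb R^d$ such that $\varphi(M\cap V)=]0,1[^m\times\{0\}$; it is a Lipschitz hypersurface in graph representation if every $x \in M$ has an open neighbourhood $V$ such that $M\cap V$ is the bijective image of an open set $U\subset\mathbb R^{d-1}$ under a map $g(y)=Q(y,h(y))+x^*$ with $Q$ orthogonal, $x^*\in\mathbb R^d$ and $h:U\to\mathbb R$ Lipschitz continuous. Then, at points $x=g(y)$ where $g$ is differentiable at $y$, $T_xM$ is the image of $g'(y)$, and the surface gradient is $\nabla_M u(x)=g'(y)\,(g'(y)^Tg'(y))^{-1}\nabla(u\circ g)(y)$. Assume that $\Gamma_{\rm d}$ and $\Sigma$ are Lipschitz hypersurfaces in graph representation, that $\Gamma_N$ is a $(d-1)$-dimensional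 Lipschitz submanifold, and that $\overline{\Gamma_N}$, $\overline{\Gamma_{\rm d}}$, $\overline\Sigma$ are each contained in a $(d-1)$-dimensional Lipschitz submanifold. (Any of $\Gamma_D,\Gamma_N,\Gamma_{\rm d},\Sigma$ may be empty.) Let $1\le k\le d$, let $S\subset\overline\Omega$ be a compact $(d-k)$-dimensional Lipschitz submanifold (a finite set if $k=d$), let $0\le\gamma<k$, and put $\mu_\Omega^*(x)=\operatorname{dist}(x,S)^\gamma$, where $\mu^*_\Omega\equiv 1$ if $\gamma=0$ (the nondegenerate case, in which $S=\emptyset$ is allowed; otherwise $S\neq\emptyset$). Assume that $S\cap\overline{\Gamma_{\rm d}\cup\Sigma}=\emptyset$ or $\gamma<1$. Let $\mu_\Omega:\Omega\to\mathbb R^{d\times d}$ be measurable with $(\mu_\Omega(x)\xi,\xi)\ge c_1\mu_\Omega^*(x)|\xi|^2$ and $\|\mu_\Omega(x)\|\le c_2\mu_\Omega^*(x)$ for $x\in\Omega$, $\xi\in\mathbb R^d$. For $\mathcal S\in\{\Gamma_{\rm d},\Sigma\}$ let $\mu_{\mathcal S}^*:\mathcal S\to[0,\infty)$ be measurable and bounded,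 and $\mu_{\mathcal S}:\mathcal S\to\mathbb R^{d\times d}$ measurable with $(\mu_{\mathcal S}(x)\xi,\xi)\ge c_1\mu_{\mathcal S}^*(x)|\xi|^2$ for $\xi\in T_x\mathcal S$ and $\|\mu_{\mathcal S}(x)\|\le c_2\mu_{\mathcal S}^*(x)$, $x\in\mathcal S$. Here $c_1,c_2>0$ are constants. For $1\le q\le\infty$ let $\mathbb L^q=L^q\big((\Omega\setminus\Sigma)\cup\Gamma_{\rm d}\cup\Sigma,\,dx+d\mathcal H_{d-1}\big)$ (complex-valued functions), where $\mathcal H_{d-1}$ is the Hausdorff measure on $\Gamma_{\rm d}$ and on $\Sigma$. Let $C_D^\infty(\Omega)$ be the set of restrictions to $\Omega$ of functions in $C_c^\infty(\mathbb R^d)$ whose support does not meet $\Gamma_D$, and let $\operatorname{dom}(\mathfrak t)$ be its completion for the norm $$\|u\|^2_{\operatorname{dom}(\mathfrak t)}=\|u\|_{L^2(\Omega)}^2+\int_\Omega|\nabla u|^2\mu_\Omega^*\,dx+\int_{\Gamma_{\rm d}}|\nabla_{\Gamma_{\rm d}}u|^2\mu_{\Gamma_{\rm d}}^*\,d\mathcal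 H_{d-1}+\int_{\Sigma}|\nabla_\Sigma u|^2\mu_\Sigma^*\,d\mathcal H_{d-1}.$$ Let $\mathfrak t$ be the continuous extension to $\operatorname{dom}(\mathfrak t)$ of the sesquilinear form $$\mathfrak t(u,v)=\int_\Omega(\mu_\Omega\nabla u,\overline{\nabla v})\,dx+\int_{\Gamma_{\rm d}}(\mu_{\Gamma_{\rm d}}\nabla_{\Gamma_{\rm d}}u,\overline{\nabla_{\Gamma_{\rm d}}v})\,d\mathcal H_{d-1}+\int_\Sigma(\mu_\Sigma\nabla_\Sigma u,\overline{\nabla_\Sigma v})\,d\mathcal H_{d-1},$$ and $\mathfrak J:\operatorname{dom}(\mathfrak t)\to\mathbb L^2$ the continuous extension of $u\mapsto(u,u|_{\Gamma_{\rm d}},u|_\Sigma)$. The operator $A_2$ on $\mathbb L^2$ associated with $\mathfrak t$ is defined by: $\varphi\in\operatorname{dom}(A_2)$ and $A_2\varphi=\psi$ iff there is $u\in\operatorname{dom}(\mathfrak t)$ with $\varphi=\mathfrak Ju$ and $(\psi,\mathfrak Jv)_{\mathbb L^2}=\mathfrak t(u,v)$ for all $v\in\operatorname{dom}(\mathfrak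 t)$. Let $T_2$ be the $C_0$-semigroup on $\mathbb L^2$ generated by $-A_2$, let $T_p$ be the $C_0$-semigroup on $\mathbb L^p$ that is consistent with $T_2$, and let $A_p$ be the negative generator of $T_p$. **Lemma 6.1.** Let $p,r\in(2,\infty)$ and $\theta\in(0,1)$ with $\theta>\frac{r}{(r-2)p}$, and suppose that $\mathfrak J\operatorname{dom}(\mathfrak t)\subset\mathbb L^r$. Then $\operatorname{dom}(A_p^\theta)\subset\mathbb L^\infty$, and the embedding is continuous: there is $C>0$ with $\|u\|_{\mathbb L^\infty}\le C\,(\|u\|_{\mathbb L^p}+\|A_p^\theta u\|_{\mathbb L^p})$ for all $u\in\operatorname{dom}(A_p^\theta)$. -/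

import Mathlib

open MeasureTheory Set Filter Topology
open scoped ENNReal NNReal ContDiff

/-! ### Strongly continuous semigroups, generators, fractional powers -/

/-- A `C₀`-semigroup of bounded operators on a complex Banach space. -/
structure C0Semigroup (X : Type*) [NormedAddCommGroup X] [NormedSpace ℂ X] where
  /-- the operator at time `t ≥ 0` -/
  toFun : ℝ≥0 → X →L[ℂ] X
  map_zero' : toFun 0 = ContinuousLinearMap.id ℂ X
  map_add' : ∀ s t, toFun (s + t) = (toFun s).comp (toFun t)
  continuous' : ∀ x, Continuous fun t => toFun t x

namespace C0Semigroup

variable {X : Type*} [NormedAddCommGroup X] [NormedSpace ℂ X]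

/-- The constant semigroup; it only serves to make choices from `C0Semigroup X` possible. -/
instance : Nonempty (C0Semigroup X) :=
  ⟨{ toFun := fun _ => ContinuousLinearMap.id ℂ X
     map_zero' := rfl
     map_add' := fun _ _ => rfl
     continuous' := fun _ => continuous_const }⟩

/-- The graph of the negative generator `A` of `T`, i.e. `A x = lim_{t → 0+} (x - T(t) x) / t`,
with domain the set of all `x` for which this limit exists. -/
def negGenerator (T : C0Semigroup X) : Set (X × X) :=
  {z | Tendsto (fun t : ℝ≥0 => ((t : ℝ)⁻¹ : ℝ) • (z.1 - T.toFun t z.1)) (𝓝[>] 0) (𝓝 z.2)}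

end C0Semigroup

/-- The graph of the Balakrishnan operator
`x ↦ (sin (π θ) / π) ∫_0^∞ s ^ (θ - 1) (s + A)⁻¹ A x ds`, `x ∈ dom A`, of an operator `A`
(given by its graph). In the definition, `z = A x` and `R s = (s + A)⁻¹ z`. -/
def balakrishnan {X : Type*} [NormedAddCommGroup X] [NormedSpace ℂ X]
    (A : Set (X × X)) (θ : ℝ) : Set (X × X) :=
  {w | ∃ z : X, (w.1, z) ∈ A ∧ ∃ R : ℝ → X,
      (∀ s : ℝ, 0 < s → (R s, z - s • R s) ∈ A) ∧
      IntegrableOn (fun s : ℝ => s ^ (θ - 1) • R s) (Ioi 0) ∧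
      w.2 = (Real.sin (Real.pi * θ) / Real.pi) • ∫ s in Ioi (0 : ℝ), s ^ (θ - 1) • R s}

/-- The graph of the fractional power `A ^ θ`, `0 < θ < 1`, of a densely defined sectorial
operator `A` (which need not be injective): the closure of the Balakrishnan operator. -/
def fracPow {X : Type*} [NormedAddCommGroup X] [NormedSpace ℂ X]
    (A : Set (X × X)) (θ : ℝ) : Set (X × X) :=
  closure (balakrishnan A θ)

/-! ### Lipschitz surfaces and the surface gradient

The space dimension is `d = n + 1`. -/

/-- `ℝ^m` with the Euclidean norm. -/
abbrev RSpace (m : ℕ) := EuclideanSpace ℝ (Fin m)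

/-- `ℂ^m` with the Hermitian norm. -/
abbrev CSpace (m : ℕ) := EuclideanSpace ℂ (Fin m)

/-- Lipschitz graph coordinates `g(y) = Q (y, h(y)) + x*`, `y ∈ U`, in `ℝ^(n+1)`. -/
structure GraphCoord (n : ℕ) where
  U : Set (RSpace n)
  isOpen_U : IsOpen U
  Q : RSpace (n + 1) ≃ₗᵢ[ℝ] RSpace (n + 1)
  base : RSpace (n + 1)
  h : RSpace n → ℝ
  lipschitz_h : ∃ K : ℝ≥0, LipschitzOnWith K h U

/-- The coordinate map `g` (only its values on `U` matter). -/
noncomputable def GraphCoord.g {n : ℕ} (c : GraphCoord n) (y : RSpace n) : RSpace (n + 1) :=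
  c.Q (WithLp.toLp 2 (Fin.snoc (α := fun _ => ℝ) (fun i => y i) (c.h y))) + c.base

/-- `c` are graph coordinates for `𝒮` around `x`. -/
def GraphCoord.IsCoordAt {n : ℕ} (c : GraphCoord n) (𝒮 : Set (RSpace (n + 1)))
    (x : RSpace (n + 1)) : Prop :=
  ∃ V : Set (RSpace (n + 1)), IsOpen V ∧ x ∈ V ∧ BijOn c.g c.U (𝒮 ∩ V)

/-- `c` are graph coordinates for `𝒮` around `x = g(y)` which are differentiable at `y`. -/
def GraphCoord.IsRegularAt {n : ℕ} (c : GraphCoord n) (𝒮 : Set (RSpace (n + 1)))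
    (x : RSpace (n + 1)) (y : RSpace n) : Prop :=
  c.IsCoordAt 𝒮 x ∧ y ∈ c.U ∧ c.g y = x ∧ DifferentiableAt ℝ c.g y

/-- Lipschitz hypersurfaces in graph representation. -/
def IsLipschitzHypersurface {n : ℕ} (𝒮 : Set (RSpace (n + 1))) : Prop :=
  ∀ x ∈ 𝒮, ∃ c : GraphCoord n, c.IsCoordAt 𝒮 x

/-- `m`-dimensional Lipschitz submanifolds of `ℝ^d`: locally the image of
`]0,1[^m × {0}` under a bi-Lipschitz map. (A compact set with this property for `m = 0` is
a finite set.) -/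
def IsLipschitzSubmanifold {d : ℕ} (m : ℕ) (𝒮 : Set (RSpace d)) : Prop :=
  ∀ x ∈ 𝒮, ∃ V : Set (RSpace d), IsOpen V ∧ x ∈ V ∧ ∃ (φ : RSpace d → RSpace d) (K : ℝ), 0 < K ∧
    (∀ a ∈ V, ∀ b ∈ V, K⁻¹ * dist a b ≤ dist (φ a) (φ b) ∧ dist (φ a) (φ b) ≤ K * dist a b) ∧
    φ '' (𝒮 ∩ V) =
      {y | (∀ i : Fin d, (i : ℕ) < m → 0 < y i ∧ y i < 1) ∧ ∀ i : Fin d, m ≤ (i : ℕ) → y i = 0}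

/-- The tangent space `T_x 𝒮` (empty if `x` is not a regular point). -/
def tangentSet {n : ℕ} (𝒮 : Set (RSpace (n + 1))) (x : RSpace (n + 1)) : Set (RSpace (n + 1)) :=
  {v | ∃ (c : GraphCoord n) (y : RSpace n), c.IsRegularAt 𝒮 x y ∧ ∃ ξ, v = fderiv ℝ c.g y ξ}

/-- The gradient of a complex valued function on `ℝ^m`. -/
noncomputable def cgrad {m : ℕ} (u : RSpace m → ℂ) (x : RSpace m) : CSpace m :=
  WithLp.toLp 2 fun i => fderiv ℝ u x (EuclideanSpace.single i 1)

/-- The Jacobian matrix `g'(y)`. -/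
noncomputable def GraphCoord.jac {n : ℕ} (c : GraphCoord n) (y : RSpace n) :
    Matrix (Fin (n + 1)) (Fin n) ℝ :=
  Matrix.of fun i j => fderiv ℝ c.g y (EuclideanSpace.single j 1) i

/-- The surface gradient in coordinates, `g'(y) G(y)⁻¹ ∇(u ∘ g)(y)` with `G = g'ᵀ g'`. -/
noncomputable def GraphCoord.surfGradIn {n : ℕ} (c : GraphCoord n) (u : RSpace (n + 1) → ℂ)
    (y : RSpace n) : CSpace (n + 1) :=
  WithLp.toLp 2 (Matrix.mulVec
    ((c.jac y * ((c.jac y).transpose * c.jac y)⁻¹).map (fun t : ℝ => (t : ℂ)))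
    (fun j => cgrad (u ∘ c.g) y j))

open Classical in
/-- The surface gradient `∇_𝒮 u` at the regular points of `𝒮` (almost all points), for a function
`u` which is smooth near `𝒮`; it does not depend on the regular coordinates chosen. -/
noncomputable def surfGrad {n : ℕ} (𝒮 : Set (RSpace (n + 1))) (u : RSpace (n + 1) → ℂ)
    (x : RSpace (n + 1)) : CSpace (n + 1) :=
  if H : ∃ p : GraphCoord n × RSpace n, p.1.IsRegularAt 𝒮 x p.2 then
    H.choose.1.surfGradIn u H.choose.2 else 0

/-! ### The geometric setting and the coefficients -/

/-- The data of the problem in `ℝ^(n+1)`: the domain `Ω`, the boundary parts `ΓD`, `ΓN`, `Γd`, the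
interface `Sig`, the set `S` of codimension `k` and the exponent `γ` which describe the
degeneracy of the bulk diffusion, the diffusion coefficients `μΩ`, `μd` (on `Γd`),
`μs` (on `Sig`), and the weights `wd`, `ws` describing the degeneracy of the latter two. -/
structure DiffusionData (n : ℕ) where
  Ω : Set (RSpace (n + 1))
  ΓD : Set (RSpace (n + 1))
  ΓN : Set (RSpace (n + 1))
  Γd : Set (RSpace (n + 1))
  Sig : Set (RSpace (n + 1))
  S : Set (RSpace (n + 1))
  k : ℕ
  γ : ℝ
  μΩ : RSpace (n + 1) → Matrix (Fin (n + 1)) (Fin (n + 1)) ℝ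
  μd : RSpace (n + 1) → Matrix (Fin (n + 1)) (Fin (n + 1)) ℝ
  μs : RSpace (n + 1) → Matrix (Fin (n + 1)) (Fin (n + 1)) ℝ
  wd : RSpace (n + 1) → ℝ
  ws : RSpace (n + 1) → ℝ

/-- On the set `𝒮`, the coefficient `μ` is measurable and, up to constants, bounded by `w` and, on
the vectors in `T x`, bounded below by `w`. -/
def IsDiffusionCoeff {m : ℕ} (𝒮 : Set (RSpace m)) (T : RSpace m → Set (RSpace m))
    (w : RSpace m → ℝ) (μ : RSpace m → Matrix (Fin m) (Fin m) ℝ) : Prop :=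
  (∀ i j, Measurable fun x : 𝒮 => μ x i j) ∧
  (∃ c₁ : ℝ, 0 < c₁ ∧ ∀ x ∈ 𝒮, ∀ ξ ∈ T x,
    c₁ * w x * ‖ξ‖ ^ 2 ≤ ∑ i, (Matrix.mulVec (μ x) (fun j => ξ j) i) * ξ i) ∧
  ∃ c₂ : ℝ, 0 < c₂ ∧ ∀ x ∈ 𝒮, ∀ ξ : RSpace m,
    ‖(WithLp.toLp 2 (Matrix.mulVec (μ x) (fun j => ξ j)) : RSpace m)‖ ≤ c₂ * w x * ‖ξ‖

namespace DiffusionData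

variable {n : ℕ}

/-- The bulk weight `dist(x, S) ^ γ`. For `γ = 0` it is the constant `1`. -/
noncomputable def wΩ (D : DiffusionData n) (x : RSpace (n + 1)) : ℝ := Metric.infDist x D.S ^ D.γ

/-- The standing assumptions. The choice `γ = 0` (for instance with `S = ∅`) is the case of
nondegenerate bulk diffusion. -/
structure Admissible (D : DiffusionData n) : Prop where
  dim : 1 ≤ n
  isOpen_Ω : IsOpen D.Ω
  isConnected_Ω : IsConnected D.Ω
  isBounded_Ω : Bornology.IsBounded D.Ω
  -- the disjoint decomposition of the boundary
  frontier_Ω : frontier D.Ω = D.ΓD ∪ D.ΓN ∪ D.Γd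
  disjoint_DN : Disjoint D.ΓD D.ΓN
  disjoint_Dd : Disjoint D.ΓD D.Γd
  disjoint_Nd : Disjoint D.ΓN D.Γd
  isClosed_ΓD : IsClosed D.ΓD
  Sig_subset : D.Sig ⊆ D.Ω
  hypersurface_Γd : IsLipschitzHypersurface D.Γd
  hypersurface_Sig : IsLipschitzHypersurface D.Sig
  submanifold_ΓN : IsLipschitzSubmanifold n D.ΓN
  closure_ΓN : ∃ M, IsLipschitzSubmanifold n M ∧ closure D.ΓN ⊆ M
  closure_Γd : ∃ M, IsLipschitzSubmanifold n M ∧ closure D.Γd ⊆ M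
  closure_Sig : ∃ M, IsLipschitzSubmanifold n M ∧ closure D.Sig ⊆ M
  -- the bulk weight
  one_le_k : 1 ≤ D.k
  k_le : D.k ≤ n + 1
  isCompact_S : IsCompact D.S
  S_subset : D.S ⊆ closure D.Ω
  submanifold_S : IsLipschitzSubmanifold (n + 1 - D.k) D.S
  zero_le_γ : 0 ≤ D.γ
  γ_lt : D.γ < D.k
  nonempty_S : D.γ = 0 ∨ D.S.Nonempty
  away_or_small : Disjoint D.S (closure (D.Γd ∪ D.Sig)) ∨ D.γ < 1
  -- the coefficients
  coeff_Ω : IsDiffusionCoeff D.Ω (fun _ => univ) D.wΩ D.μΩ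
  coeff_Γd : IsDiffusionCoeff D.Γd (tangentSet D.Γd) D.wd D.μd
  coeff_Sig : IsDiffusionCoeff D.Sig (tangentSet D.Sig) D.ws D.μs
  measurable_wd : Measurable fun x : D.Γd => D.wd x
  measurable_ws : Measurable fun x : D.Sig => D.ws x
  nonneg_wd : ∀ x ∈ D.Γd, 0 ≤ D.wd x
  nonneg_ws : ∀ x ∈ D.Sig, 0 ≤ D.ws x
  bounded_wd : ∃ C, ∀ x ∈ D.Γd, D.wd x ≤ C
  bounded_ws : ∃ C, ∀ x ∈ D.Sig, D.ws x ≤ C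

/-! ### The measures and the spaces `𝕃^p` -/

/-- Lebesgue measure on `Ω`. -/
noncomputable def bulk (D : DiffusionData n) : Measure (RSpace (n + 1)) :=
  volume.restrict D.Ω

/-- The `(d-1)`-dimensional Hausdorff measure on `Γd`. -/
noncomputable def surfd (D : DiffusionData n) : Measure (RSpace (n + 1)) :=
  (Measure.euclideanHausdorffMeasure n).restrict D.Γd

/-- The `(d-1)`-dimensional Hausdorff measure on `Sig`. -/
noncomputable def surfs (D : DiffusionData n) : Measure (RSpace (n + 1)) :=
  (Measure.euclideanHausdorffMeasure n).restrict D.Sig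

/-- The measure `dx + dℋ_{d-1}` on `(Ω \ Sig) ∪ Γd ∪ Sig`. -/
noncomputable def total (D : DiffusionData n) : Measure (RSpace (n + 1)) :=
  volume.restrict (D.Ω \ D.Sig) + D.surfd + D.surfs

/-- The space `𝕃^p`. -/
noncomputable abbrev LL (D : DiffusionData n) (p : ℝ≥0∞) := Lp ℂ p D.total

/-! ### The form domain, the form and the map `J` -/

/-- `μ` with the density `w`. -/
noncomputable def weighted (μ : Measure (RSpace (n + 1))) (w : RSpace (n + 1) → ℝ) :
    Measure (RSpace (n + 1)) :=
  μ.withDensity fun x => ENNReal.ofReal (w x)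

/-- Restrictions of functions in `C_D^∞(Ω)`: smooth compactly supported functions on `ℝ^d` with
support away from `ΓD`. -/
def TestFun (D : DiffusionData n) : Set (RSpace (n + 1) → ℂ) :=
  {u | ContDiff ℝ ∞ u ∧ HasCompactSupport u ∧ Disjoint (tsupport u) D.ΓD}

/-- `L²(Ω) × L²(Ω, wΩ; ℂ^d) × L²(Γd, wd; ℂ^d) × L²(Sig, ws; ℂ^d)`. -/
noncomputable abbrev FormSpace (D : DiffusionData n) :=
  Lp ℂ 2 D.bulk × Lp (CSpace (n + 1)) 2 (weighted D.bulk D.wΩ) ×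
    Lp (CSpace (n + 1)) 2 (weighted D.surfd D.wd) × Lp (CSpace (n + 1)) 2 (weighted D.surfs D.ws)

/-- `U = (u, ∇u, ∇_{Γd} u, ∇_{Sig} u)`. By definition, the norm of `dom(t)` of a test function
`u` is the `ℓ²`-product norm of this quadruple, which is equivalent to the norm of `FormSpace`. -/
noncomputable def Represents (D : DiffusionData n) (u : RSpace (n + 1) → ℂ) (U : D.FormSpace) : Prop :=
  U.1 =ᵐ[D.bulk] u ∧
  U.2.1 =ᵐ[weighted D.bulk D.wΩ] cgrad u ∧
  U.2.2.1 =ᵐ[weighted D.surfd D.wd] surfGrad D.Γd u ∧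
  U.2.2.2 =ᵐ[weighted D.surfs D.ws] surfGrad D.Sig u

/-- The Hilbert space `dom(t)`, the completion of `C_D^∞(Ω)`, realized as the closure of the
canonical copy of `C_D^∞(Ω)` in the complete space `FormSpace`. -/
noncomputable def formDom (D : DiffusionData n) : Set D.FormSpace :=
  closure {U | ∃ u ∈ D.TestFun, D.Represents u U}

/-- `∫ (μ F, conj G) dm` for vector fields `F`, `G`. -/
noncomputable def coeffForm (m : Measure (RSpace (n + 1)))
    (μ : RSpace (n + 1) → Matrix (Fin (n + 1)) (Fin (n + 1)) ℝ)
    (F G : RSpace (n + 1) → CSpace (n + 1)) : ℂ :=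
  ∫ x, ∑ i, ∑ j, (μ x i j : ℂ) * F x j * (starRingEnd ℂ) (G x i) ∂m

/-- The sesquilinear form `t`. (Where a weight vanishes, so does the corresponding coefficient,
so that the integrals do not depend on the representatives.) -/
noncomputable def form (D : DiffusionData n) (U V : D.FormSpace) : ℂ :=
  coeffForm D.bulk D.μΩ U.2.1 V.2.1 + coeffForm D.surfd D.μd U.2.2.1 V.2.2.1 +
    coeffForm D.surfs D.μs U.2.2.2 V.2.2.2

/-- The graph of `J : dom(t) → 𝕃²`, the continuous extension of
`u ↦ (u, u|_{Γd}, u|_{Sig})` from `C_D^∞(Ω)` to `dom(t)`: we have `J U = φ` if and only if there are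
test functions `u_k` with `u_k → U` in `dom(t)` and `(u_k, u_k|_{Γd}, u_k|_{Sig}) → φ` in `𝕃²`. -/
def graphJ (D : DiffusionData n) : Set (D.FormSpace × D.LL 2) :=
  closure {z | ∃ u ∈ D.TestFun, D.Represents u z.1 ∧ z.2 =ᵐ[D.total] u}

/-! ### The operators `A_p` -/

/-- The graph of the operator `A_2` on `𝕃²` associated with the form `t`: `A_2 φ = ψ` iff
there is `U ∈ dom(t)` with `φ = J U` and `(ψ, J V) = t(U, V)` for all `V ∈ dom(t)`. -/
noncomputable def A2 (D : DiffusionData n) : Set (D.LL 2 × D.LL 2) :=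
  {z | ∃ U ∈ D.formDom, (U, z.1) ∈ D.graphJ ∧
    ∀ V ∈ D.formDom, ∀ χ : D.LL 2, (V, χ) ∈ D.graphJ → inner ℂ χ z.2 = D.form U V}

/-- The `C₀`-semigroup `T_2` on `𝕃²` generated by `-A_2`. -/
noncomputable def T2 (D : DiffusionData n) : C0Semigroup (D.LL 2) :=
  Classical.epsilon fun T => T.negGenerator = D.A2

/-- A semigroup on `𝕃^p` is consistent with `T_2` if both agree on `𝕃^p ∩ 𝕃²`. -/
def Consistent (D : DiffusionData n) {p : ℝ≥0∞} [Fact (1 ≤ p)] (T : C0Semigroup (D.LL p)) : Prop :=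
  ∀ (f : D.LL p) (g : D.LL 2), f =ᵐ[D.total] g →
    ∀ t, T.toFun t f =ᵐ[D.total] D.T2.toFun t g

/-- The `C₀`-semigroup `T_p` on `𝕃^p`, the consistent extension of `T_2`. -/
noncomputable def Tp (D : DiffusionData n) (p : ℝ≥0∞) [Fact (1 ≤ p)] : C0Semigroup (D.LL p) :=
  Classical.epsilon fun T => D.Consistent T

/-- The graph of `A_p`, the negative generator of `T_p`. -/
def Ap (D : DiffusionData n) (p : ℝ≥0∞) [Fact (1 ≤ p)] : Set (D.LL p × D.LL p) :=
  (D.Tp p).negGenerator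

end DiffusionData

/-! Put a = r/((r-2)p), so that a < θ < 1. The theorem rests on the resolvent estimate ‖(l + A)⁻¹
f‖_∞ ≤ C l^(a-1) ‖f‖_p for l ≥ 1. Granted this, the integral of s^(-θ) (s + 1 + A)⁻¹ over (0, ∞), a
multiple of (1 + A)^(-θ), converges as an operator from 𝕃^p to 𝕃^∞: near 0 because θ < 1, near
infinity because a - 1 - θ < -1. It remains to control (1 + A)^θ u in 𝕃^p by u and A^θ u.

For u in the domain of A, a multiple of (1 + A)^θ u is W = ∫ σ^(θ-1) (σ + 1 + A)⁻¹ (1 + A) u dσ.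
Subtracting the Balakrishnan integrand σ^(θ-1) (σ + A)⁻¹ A u leaves σ^(θ-1) · σ (σ + A)⁻¹ (σ + 1 +
A)⁻¹ u, which is absolutely integrable in 𝕃^p (`MAccretive.exists_re_inner_eq_integral`). That the
negative power recovers u from W follows from the resolvent identity, which turns the double
integral into one of difference quotients, and from Frullani's integral
(`integral_difference_quotient`). The outcome is a weak bound Re (h, u) ≤ K (‖u‖ + ‖A^θ u‖) ‖h‖_1.
It is a closed condition, so it passes to the closure that defines A^θ, and duality gives the bound
in 𝕃^∞.

The resolvent estimate is Stampacchia's. The form domain is stable under u ↦ (Re u - k)⁺, with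
gradient 1_{Re u > k} Re ∇u (`exists_truncation`). Testing with these functions and using the
Sobolev inequality, which the closed graph theorem extracts from the inclusion in 𝕃^r, gives a
recursive inequality for the measures of the level sets. The iteration starts at the level l^(a-1)
‖f‖_p, whose level set is already small because ‖(l + A)⁻¹ f‖_p ≤ 4 l⁻¹ ‖f‖_p; this produces the
power of l.

The 𝕃^p bounds come from testing with differences of truncations: ∫ Re Aφ over {Re φ > k} is
nonnegative, so the truncated means ∫ (Re f - k)⁺ do not increase under normalized resolvents, hence
not along the semigroup. Integration against k^(p-2) dk recovers the 𝕃^p norms. In this way T_2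
restricts to 𝕃^p, and A_p is contained in A_2.

Finally, A_2 is m-accretive by Lax–Milgram on the graph of J, and T_2 exists by the Hille–Yosida
construction (`MAccretive.exists_semigroup`). -/

/-! ### Maximal accretive relations in a Hilbert space -/

section MAccretive

variable {H : Type*} [NormedAddCommGroup H] [InnerProductSpace ℂ H]

/-- Densely defined maximal accretive linear relations. -/
structure MAccretive (A : Submodule ℂ (H × H)) : Prop where
  accretive : ∀ z ∈ A, 0 ≤ (inner ℂ z.1 z.2).re
  range : ∀ l : ℝ, 0 < l → ∀ f : H, ∃ φ : H, (φ, f - l • φ) ∈ A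
  dense : Dense {φ : H | ∃ ψ, (φ, ψ) ∈ A}

lemma re_inner_real_smul (l : ℝ) (x y : H) :
    (inner ℂ x (l • y)).re = l * (inner ℂ x y).re := by
  rw [show l • y = (l : ℂ) • y from (Complex.coe_smul l y).symm, inner_smul_right]
  simp

lemma re_inner_self (x : H) : (inner ℂ x x).re = ‖x‖ ^ 2 := by
  rw [inner_self_eq_norm_sq_to_K]; norm_cast

lemma real_smul_mem {A : Submodule ℂ (H × H)} {z : H × H} (hz : z ∈ A) (l : ℝ) : l • z ∈ A := by
  rw [show l • z = (l : ℂ) • z from (Complex.coe_smul l z).symm]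
  exact A.smul_mem _ hz

namespace MAccretive

variable {A : Submodule ℂ (H × H)}

lemma norm_le (hA : MAccretive A) {l : ℝ} (hl : 0 < l) {f φ : H} (h : (φ, f - l • φ) ∈ A) :
    ‖φ‖ ≤ l⁻¹ * ‖f‖ := by
  have h1 := hA.accretive _ h
  simp only [inner_sub_right, Complex.sub_re, re_inner_real_smul, re_inner_self] at h1
  have h2 : (inner ℂ φ f).re ≤ ‖φ‖ * ‖f‖ :=
    (Complex.re_le_norm _).trans (norm_inner_le_norm φ f)
  rw [inv_mul_eq_div, le_div_iff₀ hl]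
  rcases (norm_nonneg φ).eq_or_lt with h0 | h0
  · rw [← h0]; simp
  · nlinarith

lemma unique (hA : MAccretive A) {l : ℝ} (hl : 0 < l) {f φ φ' : H} (h : (φ, f - l • φ) ∈ A)
    (h' : (φ', f - l • φ') ∈ A) : φ = φ' := by
  have h2 : (φ - φ', (0 : H) - l • (φ - φ')) ∈ A := by
    convert! A.sub_mem h h' using 1
    rw [Prod.mk_sub_mk, smul_sub]; congr 1; abel
  have := hA.norm_le hl h2
  rw [norm_zero, mul_zero] at this
  exact sub_eq_zero.1 (norm_le_zero_iff.1 this)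

lemma exists_resolvent (hA : MAccretive A) : ∃ R : ℝ → H →L[ℂ] H, ∀ l : ℝ, 0 < l →
    (∀ f, (R l f, f - l • R l f) ∈ A) := by
  have (l : ℝ) : ∃ S : H →L[ℂ] H, 0 < l → (∀ f, (S f, f - l • S f) ∈ A) := by
    by_cases hl : 0 < l
    · choose S hS using hA.range l hl
      refine ⟨LinearMap.mkContinuous
        { toFun := S
          map_add' := fun f g => hA.unique hl (hS _) ?_
          map_smul' := fun c f => hA.unique hl (hS _) ?_ } l⁻¹ fun f => hA.norm_le hl (hS f),
        fun _ => hS⟩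
      · convert! A.add_mem (hS f) (hS g) using 1
        rw [Prod.mk_add_mk, smul_add]; congr 1; abel
      · convert! A.smul_mem c (hS f) using 1
        rw [Prod.smul_mk, smul_sub, smul_comm]; rfl
    · exact ⟨0, fun h => absurd h hl⟩
  choose R hR using this
  exact ⟨R, hR⟩

/-- The resolvent `(l + A)⁻¹`, for `l > 0`. -/
noncomputable def res (hA : MAccretive A) : ℝ → H →L[ℂ] H := hA.exists_resolvent.choose

variable (hA : MAccretive A)
include hA

lemma res_mem {l : ℝ} (hl : 0 < l) (f : H) : (hA.res l f, f - l • hA.res l f) ∈ A :=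
  hA.exists_resolvent.choose_spec l hl f

lemma res_eq {l : ℝ} (hl : 0 < l) {f φ : H} (h : (φ, f - l • φ) ∈ A) : hA.res l f = φ :=
  hA.unique hl (hA.res_mem hl f) h

lemma res_add {l : ℝ} (hl : 0 < l) {φ ψ : H} (h : (φ, ψ) ∈ A) :
    hA.res l (ψ + l • φ) = φ := hA.res_eq hl (by simpa using h)

lemma norm_res_apply_le {l : ℝ} (hl : 0 < l) (f : H) : ‖hA.res l f‖ ≤ l⁻¹ * ‖f‖ :=
  hA.norm_le hl (hA.res_mem hl f)

lemma res_sub_res {l k : ℝ} (hl : 0 < l) (hk : 0 < k) (f : H) :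
    hA.res l f - hA.res k f = (k - l) • hA.res l (hA.res k f) := by
  rw [sub_eq_iff_eq_add]
  refine hA.res_eq hl ?_
  have h1 := hA.res_mem hk f
  have h2 := real_smul_mem (hA.res_mem hl (hA.res k f)) (k - l)
  convert! A.add_mem h2 h1 using 1
  simp only [Prod.smul_mk, Prod.mk_add_mk, Prod.mk.injEq, true_and]
  module

lemma res_comm {l k : ℝ} (hl : 0 < l) (hk : 0 < k) (f : H) :
    hA.res l (hA.res k f) = hA.res k (hA.res l f) := by
  rcases eq_or_ne l k with rfl | h
  · rfl
  · have h1 := hA.res_sub_res hl hk f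
    have h2 := hA.res_sub_res hk hl f
    have h3 : (k - l) • hA.res l (hA.res k f) = (k - l) • hA.res k (hA.res l f) := by
      rw [← h1, ← neg_sub, h2, ← neg_smul, neg_sub]
    exact smul_right_injective H (sub_ne_zero.2 h.symm) h3

/-- On the domain l (l + A)⁻¹ φ - φ = -(l + A)⁻¹ ψ = O(1/l). The operators l (l + A)⁻¹ are
contractions, so density of the domain does the rest. -/
lemma tendsto_smul_res (f : H) : Tendsto (fun l : ℝ => l • hA.res l f) atTop (𝓝 f) := by
  have hbd : ∀ l : ℝ, 0 < l → ∀ g : H, ‖l • hA.res l g‖ ≤ ‖g‖ := fun l hl g => by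
    rw [norm_smul, Real.norm_of_nonneg hl.le]
    calc l * _ ≤ l * (l⁻¹ * ‖g‖) := by gcongr; exact hA.norm_res_apply_le hl g
      _ = ‖g‖ := by field_simp
  rw [Metric.tendsto_atTop]
  intro ε hε
  obtain ⟨φ, ⟨ψ, hψ⟩, hφ⟩ := Metric.mem_closure_iff.1 (hA.dense f) (ε / 3) (by positivity)
  refine ⟨3 * ‖ψ‖ / ε + 1, fun l hl => ?_⟩
  have hl0 : 0 < l := lt_of_lt_of_le (by positivity) hl
  have h1 : l • hA.res l φ - φ = - hA.res l ψ := by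
    have := hA.res_add hl0 hψ
    rw [map_add, ContinuousLinearMap.map_smul_of_tower] at this
    rw [← eq_sub_iff_add_eq'] at this
    rw [this]; abel
  have h2 : ‖hA.res l ψ‖ < ε / 3 := by
    refine (hA.norm_res_apply_le hl0 ψ).trans_lt ?_
    rw [inv_mul_eq_div, div_lt_iff₀ hl0]
    have : 3 * ‖ψ‖ / ε < l := by linarith
    rw [div_lt_iff₀ hε] at this
    linarith
  have h3 : l • hA.res l f - f = l • hA.res l (f - φ) + (l • hA.res l φ - φ) - (f - φ) := by
    rw [map_sub, smul_sub]; abel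
  rw [dist_eq_norm, h3, h1]
  have h4 := hbd l hl0 (f - φ)
  rw [dist_eq_norm] at hφ
  calc _ ≤ ‖l • hA.res l (f - φ)‖ + ‖- hA.res l ψ‖ + ‖f - φ‖ :=
        (norm_sub_le _ _).trans (by gcongr; exact norm_add_le _ _)
    _ < ε := by rw [norm_neg]; linarith

/-- The Yosida approximation `l - l² (l + A)⁻¹`. -/
noncomputable def yosida (l : ℝ) : H →L[ℂ] H := l • (1 - l • hA.res l)

omit hA in
lemma yosida_apply (hA : MAccretive A) (l : ℝ) (f : H) :
    hA.yosida l f = l • (f - l • hA.res l f) := rfl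

lemma yosida_of_mem {l : ℝ} (hl : 0 < l) {φ ψ : H} (h : (φ, ψ) ∈ A) :
    hA.yosida l φ = l • hA.res l ψ := by
  have := hA.res_add hl h
  rw [map_add, ContinuousLinearMap.map_smul_of_tower, ← eq_sub_iff_add_eq] at this
  rw [yosida_apply, this]

lemma yosida_commute {l k : ℝ} (hl : 0 < l) (hk : 0 < k) :
    Commute (hA.yosida l) (hA.yosida k) := by
  have : Commute (hA.res l) (hA.res k) := ContinuousLinearMap.ext fun f => hA.res_comm hl hk f
  unfold yosida
  refine Commute.smul_left (Commute.smul_right (Commute.sub_left (Commute.one_left _) ?_) _) _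
  exact Commute.sub_right (Commute.one_right _) ((this.smul_left _).smul_right _)

/-- The semigroup generated by the negative Yosida approximation. -/
noncomputable def yexp (l t : ℝ) : H →L[ℂ] H := NormedSpace.exp (t • (-hA.yosida l))

end MAccretive

lemma norm_normedSpace_exp_le {𝔸 : Type*} [NormedRing 𝔸] [NormedAlgebra ℝ 𝔸]
    [CompleteSpace 𝔸] [NormOneClass 𝔸] (a : 𝔸) : ‖NormedSpace.exp a‖ ≤ Real.exp ‖a‖ := by
  rw [NormedSpace.exp_eq_tsum ℝ, Real.exp_eq_exp_ℝ]
  refine tsum_of_norm_bounded (NormedSpace.expSeries_div_hasSum_exp ‖a‖) fun n => ?_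
  rw [norm_smul, norm_inv, Real.norm_of_nonneg (by positivity), inv_mul_eq_div]
  gcongr
  exact norm_pow_le a n

end MAccretive

section MAccretive

variable {H : Type*} [NormedAddCommGroup H] [InnerProductSpace ℂ H]

namespace MAccretive

variable {A : Submodule ℂ (H × H)} [CompleteSpace H]
variable (hA : MAccretive A)
include hA

lemma yexp_norm_le {l t : ℝ} (hl : 0 < l) (ht : 0 ≤ t) : ‖hA.yexp l t‖ ≤ 1 := by
  rcases subsingleton_or_nontrivial H with h | h
  · rw [Subsingleton.elim (hA.yexp l t) 0]; simp
  -- The scalar part -tl contributes exp (-tl), and the remaining part, tl times the contraction l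
  -- (l + A)⁻¹, contributes at most exp (tl).
  have h1 : t • (-hA.yosida l) = (algebraMap ℝ (H →L[ℂ] H) (-(t * l))) +
      (t * l) • (l • hA.res l) := by
    rw [Algebra.algebraMap_eq_smul_one]; unfold yosida; module
  have hle : ‖(t * l) • (l • hA.res l)‖ ≤ t * l := by
    rw [norm_smul, Real.norm_of_nonneg (by positivity)]
    have : ‖l • hA.res l‖ ≤ 1 := by
      rw [norm_smul, Real.norm_of_nonneg hl.le]
      have : ‖hA.res l‖ ≤ l⁻¹ :=
        ContinuousLinearMap.opNorm_le_bound _ (by positivity) (hA.norm_res_apply_le hl)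
      calc l * ‖hA.res l‖ ≤ l * l⁻¹ := by gcongr
        _ = 1 := by field_simp
    calc _ ≤ t * l * 1 := by gcongr
      _ = _ := mul_one _
  unfold yexp
  let _ : NormedAlgebra ℚ (H →L[ℂ] H) := NormedAlgebra.restrictScalars ℚ ℝ _
  rw [h1, NormedSpace.exp_add_of_commute (Algebra.commutes _ _), ← NormedSpace.algebraMap_exp_comm]
  refine (norm_mul_le _ _).trans ?_
  rw [norm_algebraMap', ← Real.exp_eq_exp_ℝ, Real.norm_of_nonneg (Real.exp_pos _).le]
  calc _ ≤ Real.exp (-(t * l)) * Real.exp (t * l) := by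
        gcongr
        exact (norm_normedSpace_exp_le _).trans (Real.exp_le_exp.2 hle)
    _ = 1 := by rw [← Real.exp_add]; simp

lemma norm_yexp_apply_le {l t : ℝ} (hl : 0 < l) (ht : 0 ≤ t) (x : H) : ‖hA.yexp l t x‖ ≤ ‖x‖ := by
  simpa using (hA.yexp l t).le_of_opNorm_le (hA.yexp_norm_le hl ht) x

omit hA [CompleteSpace H] in
lemma yexp_zero (hA : MAccretive A) (l : ℝ) : hA.yexp l 0 = 1 := by
  simp [yexp, NormedSpace.exp_zero]

omit hA in
lemma yexp_add (hA : MAccretive A) (l s t : ℝ) :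
    hA.yexp l (s + t) = hA.yexp l s * hA.yexp l t := by
  let _ : NormedAlgebra ℚ (H →L[ℂ] H) := NormedAlgebra.restrictScalars ℚ ℝ _
  rw [yexp, add_smul, NormedSpace.exp_add_of_commute]
  · rfl
  · exact ((Commute.refl _).smul_left _).smul_right _

lemma hasDerivAt_yexp (l t : ℝ) :
    HasDerivAt (hA.yexp l) (hA.yexp l t * (-hA.yosida l)) t :=
  hasDerivAt_exp_smul_const (𝕂 := ℝ) (-hA.yosida l) t

lemma hasDerivAt_yexp_apply (l t : ℝ) (x : H) :
    HasDerivAt (fun t => hA.yexp l t x) (-(hA.yexp l t (hA.yosida l x))) t := by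
  have := (ContinuousLinearMap.apply ℂ H x).restrictScalars ℝ |>.hasFDerivAt.comp_hasDerivAt t
    (hA.hasDerivAt_yexp l t)
  refine (this.congr_deriv ?_)
  simp

/-- The product of the semigroups at times t - s and s interpolates between them. As the Yosida
approximations commute, its derivative in s is a contraction applied to the difference of the two
approximations at x. -/
lemma yexp_sub_le {l k t : ℝ} (hl : 0 < l) (hk : 0 < k) (ht : 0 ≤ t) (x : H) :
    ‖hA.yexp k t x - hA.yexp l t x‖ ≤ ‖hA.yosida l x - hA.yosida k x‖ * t := by
  have hc : ∀ s, Commute (hA.yosida l) (hA.yexp k s) := fun s => by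
    unfold yexp
    exact (((hA.yosida_commute hl hk).neg_right).smul_right _).exp_right
  have hd : ∀ s, HasDerivAt (fun s => (hA.yexp l (t - s) * hA.yexp k s) x)
      ((hA.yexp l (t - s) * hA.yexp k s) (hA.yosida l x - hA.yosida k x)) s := fun s => by
    have h1 : HasDerivAt (fun s => hA.yexp l (t - s)) (hA.yexp l (t - s) * hA.yosida l) s := by
      have := (hA.hasDerivAt_yexp l (t - s)).scomp s ((hasDerivAt_id s).const_sub t)
      refine this.congr_deriv ?_
      simp
    have h2 := h1.mul (hA.hasDerivAt_yexp k s)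
    have := (ContinuousLinearMap.apply ℂ H x).restrictScalars ℝ |>.hasFDerivAt.comp_hasDerivAt s h2
    refine this.congr_deriv ?_
    have h3 : hA.yexp l (t - s) * hA.yosida l * hA.yexp k s +
      hA.yexp l (t - s) * (hA.yexp k s * -hA.yosida k) =
      (hA.yexp l (t - s) * hA.yexp k s) * (hA.yosida l - hA.yosida k) := by
      rw [mul_assoc, (hc s).eq]; noncomm_ring
    rw [h3]; rfl
  have := norm_image_sub_le_of_norm_deriv_le_segment' (a := 0) (b := t)
    (C := ‖hA.yosida l x - hA.yosida k x‖)
    (fun s _ => (hd s).hasDerivWithinAt) (fun s hs => ?_) t ⟨ht, le_rfl⟩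
  · simpa [yexp_zero] using this
  · refine (hA.norm_yexp_apply_le hl (by linarith [hs.2]) _).trans ?_
    exact hA.norm_yexp_apply_le hk hs.1 _

lemma cauchySeq_yexp {t : ℝ} (ht : 0 ≤ t) (x : H) :
    CauchySeq fun n : ℕ => hA.yexp (n + 1) t x := by
  have hn : ∀ n : ℕ, (0 : ℝ) < n + 1 := fun n => by positivity
  rw [Metric.cauchySeq_iff']
  intro ε hε
  obtain ⟨φ, ⟨ψ, hψ⟩, hφ⟩ := Metric.mem_closure_iff.1 (hA.dense x) (ε / 4) (by positivity)
  have h1 : CauchySeq fun n : ℕ => hA.yosida (n + 1) φ := by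
    have : Tendsto (fun n : ℕ => hA.yosida ((n : ℝ) + 1) φ) atTop (𝓝 ψ) := by
      simp_rw [hA.yosida_of_mem (hn _) hψ]
      exact (hA.tendsto_smul_res ψ).comp
        (tendsto_atTop_add_const_right _ _ tendsto_natCast_atTop_atTop)
    exact this.cauchySeq
  obtain ⟨N, hN⟩ := Metric.cauchySeq_iff'.1 h1 (ε / (4 * (t + 1))) (by positivity)
  refine ⟨N, fun n hnN => ?_⟩
  have h2 := hA.yexp_sub_le (hn N) (hn n) ht φ
  have h3 := hN n hnN
  rw [dist_comm, dist_eq_norm] at h3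
  have h4 : ‖hA.yosida (N + 1) φ - hA.yosida (n + 1) φ‖ * t ≤ ε / 4 := by
    calc _ ≤ ε / (4 * (t + 1)) * (t + 1) := by gcongr; linarith
      _ = ε / 4 := by field_simp
  rw [dist_eq_norm] at hφ ⊢
  have h5 := hA.norm_yexp_apply_le (hn n) ht (x - φ)
  have h6 := hA.norm_yexp_apply_le (hn N) ht (x - φ)
  have h7 : hA.yexp (n + 1) t x - hA.yexp (N + 1) t x = hA.yexp (n + 1) t (x - φ)
      + (hA.yexp (n + 1) t φ - hA.yexp (N + 1) t φ) - hA.yexp (N + 1) t (x - φ) := by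
    simp only [map_sub]; abel
  rw [h7]
  calc _ ≤ ‖hA.yexp (n + 1) t (x - φ)‖ + ‖hA.yexp (n + 1) t φ - hA.yexp (N + 1) t φ‖
      + ‖hA.yexp (N + 1) t (x - φ)‖ := (norm_sub_le _ _).trans (by gcongr; exact norm_add_le _ _)
    _ < ε := by linarith

lemma exists_lim (t : ℝ≥0) : ∃ S : H →L[ℂ] H,
    ∀ x, Tendsto (fun n : ℕ => hA.yexp (n + 1) t x) atTop (𝓝 (S x)) := by
  choose S hS using fun x => cauchySeq_tendsto_of_complete (hA.cauchySeq_yexp t.2 x)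
  exact ⟨continuousLinearMapOfTendsto (fun n : ℕ => hA.yexp (n + 1) t) (tendsto_pi_nhds.2 hS), hS⟩

/-- Hille–Yosida: T is the strong limit of the exponentials of the Yosida approximations. It is
first shown that A is contained in the negative generator; equality holds because 1 + A is already
onto and T is contractive. -/
lemma exists_semigroup : ∃ T : C0Semigroup H, T.negGenerator = A := by
  have hn : ∀ n : ℕ, (0 : ℝ) < n + 1 := fun n => by positivity
  choose S hS using hA.exists_lim
  have hbd : ∀ t x, ‖S t x‖ ≤ ‖x‖ := fun t x =>
    le_of_tendsto (hS t x).norm (Eventually.of_forall fun n => hA.norm_yexp_apply_le (hn n) t.2 x)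
  have hlip : ∀ φ ψ, (φ, ψ) ∈ A → ∀ s t : ℝ≥0, ‖S t φ - S s φ‖ ≤ ‖ψ‖ * |(t : ℝ) - s| := by
    intro φ ψ h
    have key : ∀ s t : ℝ≥0, s ≤ t → ‖S t φ - S s φ‖ ≤ ‖ψ‖ * ((t : ℝ) - s) := fun s t hst => by
      refine le_of_tendsto ((hS t φ).sub (hS s φ)).norm (Eventually.of_forall fun n => ?_)
      refine norm_image_sub_le_of_norm_deriv_le_segment' (a := (s : ℝ)) (b := t)
        (fun u _ => (hA.hasDerivAt_yexp_apply (n + 1) u φ).hasDerivWithinAt)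
        (fun u hu => ?_) t ⟨hst, le_rfl⟩
      rw [norm_neg]
      refine (hA.norm_yexp_apply_le (hn n) (s.2.trans hu.1) _).trans ?_
      rw [hA.yosida_of_mem (hn n) h, norm_smul, Real.norm_of_nonneg (hn n).le]
      calc _ ≤ ((n : ℝ) + 1) * (((n : ℝ) + 1)⁻¹ * ‖ψ‖) := by
            gcongr; exact hA.norm_res_apply_le (hn n) _
        _ = ‖ψ‖ := by have := (hn n).ne'; field_simp
    intro s t
    rcases le_total s t with hst | hst
    · rw [abs_of_nonneg (by simpa using hst)]; exact key s t hst
    · rw [norm_sub_rev, abs_sub_comm, abs_of_nonneg (by simpa using hst)]; exact key t s hst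
  have hcont : ∀ x, Continuous fun t => S t x := fun x => by
    refine continuous_of_uniform_approx_of_continuous fun u hu => ?_
    obtain ⟨ε, hε, hεu⟩ := Metric.mem_uniformity_dist.1 hu
    obtain ⟨φ, ⟨ψ, hψ⟩, hφ⟩ := Metric.mem_closure_iff.1 (hA.dense x) ε hε
    refine ⟨fun t => S t φ, ?_, fun t => hεu ?_⟩
    · refine (LipschitzWith.of_dist_le_mul (K := ‖ψ‖₊) fun t s => ?_).continuous
      rw [dist_eq_norm]
      exact hlip φ ψ hψ s t
    · rw [dist_eq_norm, ← map_sub]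
      exact (hbd t _).trans_lt (by rwa [dist_eq_norm] at hφ)
  let T : C0Semigroup H :=
    { toFun := S
      map_zero' := by
        ext x
        refine tendsto_nhds_unique (hS 0 x) ?_
        simp [yexp_zero]
      map_add' := fun s t => by
        ext x
        refine tendsto_nhds_unique (hS (s + t) x) ?_
        have h1 : Tendsto (fun n : ℕ => hA.yexp (n + 1) s (S t x)) atTop (𝓝 (S s (S t x))) := hS s _
        have h2 : Tendsto (fun n : ℕ => hA.yexp (n + 1) s (hA.yexp (n + 1) t x - S t x)) atTop
            (𝓝 0) := by
          refine squeeze_zero_norm (fun n => hA.norm_yexp_apply_le (hn n) s.2 _) ?_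
          simpa using ((hS t x).sub_const (S t x)).norm
        have h3 := h2.add h1
        simp only [map_sub, sub_add_cancel, zero_add] at h3
        simpa [yexp_add] using h3
      continuous' := hcont }
  have hT : ∀ t x, T.toFun t x = S t x := fun _ _ => rfl
  have hsub : ∀ z ∈ A, z ∈ T.negGenerator := by
    rintro ⟨φ, ψ⟩ h
    change Tendsto _ _ (𝓝 ψ)
    -- Since ψ need not lie in the domain, it is compared with a nearby φ' that does, whose orbits
    -- are Lipschitz with constant ‖ψ'‖.
    have key : ∀ φ' ψ', (φ', ψ') ∈ A → ∀ t : ℝ≥0,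
        ‖φ - S t φ - (t : ℝ) • ψ‖ ≤ (2 * ‖ψ - φ'‖ + t * ‖ψ'‖) * t := by
      intro φ' ψ' h' t
      have hlim : Tendsto (fun n : ℕ => (‖((n : ℝ) + 1) • hA.res (n + 1) ψ - ψ‖ +
          (2 * ‖ψ - φ'‖ + t * ‖ψ'‖)) * t) atTop
          (𝓝 ((0 + (2 * ‖ψ - φ'‖ + t * ‖ψ'‖)) * t)) := by
        refine Tendsto.mul_const _ (Tendsto.add_const _ ?_)
        have := (hA.tendsto_smul_res ψ).comp
          (tendsto_atTop_add_const_right _ (1 : ℝ) tendsto_natCast_atTop_atTop)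
        simpa using (this.sub_const ψ).norm
      rw [zero_add] at hlim
      refine le_of_tendsto_of_tendsto (((hS t φ).const_sub φ).sub_const ((t : ℝ) • ψ)).norm hlim
        (Eventually.of_forall fun n => ?_)
      have hd : ∀ s : ℝ, HasDerivAt (fun s => φ - hA.yexp (n + 1) s φ - s • ψ)
          (hA.yexp (n + 1) s (hA.yosida (n + 1) φ) - ψ) s := fun s => by
        have := ((hA.hasDerivAt_yexp_apply (n + 1) s φ).const_sub φ).sub
          ((hasDerivAt_id s).smul_const ψ)
        refine this.congr_deriv ?_
        simp
      have := norm_image_sub_le_of_norm_deriv_le_segment' (a := 0) (b := t)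
        (C := ‖((n : ℝ) + 1) • hA.res (n + 1) ψ - ψ‖ + (2 * ‖ψ - φ'‖ + t * ‖ψ'‖))
        (fun s _ => (hd s).hasDerivWithinAt) (fun s hs => ?_) t ⟨t.2, le_rfl⟩
      · simpa [yexp_zero] using this
      · rw [hA.yosida_of_mem (hn n) h]
        have e : hA.yexp (n + 1) s (((n : ℝ) + 1) • hA.res (n + 1) ψ) - ψ =
            hA.yexp (n + 1) s (((n : ℝ) + 1) • hA.res (n + 1) ψ - ψ) +
            (hA.yexp (n + 1) s (ψ - φ') + (hA.yexp (n + 1) s φ' - φ') - (ψ - φ')) := by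
          simp only [map_sub]; abel
        rw [e]
        refine (norm_add_le _ _).trans ?_
        have a1 := hA.norm_yexp_apply_le (hn n) hs.1 (((n : ℝ) + 1) • hA.res (n + 1) ψ - ψ)
        have a2 := hA.norm_yexp_apply_le (hn n) hs.1 (ψ - φ')
        have a3 : ‖hA.yexp (n + 1) s φ' - φ'‖ ≤ ‖ψ'‖ * s := by
          have := norm_image_sub_le_of_norm_deriv_le_segment' (a := (0 : ℝ)) (b := s) (C := ‖ψ'‖)
            (fun u _ => (hA.hasDerivAt_yexp_apply (n + 1) u φ').hasDerivWithinAt)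
            (fun u hu => ?_) s ⟨hs.1, le_rfl⟩
          · simpa [yexp_zero] using this
          · rw [norm_neg]
            refine (hA.norm_yexp_apply_le (hn n) hu.1 _).trans ?_
            rw [hA.yosida_of_mem (hn n) h', norm_smul, Real.norm_of_nonneg (hn n).le]
            calc _ ≤ ((n : ℝ) + 1) * (((n : ℝ) + 1)⁻¹ * ‖ψ'‖) := by
                  gcongr; exact hA.norm_res_apply_le (hn n) _
              _ = ‖ψ'‖ := by have := (hn n).ne'; field_simp
        have a4 : ‖ψ'‖ * s ≤ t * ‖ψ'‖ := by
          rw [mul_comm]; gcongr; exact hs.2.le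
        have a5 := norm_sub_le (hA.yexp (n + 1) s (ψ - φ') + (hA.yexp (n + 1) s φ' - φ')) (ψ - φ')
        have a6 := norm_add_le (hA.yexp (n + 1) s (ψ - φ')) (hA.yexp (n + 1) s φ' - φ')
        linarith
    rw [Metric.tendsto_nhds]
    intro ε hε
    obtain ⟨φ', ⟨ψ', h'⟩, hφ'⟩ := Metric.mem_closure_iff.1 (hA.dense ψ) (ε / 4) (by positivity)
    have : ∀ᶠ t : ℝ≥0 in 𝓝[>] 0, (t : ℝ) < ε / (2 * (‖ψ'‖ + 1)) := by
      refine (nhdsWithin_le_nhds : 𝓝[>] (0 : ℝ≥0) ≤ 𝓝 0) ?_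
      have : Tendsto (fun t : ℝ≥0 => (t : ℝ)) (𝓝 0) (𝓝 0) := NNReal.tendsto_coe.2 tendsto_id
      exact this.eventually (gt_mem_nhds (by positivity))
    filter_upwards [this, self_mem_nhdsWithin] with t ht ht0
    have ht0' : (0 : ℝ) < t := ht0
    have e : ((t : ℝ)⁻¹ : ℝ) • (φ - T.toFun t φ) - ψ = ((t : ℝ)⁻¹ : ℝ) • (φ - S t φ - (t : ℝ) • ψ) := by
      rw [hT, smul_sub _ _ ((t : ℝ) • ψ), smul_smul, inv_mul_cancel₀ ht0'.ne', one_smul]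
    rw [dist_eq_norm, e, norm_smul, norm_inv, Real.norm_of_nonneg ht0'.le, inv_mul_eq_div,
      div_lt_iff₀ ht0']
    refine (key φ' ψ' h' t).trans_lt ?_
    rw [dist_eq_norm] at hφ'
    rw [lt_div_iff₀ (by positivity)] at ht
    gcongr
    nlinarith [norm_nonneg ψ']
  refine ⟨T, Set.Subset.antisymm ?_ hsub⟩
  rintro ⟨x, y⟩ hxy
  -- Maximality: with (1 + A) φ = x + y the generator sends x - φ to -(x - φ), and contractivity
  -- then forces x = φ.
  obtain ⟨φ, hφ⟩ := hA.range 1 one_pos (x + y)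
  rw [one_smul] at hφ
  have h1 := hsub _ hφ
  have h2 : Tendsto (fun t : ℝ≥0 => ((t : ℝ)⁻¹ : ℝ) • ((x - φ) - T.toFun t (x - φ))) (𝓝[>] 0)
      (𝓝 (-(x - φ))) := by
    have hx : Tendsto (fun t : ℝ≥0 => ((t : ℝ)⁻¹ : ℝ) • (x - T.toFun t x)) (𝓝[>] 0) (𝓝 y) := hxy
    have hp : Tendsto (fun t : ℝ≥0 => ((t : ℝ)⁻¹ : ℝ) • (φ - T.toFun t φ)) (𝓝[>] 0)
      (𝓝 (x + y - φ)) := h1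
    have := hx.sub hp
    refine (this.congr fun t => ?_).trans_eq ?_
    · rw [← smul_sub, map_sub]; congr 1; abel
    · congr 1; abel
  have h3 : 0 ≤ (inner ℂ (x - φ) (-(x - φ))).re := by
    have h4 : Tendsto (fun t : ℝ≥0 =>
        (inner ℂ (x - φ) (((t : ℝ)⁻¹ : ℝ) • ((x - φ) - T.toFun t (x - φ)))).re) (𝓝[>] 0)
        (𝓝 (inner ℂ (x - φ) (-(x - φ))).re) :=
      Complex.continuous_re.continuousAt.tendsto.comp (tendsto_const_nhds.inner h2)
    refine ge_of_tendsto h4 (Eventually.of_forall fun t => ?_)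
    rw [re_inner_real_smul, inner_sub_right, Complex.sub_re, re_inner_self]
    have : (inner ℂ (x - φ) (T.toFun t (x - φ))).re ≤ ‖x - φ‖ * ‖x - φ‖ :=
      (Complex.re_le_norm _).trans ((norm_inner_le_norm _ _).trans (by gcongr; exact hbd t _))
    have : 0 ≤ ‖x - φ‖ ^ 2 - (inner ℂ (x - φ) (T.toFun t (x - φ))).re := by nlinarith
    positivity
  have h4 : x - φ = 0 := by
    rw [inner_neg_right, Complex.neg_re, re_inner_self] at h3
    have : ‖x - φ‖ ^ 2 = 0 := le_antisymm (by linarith) (by positivity)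
    simpa using this
  rw [sub_eq_zero] at h4
  subst h4
  simpa using hφ

end MAccretive

end MAccretive

/-! ### Functionals that decrease along a semigroup -/

namespace C0Semigroup

variable {X : Type*} [NormedAddCommGroup X] [NormedSpace ℂ X]

lemma apply_mem_negGenerator (T : C0Semigroup X) {φ ψ : X} (h : (φ, ψ) ∈ T.negGenerator)
    (s : ℝ≥0) : (T.toFun s φ, T.toFun s ψ) ∈ T.negGenerator := by
  have h' : Tendsto (fun t : ℝ≥0 => ((t : ℝ)⁻¹ : ℝ) • (φ - T.toFun t φ)) (𝓝[>] 0) (𝓝 ψ) := h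
  change Tendsto (fun t : ℝ≥0 => ((t : ℝ)⁻¹ : ℝ) • (T.toFun s φ - T.toFun t (T.toFun s φ)))
    (𝓝[>] 0) (𝓝 (T.toFun s ψ))
  refine (((T.toFun s).continuous.tendsto ψ).comp h').congr fun t => ?_
  have e : T.toFun t (T.toFun s φ) = T.toFun s (T.toFun t φ) := by
    rw [← ContinuousLinearMap.comp_apply, ← T.map_add', add_comm, T.map_add',
      ContinuousLinearMap.comp_apply]
  rw [Function.comp_apply, ContinuousLinearMap.map_smul_of_tower, map_sub, e]

lemma exists_bound [CompleteSpace X] (T : C0Semigroup X) (t : ℝ≥0) :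
    ∃ B : ℝ, 0 ≤ B ∧ ∀ s ≤ t, ‖T.toFun s‖ ≤ B := by
  obtain ⟨B, hB⟩ := banach_steinhaus (g := fun s : Icc (0 : ℝ≥0) t => T.toFun s) fun x => by
    obtain ⟨C, hC⟩ := (isCompact_Icc.image (T.continuous' x) :
      IsCompact ((fun s => T.toFun s x) '' Icc 0 t)).isBounded.exists_norm_le
    exact ⟨C, fun s => hC _ ⟨s, s.2, rfl⟩⟩
  refine ⟨max B 0, le_max_right _ _, fun s hs => (hB ⟨s, bot_le, hs⟩).trans (le_max_left _ _)⟩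

/-- A Lipschitz functional which does not increase under the resolvents of the negative
generator does not increase along the semigroup. -/
lemma le_of_resolvent_le [CompleteSpace X] (T : C0Semigroup X)
    (hdense : Dense {φ : X | ∃ ψ, (φ, ψ) ∈ T.negGenerator}) {M : X → ℝ} {L : ℝ≥0}
    (hL : LipschitzWith L M)
    (hM : ∀ φ ψ, (φ, ψ) ∈ T.negGenerator → ∀ ε : ℝ, 0 < ε → M φ ≤ M (φ + ε • ψ))
    (t : ℝ≥0) (f : X) : M (T.toFun t f) ≤ M f := by
  suffices h : ∀ φ ψ, (φ, ψ) ∈ T.negGenerator → M (T.toFun t φ) ≤ M φ by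
    have hcl : IsClosed {f : X | M (T.toFun t f) ≤ M f} :=
      isClosed_le (hL.continuous.comp (T.toFun t).continuous) hL.continuous
    exact (hcl.closure_subset_iff.2 (fun φ hφ => h φ _ hφ.choose_spec)) (hdense f)
  intro φ ψ h
  rcases eq_or_ne t 0 with rfl | ht
  · simp [T.map_zero']
  obtain ⟨B, hB0, hB⟩ := T.exists_bound t
  -- This is the defect of a backward Euler step: T(s+e) φ + e T(s+e) ψ = T(s) φ + e T(s) d(e), with
  -- d(e) → 0. Over t/e steps the errors add up to O(‖d(e)‖).
  let d : ℝ≥0 → X := fun e => T.toFun e ψ - ((e : ℝ)⁻¹ : ℝ) • (φ - T.toFun e φ)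
  have hd : Tendsto d (𝓝[>] 0) (𝓝 0) := by
    have h1 : Tendsto (fun e => T.toFun e ψ) (𝓝[>] 0) (𝓝 ψ) := by
      have := (T.continuous' ψ).tendsto 0
      rw [T.map_zero'] at this
      exact this.mono_left nhdsWithin_le_nhds
    simpa using h1.sub h
  have step : ∀ e : ℝ≥0, 0 < e → ∀ s ≤ t,
      M (T.toFun (s + e) φ) ≤ M (T.toFun s φ) + L * (B * (e * ‖d e‖)) := by
    intro e he s hs
    have he' : (0 : ℝ) < e := he
    refine (hM _ _ (T.apply_mem_negGenerator h (s + e)) e he').trans ?_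
    have e1 : T.toFun (s + e) φ + (e : ℝ) • T.toFun (s + e) ψ =
        T.toFun s φ + T.toFun s ((e : ℝ) • d e) := by
      simp only [d, smul_sub, smul_smul, mul_inv_cancel₀ he'.ne', one_smul, T.map_add',
        ContinuousLinearMap.comp_apply, map_sub, ContinuousLinearMap.map_smul_of_tower]
      abel
    rw [e1]
    have := hL.dist_le_mul (T.toFun s φ + T.toFun s ((e : ℝ) • d e)) (T.toFun s φ)
    rw [dist_eq_norm, dist_eq_norm, add_sub_cancel_left] at this
    have h2 : ‖T.toFun s ((e : ℝ) • d e)‖ ≤ B * (e * ‖d e‖) := by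
      refine ((T.toFun s).le_of_opNorm_le (hB s hs) _).trans ?_
      rw [norm_smul, Real.norm_of_nonneg he'.le]
    have h3 := (Real.le_norm_self _).trans this
    have h4 : (L : ℝ) * ‖T.toFun s ((e : ℝ) • d e)‖ ≤ L * (B * (e * ‖d e‖)) := by gcongr
    linarith
  have iter : ∀ e : ℝ≥0, 0 < e → ∀ k : ℕ, k * e ≤ t →
      M (T.toFun (k * e) φ) ≤ M φ + k * (L * (B * (e * ‖d e‖))) := by
    intro e he k
    induction k with
    | zero => intro _; simp [T.map_zero']
    | succ k ih =>
      intro hk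
      have hk' : (k : ℝ≥0) * e ≤ t := le_trans (by gcongr; simp) hk
      have h1 := step e he _ hk'
      have h2 := ih hk'
      rw [Nat.cast_succ, add_mul, one_mul]
      push_cast
      linarith
  have hlim : Tendsto (fun n : ℕ => M φ + L * (B * (t * ‖d (t / (n + 1))‖))) atTop
      (𝓝 (M φ + L * (B * (t * ‖(0 : X)‖)))) := by
    have h1 : Tendsto (fun n : ℕ => t / ((n : ℝ≥0) + 1)) atTop (𝓝[>] 0) := by
      refine tendsto_nhdsWithin_iff.2 ⟨?_, Eventually.of_forall fun n => ?_⟩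
      · have := (tendsto_one_div_add_atTop_nhds_zero_nat (𝕜 := ℝ)).const_mul (t : ℝ)
        rw [← NNReal.tendsto_coe]
        simpa [div_eq_mul_inv] using this
      · exact div_pos (pos_iff_ne_zero.2 ht) (by positivity)
    exact (((hd.comp h1).norm.const_mul _).const_mul _).const_mul _ |>.const_add _
  simp only [norm_zero, mul_zero, add_zero] at hlim
  refine ge_of_tendsto hlim (Eventually.of_forall fun n => ?_)
  have hn : ((n + 1 : ℕ) : ℝ≥0) * (t / (n + 1)) = t := by
    push_cast; field_simp
  have := iter (t / (n + 1)) (div_pos (pos_iff_ne_zero.2 ht) (by positivity)) (n + 1) hn.le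
  rw [hn] at this
  refine this.trans (le_of_eq ?_)
  push_cast
  field_simp

end C0Semigroup

/-! ### An integral identity for fractional powers -/

/-- Comparison with x^a on (0, 1] and with x^(a+b) on (1, ∞). -/
lemma integrableOn_rpow_mul_one_add_rpow {a b : ℝ} (ha : -1 < a) (hb : b ≤ 0) (hab : a + b < -1) :
    IntegrableOn (fun x : ℝ => x ^ a * (1 + x) ^ b) (Ioi 0) := by
  have hm : ∀ S : Set ℝ, MeasurableSet S → AEStronglyMeasurable (fun x : ℝ => x ^ a * (1 + x) ^ b)
      (volume.restrict S) := fun S _ => by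
    have : Measurable (fun x : ℝ => x ^ a * (1 + x) ^ b) := by fun_prop
    exact this.aestronglyMeasurable
  rw [← Ioc_union_Ioi_eq_Ioi zero_le_one]
  refine IntegrableOn.union ?_ ?_
  · have h1 : IntegrableOn (fun x : ℝ => x ^ a) (Ioc 0 1) :=
      (intervalIntegrable_iff_integrableOn_Ioc_of_le zero_le_one).1
        (intervalIntegral.intervalIntegrable_rpow' ha)
    refine h1.mono' (hm _ measurableSet_Ioc) ((ae_restrict_iff' measurableSet_Ioc).2
      (Eventually.of_forall fun x hx => ?_))
    have hx0 : 0 < x := hx.1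
    rw [Real.norm_of_nonneg (by positivity)]
    exact mul_le_of_le_one_right (by positivity)
      (Real.rpow_le_one_of_one_le_of_nonpos (by linarith) hb)
  · refine (integrableOn_Ioi_rpow_of_lt hab one_pos).mono' (hm _ measurableSet_Ioi)
      ((ae_restrict_iff' measurableSet_Ioi).2 (Eventually.of_forall fun x hx => ?_))
    have hx0 : (0 : ℝ) < x := one_pos.trans hx
    rw [Real.norm_of_nonneg (by positivity), Real.rpow_add hx0]
    gcongr ?_ * ?_
    exact Real.rpow_le_rpow_of_nonpos hx0 (by linarith) hb

lemma integrableOn_rpow_div_one_add {a : ℝ} (ha : -1 < a) (ha' : a < 0) :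
    IntegrableOn (fun x : ℝ => x ^ a / (1 + x)) (Ioi 0) := by
  refine (integrableOn_rpow_mul_one_add_rpow ha (b := -1) (by norm_num) (by linarith)).congr_fun
    (fun x hx => ?_) measurableSet_Ioi
  simp only [Real.rpow_neg_one, div_eq_mul_inv]

lemma ae_ne_restrict (s : ℝ) : ∀ᵐ x ∂(volume.restrict (Ioi (0 : ℝ))), x ≠ s :=
  ae_restrict_of_ae (by simp [ae_iff])

section

variable {θ C L : ℝ} {ρ : ℝ → ℝ}

/-- Substitution σ = s κ; the powers s, s^(-θ) and s^(θ-1) cancel. -/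
lemma integral_difference_quotient_eq {s : ℝ} (hs : 0 < s) (g : ℝ → ℝ) :
    ∫ σ in Ioi (0 : ℝ), s ^ (-θ) * (σ ^ (θ - 1) * g σ) =
      ∫ κ in Ioi (0 : ℝ), κ ^ (θ - 1) * g (s * κ) := by
  have := integral_comp_mul_left_Ioi (fun σ => s * (s ^ (-θ) * (σ ^ (θ - 1) * g σ))) 0 hs
  rw [mul_zero, integral_const_mul s (f := fun σ => s ^ (-θ) * (σ ^ (θ - 1) * g σ)), smul_eq_mul,
    inv_mul_cancel_left₀ hs.ne'] at this
  rw [← this]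
  refine setIntegral_congr_fun measurableSet_Ioi fun κ (hκ : 0 < κ) => ?_
  have : s * s ^ (-θ) * s ^ (θ - 1) = 1 := by
    nth_rewrite 1 [← Real.rpow_one s]
    rw [← Real.rpow_add hs, ← Real.rpow_add hs]
    ring_nf; simp
  simp only [Real.mul_rpow hs.le hκ.le]
  linear_combination (κ ^ (θ - 1) * g (s * κ)) * this

/-- After σ = s κ the integrals may be exchanged. For fixed κ the integral in s is then Frullani's
integral of (ρ(s) - ρ(κs))/s, equal to L log κ because ρ tends to L at 0 and to 0 at infinity. -/
lemma integral_difference_quotient (hθ0 : 0 < θ) (hθ1 : θ < 1)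
    (h1 : ∀ s, 0 < s → |ρ s| ≤ C / (1 + s))
    (h2 : ∀ s σ, 0 < s → 0 < σ → |ρ s - ρ σ| ≤ C * |σ - s| / ((1 + s) * (1 + σ)))
    (hL : Tendsto ρ (𝓝[>] 0) (𝓝 L)) :
    ∫ s in Ioi (0 : ℝ), ∫ σ in Ioi (0 : ℝ), s ^ (-θ) * (σ ^ (θ - 1) * ((ρ s - ρ σ) / (σ - s))) =
      L * ∫ κ in Ioi (0 : ℝ), κ ^ (θ - 1) * (Real.log κ / (κ - 1)) := by
  have hC : 0 ≤ C := by
    have := (abs_nonneg _).trans (h1 1 one_pos)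
    by_contra hC
    have : C / (1 + 1) < 0 := by linarith
    linarith
  have hcont : ContinuousOn ρ (Ioi 0) := by
    refine LipschitzOnWith.continuousOn (K := ⟨C, hC⟩) (LipschitzOnWith.of_dist_le_mul ?_)
    intro s hs σ hσ
    have hs' : 0 < s := hs
    have hσ' : 0 < σ := hσ
    rw [Real.dist_eq, Real.dist_eq, abs_sub_comm s σ]
    refine (h2 s σ hs hσ).trans (div_le_self (by positivity) ?_)
    nlinarith
  -- The bound also holds on the diagonal, where the quotient has the default value 0.
  have hq : ∀ s σ, 0 < s → 0 < σ → |(ρ s - ρ σ) / (σ - s)| ≤ C / ((1 + s) * (1 + σ)) := by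
    intro s σ hs hσ
    rcases eq_or_ne σ s with rfl | h
    · simp; positivity
    · rw [abs_div, div_le_iff₀ (abs_pos.2 (sub_ne_zero.2 h))]
      refine (h2 s σ hs hσ).trans (le_of_eq ?_)
      ring
  let F : ℝ → ℝ → ℝ := fun s κ => κ ^ (θ - 1) * ((ρ s - ρ (s * κ)) / (s * κ - s))
  have hstep : ∀ s ∈ Ioi (0 : ℝ),
      ∫ σ in Ioi (0 : ℝ), s ^ (-θ) * (σ ^ (θ - 1) * ((ρ s - ρ σ) / (σ - s))) =
      ∫ κ in Ioi (0 : ℝ), F s κ := fun s hs =>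
    integral_difference_quotient_eq hs fun σ => (ρ s - ρ σ) / (σ - s)
  rw [setIntegral_congr_fun measurableSet_Ioi hstep]
  have hI1 := integrableOn_rpow_div_one_add (a := θ - 1) (by linarith) (by linarith)
  have hI2 := integrableOn_rpow_div_one_add (a := -θ) (by linarith) (by linarith)
  have hFm : AEStronglyMeasurable (Function.uncurry F)
      ((volume.restrict (Ioi 0)).prod (volume.restrict (Ioi 0))) := by
    -- Nothing is known about ρ outside (0, ∞), so it is cut off there to become measurable on the
    -- line.
    have hm : Measurable ((Ioi (0 : ℝ)).indicator ρ) := by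
      rw [← piecewise_eq_indicator]
      exact hcont.measurable_piecewise (continuousOn_const) measurableSet_Ioi
    have hG : Measurable fun z : ℝ × ℝ => z.2 ^ (θ - 1) * (((Ioi (0 : ℝ)).indicator ρ z.1 -
        (Ioi (0 : ℝ)).indicator ρ (z.1 * z.2)) / (z.1 * z.2 - z.1)) := by
      fun_prop
    refine hG.aestronglyMeasurable.congr ?_
    rw [Measure.prod_restrict]
    refine (ae_restrict_iff' (measurableSet_Ioi.prod measurableSet_Ioi)).2
      (Eventually.of_forall fun z hz => ?_)
    have h1 : z.1 ∈ Ioi (0 : ℝ) := hz.1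
    have h2 : z.2 ∈ Ioi (0 : ℝ) := hz.2
    have h3 : z.1 * z.2 ∈ Ioi (0 : ℝ) := mul_pos (mem_Ioi.1 h1) (mem_Ioi.1 h2)
    simp only [indicator_of_mem h1, indicator_of_mem h3]
    rfl
  have hFb : ∀ s, 0 < s → ∀ κ, 0 < κ →
      ‖F s κ‖ ≤ C / (1 + s) * (κ ^ (θ - 1) * (1 / (1 + s * κ))) := by
    intro s hs κ hκ
    simp only [F, norm_mul, Real.norm_eq_abs, abs_of_nonneg (Real.rpow_nonneg hκ.le _)]
    have := hq s (s * κ) hs (mul_pos hs hκ)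
    calc _ ≤ κ ^ (θ - 1) * (C / ((1 + s) * (1 + s * κ))) := by gcongr
      _ = _ := by field_simp
  have hIs : ∀ s, 0 < s → IntegrableOn (fun κ : ℝ => κ ^ (θ - 1) * (1 / (1 + s * κ))) (Ioi 0) := by
    intro s hs
    have := (integrableOn_Ioi_comp_mul_left_iff (fun σ : ℝ => σ ^ (θ - 1) / (1 + σ)) 0 hs).2
      (by simpa using hI1)
    refine IntegrableOn.congr_fun (this.const_mul (s ^ (θ - 1))⁻¹) (fun κ hκ => ?_) measurableSet_Ioi
    have hκ' : (0 : ℝ) < κ := hκ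
    simp only [Real.mul_rpow hs.le hκ'.le]
    have : s ^ (θ - 1) ≠ 0 := (Real.rpow_pos_of_pos hs _).ne'
    field_simp
  have hFs : ∀ s, 0 < s → IntegrableOn (F s) (Ioi 0) := by
    intro s hs
    refine ((hIs s hs).const_mul (C / (1 + s))).mono' ?_ ((ae_restrict_iff' measurableSet_Ioi).2
      (Eventually.of_forall fun κ hκ => hFb s hs κ hκ))
    refine ContinuousOn.aestronglyMeasurable ?_ measurableSet_Ioi |>.mul
      ((ContinuousOn.aestronglyMeasurable ?_ measurableSet_Ioi).aemeasurable.div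
        (((continuous_const_mul s).sub continuous_const).measurable.aemeasurable)
          |>.aestronglyMeasurable)
    · exact fun x hx => (Real.continuousAt_rpow_const _ _ (Or.inl (ne_of_gt hx))).continuousWithinAt
    · exact continuousOn_const.sub (hcont.comp (continuous_const_mul s).continuousOn
        fun κ hκ => mul_pos hs hκ)
  -- Integrating the norm in κ first leaves C s^(-θ)/(1 + s) times the constant ∫ σ^(θ-1)/(1 + σ)
  -- dσ.
  have hF : Integrable (Function.uncurry F)
      ((volume.restrict (Ioi 0)).prod (volume.restrict (Ioi 0))) := by
    rw [integrable_prod_iff hFm]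
    refine ⟨(ae_restrict_iff' measurableSet_Ioi).2 (Eventually.of_forall fun s hs => hFs s hs), ?_⟩
    refine (hI2.const_mul (C * ∫ σ in Ioi (0 : ℝ), σ ^ (θ - 1) / (1 + σ))).mono'
      hFm.norm.integral_prod_right' ((ae_restrict_iff' measurableSet_Ioi).2
      (Eventually.of_forall fun s hs => ?_))
    have hs' : 0 < s := hs
    rw [Real.norm_of_nonneg (integral_nonneg fun _ => norm_nonneg _)]
    calc ∫ κ in Ioi (0 : ℝ), ‖F s κ‖
        ≤ ∫ κ in Ioi (0 : ℝ), C / (1 + s) * (κ ^ (θ - 1) * (1 / (1 + s * κ))) := by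
          refine setIntegral_mono_on (hFs s hs).norm ((hIs s hs).const_mul _) measurableSet_Ioi
            fun κ hκ => hFb s hs κ hκ
      _ = C / (1 + s) * ∫ σ in Ioi (0 : ℝ), s ^ (-θ) * (σ ^ (θ - 1) * (1 / (1 + σ))) := by
          rw [integral_const_mul, integral_difference_quotient_eq hs fun σ => 1 / (1 + σ)]
      _ = _ := by
          rw [integral_const_mul]
          simp only [mul_one_div]
          ring
  rw [integral_integral_swap hF, ← integral_const_mul]
  refine integral_congr_ae ?_
  have hR : Tendsto ρ atTop (𝓝 0) := by
    refine squeeze_zero_norm' (a := fun s => C / (1 + s)) ?_ ?_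
    · filter_upwards [eventually_gt_atTop 0] with s hs using h1 s hs
    · exact tendsto_const_nhds.div_atTop (tendsto_atTop_add_const_left _ _ tendsto_id)
  filter_upwards [hF.prod_left_ae, ae_ne_restrict 1, ae_restrict_mem measurableSet_Ioi]
    with κ hκI hκ1 hκ
  have hκ0 : (0 : ℝ) < κ := hκ
  have hk1 : κ - 1 ≠ 0 := sub_ne_zero.2 hκ1
  have hkt : κ ^ (θ - 1) ≠ 0 := (Real.rpow_pos_of_pos hκ0 _).ne'
  have e : ∀ s ∈ Ioi (0 : ℝ), F s κ =
      κ ^ (θ - 1) / (κ - 1) * (s⁻¹ • (ρ (1 * s) - ρ (κ * s))) := fun s hs => by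
    have hs' : s ≠ 0 := ne_of_gt hs
    have : s * κ - s ≠ 0 := by
      rw [show s * κ - s = s * (κ - 1) by ring]; exact mul_ne_zero hs' hk1
    simp only [F, smul_eq_mul, one_mul, mul_comm κ s]
    field_simp
  have hfr := Frullani.integral_Ioi_eq (f := ρ) (a := 1) (b := κ) (L := L) (R := 0)
    (hcont.locallyIntegrableOn measurableSet_Ioi) one_pos hκ0 hL hR (by
      have : IntegrableOn (fun s => κ ^ (θ - 1) / (κ - 1) *
          (s⁻¹ • (ρ (1 * s) - ρ (κ * s)))) (Ioi 0) :=
        IntegrableOn.congr_fun hκI e measurableSet_Ioi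
      refine IntegrableOn.congr_fun (this.const_mul ((κ - 1) / κ ^ (θ - 1))) (fun s _ => ?_)
        measurableSet_Ioi
      field_simp)
  rw [setIntegral_congr_fun measurableSet_Ioi e, integral_const_mul, hfr]
  simp only [div_one, sub_zero, smul_eq_mul]
  ring

/-- The constant `∫ κ ^ (θ - 1) log κ / (κ - 1) dκ` over `(0, ∞)`. -/
noncomputable def fracConst (θ : ℝ) : ℝ :=
  ∫ κ in Ioi (0 : ℝ), κ ^ (θ - 1) * (Real.log κ / (κ - 1))

lemma integral_rpow_div_one_add_pos {a : ℝ} (ha : -1 < a) (ha' : a < 0) :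
    0 < ∫ x in Ioi (0 : ℝ), x ^ a / (1 + x) := by
  rw [setIntegral_pos_iff_support_of_nonneg_ae _ (integrableOn_rpow_div_one_add ha ha')]
  · have : Ioi (0 : ℝ) ⊆ Function.support (fun x : ℝ => x ^ a / (1 + x)) := fun x hx => by
      have hx' : (0 : ℝ) < x := hx
      have : 0 < x ^ a / (1 + x) := by positivity
      exact this.ne'
    rw [inter_eq_self_of_subset_right this]
    simp
  · refine (ae_restrict_iff' measurableSet_Ioi).2 (Eventually.of_forall fun x hx => ?_)
    have hx' : (0 : ℝ) < x := hx
    simp only [Pi.zero_apply]; positivity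

/-- The sign is read off from one example: for ρ(s) = 1/(1 + s), where L = 1, the double integral
factors into two positive integrals. -/
lemma fracConst_pos (hθ0 : 0 < θ) (hθ1 : θ < 1) : 0 < fracConst θ := by
  have hk : ∀ s σ : ℝ, 0 < s → 0 < σ →
      (1 + s)⁻¹ - (1 + σ)⁻¹ = (σ - s) * (1 / ((1 + s) * (1 + σ))) := fun s σ hs hσ => by
    field_simp; ring
  have := integral_difference_quotient (ρ := fun s => (1 + s)⁻¹) (C := 1) (L := 1) hθ0 hθ1
    (fun s hs => by rw [abs_of_pos (by positivity), one_div])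
    (fun s σ hs hσ => by
      rw [hk s σ hs hσ, abs_mul, abs_of_pos (a := 1 / ((1 + s) * (1 + σ))) (by positivity)]
      apply le_of_eq; ring)
    (by
      have : ContinuousAt (fun s : ℝ => (1 + s)⁻¹) 0 :=
        (continuousAt_const.add continuousAt_id).inv₀ (by simp)
      simpa using this.tendsto.mono_left nhdsWithin_le_nhds)
  rw [one_mul] at this
  rw [fracConst, ← this]
  have e : ∀ s ∈ Ioi (0 : ℝ),
      ∫ σ in Ioi (0 : ℝ), s ^ (-θ) * (σ ^ (θ - 1) * (((1 + s)⁻¹ - (1 + σ)⁻¹) / (σ - s))) =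
      s ^ (-θ) / (1 + s) * ∫ σ in Ioi (0 : ℝ), σ ^ (θ - 1) / (1 + σ) := fun s hs => by
    have hs' : (0 : ℝ) < s := hs
    rw [← integral_const_mul]
    refine integral_congr_ae ?_
    filter_upwards [ae_ne_restrict s, ae_restrict_mem measurableSet_Ioi] with σ h1 hσ
    have hσ' : (0 : ℝ) < σ := hσ
    rw [hk s σ hs hσ, mul_div_cancel_left₀ _ (sub_ne_zero.2 h1)]
    field_simp
  rw [setIntegral_congr_fun measurableSet_Ioi e, integral_mul_const]
  exact mul_pos (integral_rpow_div_one_add_pos (by linarith) (by linarith))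
    (integral_rpow_div_one_add_pos (by linarith) (by linarith))

end

namespace MAccretive

variable {H : Type*} [NormedAddCommGroup H] [InnerProductSpace ℂ H]
  {A : Submodule ℂ (H × H)} (hA : MAccretive A)
include hA

lemma norm_res_add_one_le {s : ℝ} (hs : 0 < s) (x : H) : ‖hA.res (s + 1) x‖ ≤ ‖x‖ / (1 + s) := by
  refine (hA.norm_res_apply_le (by linarith) x).trans (le_of_eq ?_)
  rw [add_comm, inv_mul_eq_div]

lemma continuousOn_res_add_one (x : H) : ContinuousOn (fun s => hA.res (s + 1) x) (Ici 0) := by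
  refine LipschitzOnWith.continuousOn (K := ‖x‖₊) (LipschitzOnWith.of_dist_le_mul ?_)
  intro s hs σ hσ
  have hs' : 0 ≤ s := hs
  have hσ' : 0 ≤ σ := hσ
  rw [dist_eq_norm, hA.res_sub_res (by linarith) (by linarith), norm_smul, dist_comm, Real.dist_eq,
    coe_nnnorm, mul_comm, Real.norm_eq_abs, add_sub_add_right_eq_sub]
  have hle : ∀ r : ℝ, 0 ≤ r → ∀ y : H, ‖hA.res (r + 1) y‖ ≤ ‖y‖ := fun r hr y => by
    refine (hA.norm_res_apply_le (by linarith) y).trans (mul_le_of_le_one_left (norm_nonneg _) ?_)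
    exact inv_le_one_of_one_le₀ (by linarith)
  gcongr
  exact (hle s hs' _).trans (hle σ hσ' _)

lemma integrableOn_smul_res {θ : ℝ} (hθ0 : 0 < θ) (hθ1 : θ < 1) (x : H) :
    IntegrableOn (fun σ : ℝ => σ ^ (θ - 1) • hA.res (σ + 1) x) (Ioi 0) := by
  refine ((integrableOn_rpow_div_one_add (a := θ - 1) (by linarith) (by linarith)).mul_const
    ‖x‖).mono' ?_ ((ae_restrict_iff' measurableSet_Ioi).2 (Eventually.of_forall fun σ hσ => ?_))
  · have hr : ContinuousOn (fun σ : ℝ => σ ^ (θ - 1)) (Ioi 0) := fun x hx =>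
      (Real.continuousAt_rpow_const _ _ (Or.inl (ne_of_gt hx))).continuousWithinAt
    exact (hr.smul ((hA.continuousOn_res_add_one x).mono
      Ioi_subset_Ici_self)).aestronglyMeasurable measurableSet_Ioi
  · have hσ' : (0 : ℝ) < σ := hσ
    rw [norm_smul, Real.norm_of_nonneg (by positivity), div_mul_eq_mul_div, mul_div_assoc]
    gcongr
    exact hA.norm_res_add_one_le hσ' x

/-- The identity `(1 + A)^{-θ} (1 + A)^{θ - 1} x = (1 + A)⁻¹ x`, up to a constant and in weak form. -/
lemma integral_re_inner_res [CompleteSpace H] {θ : ℝ} (hθ0 : 0 < θ) (hθ1 : θ < 1) (h x : H) :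
    ∫ s in Ioi (0 : ℝ), s ^ (-θ) *
      (inner ℂ h (hA.res (s + 1) (∫ σ in Ioi (0 : ℝ), σ ^ (θ - 1) • hA.res (σ + 1) x))).re =
    (inner ℂ h (hA.res 1 x)).re * fracConst θ := by
  let l : H →L[ℝ] ℝ := Complex.reCLM.comp ((innerSL ℂ h).restrictScalars ℝ)
  have hl : ∀ y, l y = (inner ℂ h y).re := fun y => rfl
  have hlb : ∀ y, |l y| ≤ ‖h‖ * ‖y‖ := fun y =>
    (Complex.abs_re_le_norm _).trans (norm_inner_le_norm _ _)
  let ρ : ℝ → ℝ := fun s => l (hA.res (s + 1) x)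
  -- By the resolvent identity the product of two resolvents, tested against h, is a difference
  -- quotient of ρ.
  have hdiff : ∀ s σ, 0 < s → 0 < σ →
      ρ s - ρ σ = (σ - s) * l (hA.res (s + 1) (hA.res (σ + 1) x)) := fun s σ hs hσ => by
    simp only [ρ]
    rw [← map_sub, hA.res_sub_res (by linarith) (by linarith), map_smul, smul_eq_mul]
    ring
  have hbd : ∀ s σ, 0 < s → 0 < σ →
      |l (hA.res (s + 1) (hA.res (σ + 1) x))| ≤ ‖h‖ * ‖x‖ / ((1 + s) * (1 + σ)) :=
    fun s σ hs hσ => by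
      refine (hlb _).trans ?_
      calc _ ≤ ‖h‖ * (‖x‖ / (1 + σ) / (1 + s)) := by
            gcongr
            exact (hA.norm_res_add_one_le hs _).trans
              (by gcongr; exact hA.norm_res_add_one_le hσ x)
        _ = _ := by field_simp
  have key := integral_difference_quotient (ρ := ρ) (C := ‖h‖ * ‖x‖) (L := l (hA.res 1 x)) hθ0 hθ1
    (fun s hs => by
      refine (hlb _).trans ?_
      rw [mul_div_assoc]
      gcongr
      exact hA.norm_res_add_one_le hs x)
    (fun s σ hs hσ => by
      rw [hdiff s σ hs hσ, abs_mul]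
      calc _ ≤ |σ - s| * (‖h‖ * ‖x‖ / ((1 + s) * (1 + σ))) := by gcongr; exact hbd s σ hs hσ
        _ = _ := by ring)
    (by
      have := ((hA.continuousOn_res_add_one x) 0 self_mem_Ici).tendsto
      rw [zero_add] at this
      exact (l.continuous.tendsto _).comp (this.mono_left (nhdsWithin_mono _ Ioi_subset_Ici_self)))
  rw [← hl, fracConst, ← key]
  refine setIntegral_congr_fun measurableSet_Ioi fun s hs => ?_
  have hs' : (0 : ℝ) < s := hs
  have e : (inner ℂ h (hA.res (s + 1)
      (∫ σ in Ioi (0 : ℝ), σ ^ (θ - 1) • hA.res (σ + 1) x))).re =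
      ∫ σ in Ioi (0 : ℝ), (l.comp ((hA.res (s + 1)).restrictScalars ℝ))
        (σ ^ (θ - 1) • hA.res (σ + 1) x) :=
    (ContinuousLinearMap.integral_comp_comm
      (l.comp ((hA.res (s + 1)).restrictScalars ℝ)) (hA.integrableOn_smul_res hθ0 hθ1 x)).symm
  rw [e, ← integral_const_mul]
  refine integral_congr_ae ?_
  filter_upwards [ae_ne_restrict s, ae_restrict_mem measurableSet_Ioi] with σ h1 hσ
  rw [hdiff s σ hs hσ, mul_div_cancel_left₀ _ (sub_ne_zero.2 h1), map_smul, smul_eq_mul]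
  rfl

end MAccretive

/-! ### Comparison of `L^p` norms by truncated means -/

/-- Taylor's formula for t^p, with second derivative p (p - 1) k^(p-2). It writes the p-th power of
a positive part as a superposition of truncations. -/
lemma lintegral_rpow_mul_excess {p : ℝ} (hp : 2 < p) (t : ℝ) :
    ∫⁻ k in Ioi (0 : ℝ), ENNReal.ofReal (k ^ (p - 2)) * ENNReal.ofReal (t - k) =
      ENNReal.ofReal (p * (p - 1))⁻¹ * ENNReal.ofReal t ^ p := by
  have hp0 : 0 < p := by linarith
  rcases le_or_gt t 0 with ht | ht
  · rw [ENNReal.ofReal_of_nonpos ht, ENNReal.zero_rpow_of_pos hp0, mul_zero,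
      setLIntegral_congr_fun (g := fun _ => 0) measurableSet_Ioi fun k (hk : 0 < k) => ?_]
    · simp
    · simp only
      rw [ENNReal.ofReal_of_nonpos (by linarith : t - k ≤ 0), mul_zero]
  · have h0 : ∫⁻ k in Ioi (0 : ℝ), ENNReal.ofReal (k ^ (p - 2)) * ENNReal.ofReal (t - k) =
        ∫⁻ k in Ioc 0 t, ENNReal.ofReal (k ^ (p - 2) * (t - k)) := by
      rw [← lintegral_indicator measurableSet_Ioi, ← lintegral_indicator measurableSet_Ioc]
      congr 1
      ext k
      by_cases hk : 0 < k
      · rw [indicator_of_mem (by exact hk)]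
        by_cases hkt : k ≤ t
        · rw [indicator_of_mem (by exact ⟨hk, hkt⟩), ENNReal.ofReal_mul (by positivity)]
        · rw [indicator_of_notMem (fun h => hkt h.2),
            ENNReal.ofReal_of_nonpos (by linarith : t - k ≤ 0), mul_zero]
      · rw [indicator_of_notMem (by exact hk), indicator_of_notMem (fun h => hk h.1)]
    have hi1 : IntervalIntegrable (fun k : ℝ => k ^ (p - 2)) volume 0 t :=
      intervalIntegral.intervalIntegrable_rpow' (by linarith)
    have hi2 : IntervalIntegrable (fun k : ℝ => k ^ (p - 1)) volume 0 t :=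
      intervalIntegral.intervalIntegrable_rpow' (by linarith)
    have e : EqOn (fun k : ℝ => k ^ (p - 2) * (t - k)) (fun k => t * k ^ (p - 2) - k ^ (p - 1))
        (Ioc 0 t) := fun k hk => by
      have : k ^ (p - 1) = k ^ (p - 2) * k := by
        rw [← Real.rpow_add_one (ne_of_gt hk.1)]; ring_nf
      simp only [this]; ring
    have hi3 : IntervalIntegrable (fun k : ℝ => k ^ (p - 2) * (t - k)) volume 0 t :=
      ((hi1.const_mul t).sub hi2).congr (by rw [uIoc_of_le ht.le]; exact e.symm)
    rw [h0, ← ofReal_integral_eq_lintegral_ofReal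
      ((intervalIntegrable_iff_integrableOn_Ioc_of_le ht.le).1 hi3)
      ((ae_restrict_iff' measurableSet_Ioc).2 (Eventually.of_forall fun k hk => by
        have : 0 ≤ t - k := by linarith [hk.2]
        have := hk.1
        simp only [Pi.zero_apply]; positivity)),
      setIntegral_congr_fun measurableSet_Ioc e,
      ← intervalIntegral.integral_of_le ht.le, intervalIntegral.integral_sub (hi1.const_mul t) hi2,
      intervalIntegral.integral_const_mul, integral_rpow (Or.inl (by linarith)),
      integral_rpow (Or.inl (by linarith)), ENNReal.ofReal_rpow_of_pos ht,
      ← ENNReal.ofReal_mul (by have : 0 < p - 1 := by linarith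
                               positivity)]
    congr 1
    have e1 : t ^ p = t * t ^ (p - 1) := by
      rw [← Real.rpow_one_add' ht.le (by linarith)]; ring_nf
    have h1 : p - 1 ≠ 0 := by linarith
    rw [show p - 2 + 1 = p - 1 by ring, show p - 1 + 1 = p by ring,
      Real.zero_rpow h1, Real.zero_rpow hp0.ne', e1]
    field_simp
    ring

section Excess

variable {α : Type*} [MeasurableSpace α] {m : Measure α}

/-- Integrate the hypothesis against k^(p-2) dk and use Tonelli. -/
lemma lintegral_rpow_le_of_excess_le [SFinite m] {p : ℝ} (hp : 2 < p) {g f : α → ℝ}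
    (hg : AEMeasurable g m) (hf : AEMeasurable f m)
    (h : ∀ k : ℝ, 0 < k → ∫⁻ x, ENNReal.ofReal (g x - k) ∂m ≤ ∫⁻ x, ENNReal.ofReal (f x - k) ∂m) :
    ∫⁻ x, ENNReal.ofReal (g x) ^ p ∂m ≤ ∫⁻ x, ENNReal.ofReal (f x) ^ p ∂m := by
  have hc : ENNReal.ofReal (p * (p - 1))⁻¹ ≠ 0 := by
    have : 0 < p - 1 := by linarith
    have : 0 < p := by linarith
    simp only [ne_eq, ENNReal.ofReal_eq_zero, not_le]; positivity
  have key : ∀ u : α → ℝ, AEMeasurable u m →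
      ENNReal.ofReal (p * (p - 1))⁻¹ * ∫⁻ x, ENNReal.ofReal (u x) ^ p ∂m =
      ∫⁻ k in Ioi (0 : ℝ), ENNReal.ofReal (k ^ (p - 2)) * ∫⁻ x, ENNReal.ofReal (u x - k) ∂m := by
    intro u hu
    have hm : AEMeasurable (Function.uncurry fun (x : α) (k : ℝ) =>
        ENNReal.ofReal (k ^ (p - 2)) * ENNReal.ofReal (u x - k))
        (m.prod (volume.restrict (Ioi 0))) := by
      have h1 : AEMeasurable (fun z : α × ℝ => u z.1) (m.prod (volume.restrict (Ioi 0))) :=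
        hu.comp_quasiMeasurePreserving Measure.quasiMeasurePreserving_fst
      have h2 : AEMeasurable (fun z : α × ℝ => z.2) (m.prod (volume.restrict (Ioi 0))) :=
        measurable_snd.aemeasurable
      exact ((h2.pow_const _).ennreal_ofReal).mul ((h1.sub h2).ennreal_ofReal)
    rw [← lintegral_const_mul'' _ (hu.ennreal_ofReal.pow_const p)]
    simp_rw [← lintegral_rpow_mul_excess hp]
    rw [lintegral_lintegral_swap hm]
    refine lintegral_congr fun k => ?_
    rw [lintegral_const_mul'' _ ((hu.sub_const k).ennreal_ofReal)]
  rw [← ENNReal.mul_le_mul_iff_right hc ENNReal.ofReal_ne_top, key g hg, key f hf]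
  refine lintegral_mono_ae ((ae_restrict_iff' measurableSet_Ioi).2
    (Eventually.of_forall fun k hk => ?_))
  exact mul_le_mul' le_rfl (h k hk)

/-- The truncated mean `∫ (Re f - k)⁺`. -/
noncomputable def excess (m : Measure α) (k : ℝ) (f : α → ℂ) : ℝ := ∫ x, max ((f x).re - k) 0 ∂m

lemma excess_congr {k : ℝ} {f g : α → ℂ} (h : f =ᵐ[m] g) : excess m k f = excess m k g :=
  integral_congr_ae (h.mono fun x hx => by simp only [hx])

lemma integrable_excess [IsFiniteMeasure m] {f : α → ℂ} (hf : Integrable f m) (k : ℝ) :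
    Integrable (fun x => max ((f x).re - k) 0) m :=
  (hf.re.sub (integrable_const k)).pos_part

lemma ofReal_excess [IsFiniteMeasure m] {f : α → ℂ} (hf : Integrable f m) (k : ℝ) :
    ENNReal.ofReal (excess m k f) = ∫⁻ x, ENNReal.ofReal ((f x).re - k) ∂m := by
  rw [excess, ofReal_integral_eq_lintegral_ofReal (integrable_excess hf k)
    (Eventually.of_forall fun x => le_max_right _ _)]
  refine lintegral_congr fun x => ?_
  rcases le_total ((f x).re - k) 0 with h | h
  · rw [max_eq_right h, ENNReal.ofReal_of_nonpos h, ENNReal.ofReal_zero]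
  · rw [max_eq_left h]

lemma norm_le_sum_re_parts (z : ℂ) : ‖z‖ ≤ max z.re 0 + max (-z).re 0 + max (-Complex.I * z).re 0 +
    max (Complex.I * z).re 0 := by
  refine (Complex.norm_le_abs_re_add_abs_im z).trans ?_
  have h1 : |z.re| ≤ max z.re 0 + max (-z).re 0 := by
    rw [Complex.neg_re]
    refine abs_le.2 ⟨?_, ?_⟩ <;>
      linarith [le_max_left z.re 0, le_max_right z.re 0, le_max_left (-z.re) 0, le_max_right (-z.re) 0]
  have h2 : |z.im| ≤ max (-Complex.I * z).re 0 + max (Complex.I * z).re 0 := by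
    have e1 : (-Complex.I * z).re = z.im := by simp
    have e2 : (Complex.I * z).re = -z.im := by simp
    rw [e1, e2]
    refine abs_le.2 ⟨?_, ?_⟩ <;>
      linarith [le_max_left z.im 0, le_max_right z.im 0, le_max_left (-z.im) 0, le_max_right (-z.im) 0]
  linarith

/-- `g` is dominated by `f`, in the sense of truncated means of the real part in all four
directions. -/
def ExcessLE (m : Measure α) (g f : α → ℂ) : Prop :=
  ∀ c : ℂ, ‖c‖ = 1 → ∀ k : ℝ, 0 ≤ k → excess m k (fun x => c * g x) ≤ excess m k (fun x => c * f x)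

/-- The rotations c = 1, -1, -i, i recover |g| from the positive parts of Re (c g). This is the
origin of the factor 4 in the estimates below. -/
lemma eLpNorm_le_of_re_parts {p : ℝ≥0∞} (hp : 1 ≤ p) {g : α → ℂ} {C : ℝ≥0∞}
    (hg : AEStronglyMeasurable g m)
    (h : ∀ c : ℂ, ‖c‖ = 1 → eLpNorm (fun x => max (c * g x).re 0) p m ≤ C) :
    eLpNorm g p m ≤ 4 * C := by
  have hm : ∀ c : ℂ, AEStronglyMeasurable (fun x => max (c * g x).re 0) m := fun c =>
    ((Complex.continuous_re.comp_aestronglyMeasurable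
      (hg.const_mul c)).aemeasurable.max aemeasurable_const).aestronglyMeasurable
  have h1 := h 1 (by simp)
  have h2 := h (-1) (by simp)
  have h3 := h (-Complex.I) (by simp)
  have h4 := h Complex.I (by simp)
  refine (eLpNorm_mono_real (g := (fun x => max (1 * g x).re 0) + (fun x => max (-1 * g x).re 0) +
    (fun x => max (-Complex.I * g x).re 0) + (fun x => max (Complex.I * g x).re 0)) fun x => ?_).trans ?_
  · simpa using norm_le_sum_re_parts (g x)
  · refine (eLpNorm_add_le (((hm _).add (hm _)).add (hm _)) (hm _) hp).trans ?_
    refine (add_le_add_left (eLpNorm_add_le ((hm _).add (hm _)) (hm _) hp) _).trans ?_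
    refine (add_le_add_left (add_le_add_left (eLpNorm_add_le (hm _) (hm _) hp) _) _).trans ?_
    calc _ ≤ C + C + C + C := by gcongr
      _ = 4 * C := by ring

lemma eLpNorm_le_of_excessLE [IsFiniteMeasure m] {p : ℝ} (hp : 2 < p) {g f : α → ℂ}
    (hg : Integrable g m) (hf : Integrable f m) (h : ExcessLE m g f) :
    eLpNorm g (ENNReal.ofReal p) m ≤ 4 * eLpNorm f (ENNReal.ofReal p) m := by
  have hp0 : 0 < p := by linarith
  have hp1 : ENNReal.ofReal p ≠ 0 := by simpa using hp0
  refine eLpNorm_le_of_re_parts (by rw [ENNReal.one_le_ofReal]; linarith) hg.1 fun c hc => ?_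
  have key := lintegral_rpow_le_of_excess_le hp (m := m) (g := fun x => (c * g x).re)
    (f := fun x => (c * f x).re) (hg.const_mul c).re.1.aemeasurable
    (hf.const_mul c).re.1.aemeasurable fun k hk => by
      rw [← ofReal_excess (hg.const_mul c), ← ofReal_excess (hf.const_mul c)]
      exact ENNReal.ofReal_le_ofReal (h c hc k hk.le)
  rw [eLpNorm_eq_lintegral_rpow_enorm_toReal hp1 ENNReal.ofReal_ne_top,
    eLpNorm_eq_lintegral_rpow_enorm_toReal hp1 ENNReal.ofReal_ne_top, ENNReal.toReal_ofReal hp0.le]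
  gcongr ?_ ^ _
  calc ∫⁻ x, ‖max (c * g x).re 0‖ₑ ^ p ∂m = ∫⁻ x, ENNReal.ofReal (c * g x).re ^ p ∂m := by
        refine lintegral_congr fun x => ?_
        rw [Real.enorm_of_nonneg (le_max_right _ _)]
        rcases le_total (c * g x).re 0 with h | h
        · rw [max_eq_right h, ENNReal.ofReal_of_nonpos h, ENNReal.ofReal_zero]
        · rw [max_eq_left h]
    _ ≤ ∫⁻ x, ENNReal.ofReal (c * f x).re ^ p ∂m := key
    _ ≤ ∫⁻ x, ‖f x‖ₑ ^ p ∂m := by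
        refine lintegral_mono fun x => ?_
        simp only
        gcongr
        rw [← ofReal_norm]
        refine ENNReal.ofReal_le_ofReal ((Complex.re_le_norm _).trans (le_of_eq ?_))
        rw [norm_mul, hc, one_mul]

/-- At the level k = ‖f‖_∞ the truncated mean of c f vanishes, hence so does that of c g. -/
lemma eLpNorm_top_le_of_excessLE [IsFiniteMeasure m] {g f : α → ℂ}
    (hg : Integrable g m) (h : ExcessLE m g f) :
    eLpNorm g ∞ m ≤ 4 * eLpNorm f ∞ m := by
  rcases eq_or_ne (eLpNorm f ∞ m) ∞ with htop | htop
  · rw [htop]; simp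
  refine eLpNorm_le_of_re_parts le_top hg.1 fun c hc => ?_
  set k := (eLpNorm f ∞ m).toReal with hk
  have hfk : ∀ᵐ x ∂m, ‖f x‖ ≤ k := by
    have := ae_le_eLpNormEssSup (f := f) (μ := m)
    filter_upwards [this] with x hx
    rw [← eLpNorm_exponent_top, ← ofReal_norm] at hx
    exact (ENNReal.ofReal_le_iff_le_toReal htop).1 hx
  have h0 : excess m k (fun x => c * f x) = 0 := by
    rw [excess, integral_eq_zero_of_ae]
    filter_upwards [hfk] with x hx
    refine max_eq_right ?_
    have := Complex.re_le_norm (c * f x)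
    rw [norm_mul, hc, one_mul] at this
    linarith
  have h1 : excess m k (fun x => c * g x) = 0 :=
    le_antisymm ((h c hc k ENNReal.toReal_nonneg).trans h0.le)
      (integral_nonneg fun _ => le_max_right _ _)
  replace h1 := (integral_eq_zero_iff_of_nonneg (f := fun x => max ((c * g x).re - k) 0)
    (fun _ => le_max_right _ _) (integrable_excess (hg.const_mul c) k)).1 h1
  have : ∀ᵐ x ∂m, ‖max (c * g x).re 0‖ ≤ k := by
    filter_upwards [h1] with x hx
    have h3 : max ((c * g x).re - k) 0 = 0 := hx
    have h2 : (c * g x).re - k ≤ 0 := max_eq_right_iff.1 h3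
    rw [Real.norm_of_nonneg (le_max_right _ _)]
    exact max_le (by linarith) ENNReal.toReal_nonneg
  calc _ ≤ ENNReal.ofReal k := by
        rw [eLpNorm_exponent_top]
        exact eLpNormEssSup_le_of_ae_bound this
    _ = eLpNorm f ∞ m := ENNReal.ofReal_toReal htop

end Excess

/-! ### Truncation accretivity and the semigroup on `L^p` -/

section LpSemigroup

variable {α : Type*} [MeasurableSpace α] {m : Measure α} [IsFiniteMeasure m]

lemma Lp_integrable {p : ℝ≥0∞} (hp : 1 ≤ p) (f : Lp ℂ p m) : Integrable f m :=
  (Lp.memLp f).integrable hp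

lemma integral_norm_le_Lp_two (f : Lp ℂ 2 m) :
    ∫ x, ‖f x‖ ∂m ≤ (m univ ^ (1 / 2 : ℝ)).toReal * ‖f‖ := by
  have h1 := eLpNorm_le_eLpNorm_mul_rpow_measure_univ (p := 1) (q := 2) (by norm_num)
    (Lp.aestronglyMeasurable f)
  rw [eLpNorm_one_eq_lintegral_enorm, ← ofReal_integral_norm_eq_lintegral_enorm
    (Lp_integrable (by norm_num) f)] at h1
  rw [Lp.norm_def, mul_comm, ← ENNReal.toReal_mul]
  refine (ENNReal.ofReal_le_iff_le_toReal ?_).1 (h1.trans (le_of_eq ?_))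
  · exact ENNReal.mul_ne_top (Lp.eLpNorm_ne_top f)
      (ENNReal.rpow_ne_top_of_nonneg (by norm_num) (measure_ne_top _ _))
  · norm_num

lemma excess_lipschitz (k : ℝ) :
    LipschitzWith (m univ ^ (1 / 2 : ℝ)).toNNReal fun f : Lp ℂ 2 m => excess m k f := by
  refine LipschitzWith.of_le_add_mul _ fun f g => ?_
  have hf := Lp_integrable (by norm_num) f
  have hg := Lp_integrable (by norm_num) g
  have h : excess m k f ≤ excess m k g + ∫ x, ‖(f - g : Lp ℂ 2 m) x‖ ∂m := by
    rw [excess, excess, ← integral_add (integrable_excess hg k)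
      (Lp_integrable (by norm_num) (f - g)).norm]
    refine integral_mono_ae (integrable_excess hf k) ((integrable_excess hg k).add
      (Lp_integrable (by norm_num) (f - g)).norm) ?_
    filter_upwards [Lp.coeFn_sub f g] with x hx
    simp only [hx, Pi.sub_apply]
    have h1 := Complex.re_le_norm (f x - g x)
    rw [Complex.sub_re] at h1
    refine max_le ?_ (add_nonneg (le_max_right _ _) (norm_nonneg _))
    linarith [le_max_left ((g x).re - k) 0]
  refine h.trans ?_
  have := integral_norm_le_Lp_two (f - g)
  rw [dist_eq_norm]
  gcongr
  exact this

omit [IsFiniteMeasure m] in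
lemma excess_const_mul (c : ℂ) (k : ℝ) (f : Lp ℂ 2 m) :
    excess m k (fun x => c * f x) = excess m k (c • f : Lp ℂ 2 m) :=
  excess_congr ((Lp.coeFn_smul c f).mono fun x hx => by simp [hx])

/-- The form inequality which says that `A` is accretive with respect to all truncated means. -/
def IsTruncationAccretive (A : Submodule ℂ (Lp ℂ 2 m × Lp ℂ 2 m)) : Prop :=
  ∀ z ∈ A, ∀ k : ℝ, 0 ≤ k → 0 ≤ ∫ x in {x | k < (z.1 x).re}, (z.2 x).re ∂m

variable {A : Submodule ℂ (Lp ℂ 2 m × Lp ℂ 2 m)}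

omit [IsFiniteMeasure m] in
lemma measurableSet_re_gt (k : ℝ) (f : Lp ℂ 2 m) : MeasurableSet {x | k < (f x).re} :=
  measurableSet_lt measurable_const
    (Complex.measurable_re.comp (Lp.stronglyMeasurable f).measurable)

/-- On {Re φ > k} the function Re φ - k changes by ε Re ψ, whose integral over this set is
nonnegative. Off this set the new positive part can only add to the mean. -/
lemma IsTruncationAccretive.excess_le (hA : IsTruncationAccretive A) {φ ψ : Lp ℂ 2 m}
    (h : (φ, ψ) ∈ A) {k : ℝ} (hk : 0 ≤ k) {ε : ℝ} (hε : 0 ≤ ε) :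
    excess m k φ ≤ excess m k (φ + ε • ψ : Lp ℂ 2 m) := by
  have hφ := Lp_integrable (by norm_num) φ
  have hψ := Lp_integrable (by norm_num) ψ
  have hS := measurableSet_re_gt k φ
  set S := {x | k < (φ x).re} with hSdef
  have hφk : Integrable (fun x => (φ x).re - k) m := hφ.re.sub (integrable_const k)
  have hψε : Integrable (fun x => ε * (ψ x).re) m := hψ.re.const_mul ε
  have h1 : excess m k φ = ∫ x in S, ((φ x).re - k) ∂m := by
    rw [excess, ← integral_indicator hS]
    refine integral_congr_ae (Eventually.of_forall fun x => ?_)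
    by_cases hx : k < (φ x).re
    · rw [indicator_of_mem (by exact hx)]; exact max_eq_left (by linarith)
    · rw [indicator_of_notMem (by exact hx)]; exact max_eq_right (by linarith)
  have h2 : ∫ x in S, ((φ x).re - k) ∂m ≤ ∫ x in S, (((φ x).re - k) + ε * (ψ x).re) ∂m := by
    rw [integral_add hφk.integrableOn hψε.integrableOn, integral_const_mul]
    exact le_add_of_nonneg_right (mul_nonneg hε (hA _ h k hk))
  rw [h1]
  refine h2.trans ?_
  rw [← integral_indicator hS, excess]
  refine integral_mono_ae ((hφk.add hψε).indicator hS) (integrable_excess (Lp_integrable (by norm_num) _) k) ?_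
  filter_upwards [Lp.coeFn_add φ (ε • ψ), Lp.coeFn_smul ε ψ] with x hx1 hx2
  simp only [hx1, Pi.add_apply, hx2, Pi.smul_apply]
  by_cases hx : k < (φ x).re
  · rw [indicator_of_mem (by exact hx)]
    refine le_max_of_le_left (le_of_eq ?_)
    simp; ring
  · rw [indicator_of_notMem (by exact hx)]; exact le_max_right _ _

/-- Truncated means are Lipschitz on L² and do not increase under resolvents, so
`le_of_resolvent_le` applies; linearity of the semigroup takes care of the rotations c. -/
lemma IsTruncationAccretive.excessLE_semigroup (hA : IsTruncationAccretive A) (hM : MAccretive A)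
    {T : C0Semigroup (Lp ℂ 2 m)} (hT : T.negGenerator = A) (t : ℝ≥0) (f : Lp ℂ 2 m) :
    ExcessLE m (T.toFun t f) f := by
  intro c _ k hk
  rw [excess_const_mul, excess_const_mul, ← map_smul]
  refine T.le_of_resolvent_le ?_ (excess_lipschitz k) (fun φ ψ h ε hε => hA.excess_le ?_ hk hε.le) t _
  · rw [hT]; exact hM.dense
  · rw [hT] at h; exact h

/-- Accretivity with ε = l⁻¹, since φ + l⁻¹ (f - l φ) = l⁻¹ f. -/
lemma IsTruncationAccretive.excessLE_resolvent (hA : IsTruncationAccretive A) {l : ℝ} (hl : 0 < l)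
    {φ f : Lp ℂ 2 m} (h : (φ, f - l • φ) ∈ A) :
    ExcessLE m φ (l⁻¹ • f : Lp ℂ 2 m) := by
  intro c _ k hk
  rw [excess_const_mul, excess_const_mul]
  have := hA.excess_le (A.smul_mem c h) hk (inv_pos.2 hl).le
  refine this.trans (le_of_eq ?_)
  have e : c • φ + l⁻¹ • c • (f - l • φ) = c • l⁻¹ • f := by
    rw [smul_comm l⁻¹ c, ← smul_add, smul_sub, smul_smul l⁻¹ l, inv_mul_cancel₀ hl.ne', one_smul]
    congr 1; abel
  simp only [e]

lemma IsTruncationAccretive.eLpNorm_resolvent_le (hA : IsTruncationAccretive A) {l : ℝ} (hl : 0 < l)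
    {φ f : Lp ℂ 2 m} (h : (φ, f - l • φ) ∈ A) {p : ℝ} (hp : 2 < p) :
    eLpNorm φ (ENNReal.ofReal p) m ≤
      4 * (ENNReal.ofReal l⁻¹ * eLpNorm f (ENNReal.ofReal p) m) := by
  refine (eLpNorm_le_of_excessLE hp (Lp_integrable (by norm_num) _) (Lp_integrable (by norm_num) _)
    (hA.excessLE_resolvent hl h)).trans (le_of_eq ?_)
  rw [eLpNorm_congr_ae (Lp.coeFn_smul l⁻¹ f), eLpNorm_const_smul,
    Real.enorm_of_nonneg (inv_pos.2 hl).le]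

/-- The inclusion `L^p ⊂ L²` for `p ≥ 2` on a finite measure space. -/
noncomputable def LpToL2 (m : Measure α) [IsFiniteMeasure m] (p : ℝ≥0∞) [Fact (1 ≤ p)]
    (hp : 2 ≤ p) : Lp ℂ p m →L[ℂ] Lp ℂ 2 m :=
  LinearMap.mkContinuous
    { toFun := fun f => ((Lp.memLp f).mono_exponent hp).toLp f
      map_add' := fun f g => by
        ext1
        filter_upwards [MemLp.coeFn_toLp ((Lp.memLp (f + g)).mono_exponent hp),
          Lp.coeFn_add f g, MemLp.coeFn_toLp ((Lp.memLp f).mono_exponent hp),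
          MemLp.coeFn_toLp ((Lp.memLp g).mono_exponent hp),
          Lp.coeFn_add (((Lp.memLp f).mono_exponent hp).toLp f)
            (((Lp.memLp g).mono_exponent hp).toLp g)] with x h1 h2 h3 h4 h5
        rw [h1, h2, h5, Pi.add_apply, Pi.add_apply, h3, h4]
      map_smul' := fun c f => by
        ext1
        filter_upwards [MemLp.coeFn_toLp ((Lp.memLp (c • f)).mono_exponent hp),
          Lp.coeFn_smul c f, MemLp.coeFn_toLp ((Lp.memLp f).mono_exponent hp),
          Lp.coeFn_smul c (((Lp.memLp f).mono_exponent hp).toLp f)] with x h1 h2 h3 h5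
        rw [h1, h2, RingHom.id_apply, h5, Pi.smul_apply, Pi.smul_apply, h3] }
    (m univ ^ (1 / (2 : ℝ≥0∞).toReal - 1 / p.toReal)).toReal fun f => by
      have h1 := eLpNorm_le_eLpNorm_mul_rpow_measure_univ hp (Lp.aestronglyMeasurable f)
      have h2 : (m univ ^ (1 / (2 : ℝ≥0∞).toReal - 1 / p.toReal)) ≠ ⊤ := by
        refine ENNReal.rpow_ne_top_of_nonneg ?_ (measure_ne_top _ _)
        rcases eq_or_ne p ⊤ with rfl | hpt
        · simp
        · have : (2 : ℝ≥0∞).toReal ≤ p.toReal := ENNReal.toReal_mono hpt hp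
          have h2 : (0 : ℝ) < (2 : ℝ≥0∞).toReal := by norm_num
          have := one_div_le_one_div_of_le h2 this
          linarith
      change ‖MemLp.toLp (f : α → ℂ) ((Lp.memLp f).mono_exponent hp)‖ ≤ _
      rw [Lp.norm_toLp, Lp.norm_def, mul_comm, ← ENNReal.toReal_mul]
      exact ENNReal.toReal_mono (ENNReal.mul_ne_top (Lp.eLpNorm_ne_top f) h2) h1

lemma LpToL2_coe {p : ℝ≥0∞} [Fact (1 ≤ p)] (hp : 2 ≤ p) (f : Lp ℂ p m) :
    LpToL2 m p hp f =ᵐ[m] f := MemLp.coeFn_toLp ((Lp.memLp f).mono_exponent hp)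

lemma LpToL2_eq_of_ae {p : ℝ≥0∞} [Fact (1 ≤ p)] (hp : 2 ≤ p) {f : Lp ℂ p m} {g : Lp ℂ 2 m}
    (h : f =ᵐ[m] g) : LpToL2 m p hp f = g := Lp.ext ((LpToL2_coe hp f).trans h)

omit [IsFiniteMeasure m] in
/-- A bounded sequence which converges in `L²` converges in `L^p`. -/
lemma tendsto_eLpNorm_of_tendsto_two {ι : Type*} {l : Filter ι} {p : ℝ} (hp : 2 < p)
    {d : ι → α → ℂ} {B : ℝ≥0∞} (hB : B ≠ ⊤) (hd : ∀ i, eLpNorm (d i) ∞ m ≤ B)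
    (h : Tendsto (fun i => eLpNorm (d i) 2 m) l (𝓝 0)) :
    Tendsto (fun i => eLpNorm (d i) (ENNReal.ofReal p) m) l (𝓝 0) := by
  have hp0 : 0 < p := by linarith
  have key : ∀ i, eLpNorm (d i) (ENNReal.ofReal p) m ≤
      (B ^ (p - 2) * eLpNorm (d i) 2 m ^ (2 : ℝ)) ^ (1 / p) := fun i => by
    rw [eLpNorm_eq_lintegral_rpow_enorm_toReal (by simpa using hp0) ENNReal.ofReal_ne_top,
      eLpNorm_eq_lintegral_rpow_enorm_toReal (by norm_num) (by norm_num),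
      ENNReal.toReal_ofReal hp0.le, ← ENNReal.rpow_mul]
    gcongr
    norm_num
    rw [← lintegral_const_mul' _ _ (ENNReal.rpow_ne_top_of_nonneg (by linarith) hB)]
    refine lintegral_mono_ae ?_
    filter_upwards [ae_le_eLpNormEssSup (f := d i) (μ := m)] with x hx
    have hx' : ‖d i x‖ₑ ≤ B := hx.trans (by rw [← eLpNorm_exponent_top]; exact hd i)
    calc ‖d i x‖ₑ ^ p = ‖d i x‖ₑ ^ (p - 2) * ‖d i x‖ₑ ^ (2 : ℝ) := by
          rw [← ENNReal.rpow_add_of_nonneg _ _ (by linarith) (by norm_num)]; ring_nf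
      _ ≤ B ^ (p - 2) * ‖d i x‖ₑ ^ (2 : ℝ) := by
          gcongr
      _ = _ := by norm_num
  refine tendsto_of_tendsto_of_tendsto_of_le_of_le tendsto_const_nhds ?_ (fun _ => zero_le) key
  have h1 : Tendsto (fun i => B ^ (p - 2) * eLpNorm (d i) 2 m ^ (2 : ℝ)) l (𝓝 0) := by
    have := ENNReal.Tendsto.const_mul (a := B ^ (p - 2)) (h.ennrpow_const (2 : ℝ))
      (Or.inr (ENNReal.rpow_ne_top_of_nonneg (by linarith) hB))
    simpa using this
  have := h1.ennrpow_const (1 / p)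
  rwa [ENNReal.zero_rpow_of_pos (by positivity)] at this

/-- A semigroup on `L²` which is bounded in `L^p` and `L^∞` restricts to a semigroup on `L^p`. -/
lemma exists_Lp_semigroup (T : C0Semigroup (Lp ℂ 2 m)) {p : ℝ} (hp : 2 < p)
    [Fact (1 ≤ ENNReal.ofReal p)] (hp2 : 2 ≤ ENNReal.ofReal p)
    (hb : ∀ t f, eLpNorm (T.toFun t f) (ENNReal.ofReal p) m ≤ 4 * eLpNorm f (ENNReal.ofReal p) m)
    (hb' : ∀ t f, eLpNorm (T.toFun t f) ∞ m ≤ 4 * eLpNorm f ∞ m) :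
    ∃ S : C0Semigroup (Lp ℂ (ENNReal.ofReal p) m), ∀ t f,
      LpToL2 m _ hp2 (S.toFun t f) = T.toFun t (LpToL2 m _ hp2 f) := by
  set P := ENNReal.ofReal p with hP
  let ι := LpToL2 m P hp2
  have hinj : ∀ f g : Lp ℂ P m, ι f = ι g → f = g := fun f g h => Lp.ext <|
    (LpToL2_coe hp2 f).symm.trans ((Filter.EventuallyEq.of_eq (by rw [show LpToL2 m P hp2 f =
      LpToL2 m P hp2 g from h])).trans (LpToL2_coe hp2 g))
  have hmem : ∀ t f, MemLp (T.toFun t (ι f)) P m := fun t f =>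
    ⟨Lp.aestronglyMeasurable _, (hb t _).trans_lt (ENNReal.mul_lt_top (by norm_num) (by
      rw [eLpNorm_congr_ae (LpToL2_coe hp2 f)]; exact Lp.eLpNorm_lt_top f))⟩
  have hex : ∀ t, ∃ S : Lp ℂ P m →L[ℂ] Lp ℂ P m, (∀ f, ι (S f) = T.toFun t (ι f)) ∧ ‖S‖ ≤ 4 := by
    intro t
    have hι : ∀ f, ι ((hmem t f).toLp _) = T.toFun t (ι f) := fun f =>
      LpToL2_eq_of_ae hp2 (MemLp.coeFn_toLp _)
    have hn : ∀ f, ‖(hmem t f).toLp _‖ ≤ 4 * ‖f‖ := fun f => by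
      rw [Lp.norm_toLp, Lp.norm_def, show (4 : ℝ) = (4 : ℝ≥0∞).toReal by norm_num,
        ← ENNReal.toReal_mul]
      refine ENNReal.toReal_mono (ENNReal.mul_ne_top (by norm_num) (Lp.eLpNorm_ne_top f)) ?_
      refine (hb t _).trans (le_of_eq ?_)
      rw [eLpNorm_congr_ae (LpToL2_coe hp2 f)]
    refine ⟨LinearMap.mkContinuous
      { toFun := fun f => (hmem t f).toLp _
        map_add' := fun f g => hinj _ _ ?_
        map_smul' := fun c f => hinj _ _ ?_ } 4 hn, hι,
      LinearMap.mkContinuous_norm_le _ (by norm_num) _⟩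
    · exact (hι _).trans (by rw [map_add, map_add, map_add, hι, hι])
    · exact (hι _).trans (by rw [map_smul, map_smul, RingHom.id_apply, map_smul, hι])
  choose S hS hSn using hex
  -- The orbit of an indicator function is bounded in L^∞ and continuous in L², hence continuous in
  -- L^p. The uniform bound 4 carries this over to sums and limits of such functions.
  have hcont : ∀ f, Continuous fun t => S t f := by
    intro f
    refine Lp.induction (p := P) ENNReal.ofReal_ne_top (fun f : Lp ℂ P m => Continuous fun t => S t f)
      ?_ ?_ ?_ f
    · intro c s hs hμs
      set g : Lp ℂ P m := (Lp.simpleFunc.indicatorConst P hs hμs.ne c : Lp ℂ P m)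
      have hgb : eLpNorm (ι g) ∞ m ≤ ENNReal.ofReal ‖c‖ := by
        rw [eLpNorm_congr_ae (LpToL2_coe hp2 g)]
        have : g =ᵐ[m] s.indicator fun _ => c := by
          simp only [g, Lp.simpleFunc.coe_indicatorConst]
          exact indicatorConstLp_coeFn
        rw [eLpNorm_congr_ae this, eLpNorm_exponent_top]
        refine eLpNormEssSup_le_of_ae_bound (Eventually.of_forall fun x => ?_)
        by_cases hx : x ∈ s <;> simp [hx]
      rw [continuous_iff_continuousAt]
      intro t₀
      rw [ContinuousAt, tendsto_iff_norm_sub_tendsto_zero]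
      have hsub : ∀ t, (S t g - S t₀ g : Lp ℂ P m) =ᵐ[m]
          (T.toFun t (ι g) - T.toFun t₀ (ι g) : Lp ℂ 2 m) := fun t => by
        rw [← hS, ← hS, ← map_sub]; exact (LpToL2_coe hp2 _).symm
      have h2 : Tendsto (fun t => eLpNorm (T.toFun t (ι g) - T.toFun t₀ (ι g) : Lp ℂ 2 m) P m)
          (𝓝 t₀) (𝓝 0) := by
        refine tendsto_eLpNorm_of_tendsto_two (B := 4 * ENNReal.ofReal ‖c‖ + 4 * ENNReal.ofReal ‖c‖)
          hp (by finiteness) (fun t => ?_) ?_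
        · rw [eLpNorm_congr_ae (Lp.coeFn_sub _ _)]
          refine (eLpNorm_sub_le (Lp.aestronglyMeasurable _) (Lp.aestronglyMeasurable _)
            (by simp)).trans ?_
          gcongr
          · exact (hb' _ _).trans (by gcongr)
          · exact (hb' _ _).trans (by gcongr)
        · have := (tendsto_iff_norm_sub_tendsto_zero.1 ((T.continuous' (ι g)).tendsto t₀))
          have h3 := ENNReal.tendsto_ofReal this
          rw [ENNReal.ofReal_zero] at h3
          refine h3.congr fun t => ?_
          rw [Lp.norm_def, ENNReal.ofReal_toReal (Lp.eLpNorm_ne_top _)]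
      have h3 := (ENNReal.tendsto_toReal ENNReal.zero_ne_top).comp h2
      rw [ENNReal.toReal_zero] at h3
      refine h3.congr fun t => ?_
      simp only [Function.comp_apply]
      rw [Lp.norm_def, eLpNorm_congr_ae (hsub t)]
    · intro f g hf hg _ h1 h2
      simp only [map_add]
      exact h1.add h2
    · refine isClosed_of_closure_subset fun f hf => ?_
      refine continuous_of_uniform_approx_of_continuous fun u hu => ?_
      obtain ⟨ε, hε, hεu⟩ := Metric.mem_uniformity_dist.1 hu
      -- Distance ε/5 suffices because the operators have norm at most 4.
      obtain ⟨g, hg, hfg⟩ := Metric.mem_closure_iff.1 hf (ε / 5) (by positivity)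
      refine ⟨fun t => S t g, hg, fun t => hεu ?_⟩
      rw [dist_eq_norm, ← map_sub]
      rw [dist_eq_norm] at hfg
      have := (S t).le_of_opNorm_le (hSn t) (f - g)
      linarith
  refine ⟨{ toFun := S, map_zero' := ?_, map_add' := fun s t => ?_, continuous' := hcont }, hS⟩
  · ext1 f
    exact hinj _ _ (by rw [hS, T.map_zero']; rfl)
  · ext1 f
    exact hinj _ _ (by rw [ContinuousLinearMap.comp_apply, hS, hS, hS, T.map_add']; rfl)

/-- The inclusion is continuous and intertwines the semigroups. Thus A_p is a part of A_2, and its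
resolvents can be computed in L². -/
lemma negGenerator_LpToL2 {T : C0Semigroup (Lp ℂ 2 m)} {p : ℝ≥0∞} [Fact (1 ≤ p)] (hp2 : 2 ≤ p)
    {S : C0Semigroup (Lp ℂ p m)}
    (hS : ∀ t f, LpToL2 m p hp2 (S.toFun t f) = T.toFun t (LpToL2 m p hp2 f))
    {x y : Lp ℂ p m} (h : (x, y) ∈ S.negGenerator) :
    (LpToL2 m p hp2 x, LpToL2 m p hp2 y) ∈ T.negGenerator := by
  have h' : Tendsto (fun t : ℝ≥0 => ((t : ℝ)⁻¹ : ℝ) • (x - S.toFun t x)) (𝓝[>] 0) (𝓝 y) := h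
  change Tendsto (fun t : ℝ≥0 => ((t : ℝ)⁻¹ : ℝ) • (LpToL2 m p hp2 x -
    T.toFun t (LpToL2 m p hp2 x))) (𝓝[>] 0) (𝓝 (LpToL2 m p hp2 y))
  refine (((LpToL2 m p hp2).continuous.tendsto y).comp h').congr fun t => ?_
  rw [Function.comp_apply, ContinuousLinearMap.map_smul_of_tower, map_sub, hS]

end LpSemigroup

/-! ### Stampacchia's method and the resolvent estimate from `L^p` to `L^∞` -/

/-- Stampacchia's lemma on the vanishing of level sets. -/
lemma stampacchia_vanishing {b : ℝ → ℝ} (hb0 : ∀ k, 0 ≤ b k) (hanti : Antitone b)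
    {K σ k₀ d : ℝ} (hK : 0 ≤ K) (hσ : 1 < σ) (hd0 : 0 < d)
    (h : ∀ k h, k₀ ≤ k → k < h → (h - k) * b h ≤ K * b k ^ σ)
    (hd : 2 * K * b k₀ ^ (σ - 1) ≤ d * (1 / 2) ^ (1 / (σ - 1))) : b (k₀ + d) = 0 := by
  set q : ℝ := (1 / 2) ^ (1 / (σ - 1)) with hq
  have hσ' : 0 < σ - 1 := by linarith
  have hq0 : 0 < q := Real.rpow_pos_of_pos (by norm_num) _
  have hq1 : q < 1 := Real.rpow_lt_one (by norm_num) (by norm_num) (by positivity)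
  have hqσ : q ^ (σ - 1) = 1 / 2 := by
    rw [hq, ← Real.rpow_mul (by norm_num), one_div_mul_cancel hσ'.ne', Real.rpow_one]
  have hqσ' : q ^ σ = q / 2 := by
    rw [show σ = (σ - 1) + 1 by ring, Real.rpow_add_one hq0.ne', hqσ]; ring
  rcases (hb0 k₀).eq_or_lt with h0 | h0
  · exact le_antisymm ((hanti (by linarith)).trans h0.ge) (hb0 _)
  have hbσ : b k₀ ^ σ = b k₀ ^ (σ - 1) * b k₀ := by
    rw [← Real.rpow_add_one h0.ne']; ring_nf
  -- At the levels k₀ + d (1 - 2^(-j)) geometric decay reproduces itself: as q^(σ-1) = 1/2, the gain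
  -- q^(jσ) = q^j 2^(-j) compensates for the shrinking gap d 2^(-j-1), and the condition on d
  -- supplies one more factor q.
  have key : ∀ j : ℕ, b (k₀ + d * (1 - (1 / 2) ^ j)) ≤ b k₀ * q ^ j := by
    intro j
    induction j with
    | zero => simp
    | succ j ih =>
      have h2 : (0 : ℝ) < (1 / 2) ^ j := by positivity
      have h3 : ((1 / 2) ^ j : ℝ) ≤ 1 := pow_le_one₀ (by norm_num) (by norm_num)
      have hstep := h (k₀ + d * (1 - (1 / 2) ^ j)) (k₀ + d * (1 - (1 / 2) ^ (j + 1)))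
        (by nlinarith) (by rw [pow_succ]; nlinarith)
      have e1 : k₀ + d * (1 - (1 / 2) ^ (j + 1)) - (k₀ + d * (1 - (1 / 2) ^ j)) =
          d * ((1 / 2) ^ j / 2) := by rw [pow_succ]; ring
      have e2 : (b k₀ * q ^ j) ^ σ = b k₀ ^ (σ - 1) * b k₀ * (q ^ j * (1 / 2) ^ j) := by
        rw [Real.mul_rpow h0.le (by positivity), hbσ, ← Real.rpow_natCast q j,
          ← Real.rpow_mul hq0.le, mul_comm (j : ℝ) σ, Real.rpow_mul hq0.le, hqσ', Real.rpow_natCast,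
          Real.rpow_natCast, ← mul_pow]
        ring
      have h4 : b (k₀ + d * (1 - (1 / 2) ^ j)) ^ σ ≤ (b k₀ * q ^ j) ^ σ :=
        Real.rpow_le_rpow (hb0 _) ih (by linarith)
      rw [e1] at hstep
      have h5 := hstep.trans (mul_le_mul_of_nonneg_left h4 hK)
      rw [e2] at h5
      have h6 : (2 * K * b k₀ ^ (σ - 1)) * (b k₀ * q ^ j) ≤ d * q * (b k₀ * q ^ j) :=
        mul_le_mul_of_nonneg_right hd (by positivity)
      have h7 : (d * (1 / 2) ^ j) * b (k₀ + d * (1 - (1 / 2) ^ (j + 1))) ≤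
          (d * (1 / 2) ^ j) * (b k₀ * q ^ (j + 1)) := by
        rw [pow_succ q]
        nlinarith
      exact le_of_mul_le_mul_left h7 (by positivity)
  have hlim : Tendsto (fun j : ℕ => b k₀ * q ^ j) atTop (𝓝 0) := by
    simpa using (tendsto_pow_atTop_nhds_zero_of_lt_one hq0.le hq1).const_mul (b k₀)
  refine le_antisymm (ge_of_tendsto hlim (Eventually.of_forall fun j => ?_)) (hb0 _)
  refine (hanti ?_).trans (key j)
  have h2 : (0 : ℝ) < (1 / 2) ^ j := by positivity
  nlinarith

section Stampacchia

variable {α : Type*} [MeasurableSpace α] {m : Measure α} [IsFiniteMeasure m]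
  {A : Submodule ℂ (Lp ℂ 2 m × Lp ℂ 2 m)}

/-- The positive part `(Re φ - k)⁺`. -/
def rePart (k : ℝ) (φ : α → ℂ) (x : α) : ℝ := max ((φ x).re - k) 0

/-- A Sobolev inequality for the truncations of the elements of the domain. -/
def HasSobolev (A : Submodule ℂ (Lp ℂ 2 m × Lp ℂ 2 m)) (r C : ℝ) : Prop :=
  ∀ z ∈ A, ∀ k : ℝ, 0 ≤ k → eLpNorm (rePart k z.1) (ENNReal.ofReal r) m ^ 2 ≤
    ENNReal.ofReal (C * ∫ x, ((z.2 x).re + rePart k z.1 x) * rePart k z.1 x ∂m)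

omit [IsFiniteMeasure m] in
lemma aestronglyMeasurable_rePart (k : ℝ) (φ : Lp ℂ 2 m) : AEStronglyMeasurable (rePart k φ) m :=
  (((Complex.measurable_re.comp (Lp.stronglyMeasurable φ).measurable).sub_const k).max
    measurable_const).aestronglyMeasurable

lemma memLp_rePart (k : ℝ) (φ : Lp ℂ 2 m) : MemLp (rePart k φ) 2 m :=
  ((Lp.memLp φ).norm.add (memLp_const |k|)).mono (aestronglyMeasurable_rePart k φ)
    (Eventually.of_forall fun x => by
      rw [Real.norm_of_nonneg (show 0 ≤ rePart k φ x from le_max_right _ _), Pi.add_apply,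
        Real.norm_of_nonneg (by positivity)]
      refine max_le ?_ (by positivity)
      linarith [Complex.re_le_norm (φ x), neg_abs_le k])

/-- Test with v = (Re φ - k)⁺. The Sobolev inequality gives ‖v‖_r² ≤ C ∫ |f| v, and Hölder on {Re φ
> k} bounds the integral by F ‖v‖_r times the measure of this set to the power 1 - 1/p - 1/r. Divide
by ‖v‖_r and apply Chebyshev at height k' - k. -/
lemma HasSobolev.level_set_estimate {p r C : ℝ} (hp : 2 < p) (hr : 2 < r) (hC : 0 ≤ C)
    (hS : HasSobolev A r C) {l : ℝ} (hl : 1 ≤ l) {φ f : Lp ℂ 2 m} (h : (φ, f - l • φ) ∈ A)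
    {F : ℝ} (hF0 : 0 ≤ F) (hF : eLpNorm f (ENNReal.ofReal p) m ≤ ENNReal.ofReal F)
    {k k' : ℝ} (hk : 0 ≤ k) (hkk' : k < k') :
    (k' - k) * m.real {x | k' < (φ x).re} ^ (1 / r) ≤
      C * F * m.real {x | k < (φ x).re} ^ (1 - (1 / p + 1 / r)) := by
  set v := rePart k φ with hv
  have hv0 : ∀ x, 0 ≤ v x := fun x => le_max_right _ _
  have hvm : AEStronglyMeasurable v m := aestronglyMeasurable_rePart k φ
  have hvL : MemLp v 2 m := memLp_rePart k φ
  set S := {x | k < (φ x).re} with hSdef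
  have hSm : MeasurableSet S := measurableSet_re_gt k φ
  have hp0 : 0 < p := by linarith
  have hr0 : 0 < r := by linarith
  set e := 1 - (1 / p + 1 / r) with he
  have he0 : 0 < e := by
    have h1 : 1 / p < 1 / 2 := one_div_lt_one_div_of_lt (by norm_num) hp
    have h2 : 1 / r < 1 / 2 := one_div_lt_one_div_of_lt (by norm_num) hr
    linarith
  have hfv : Integrable (fun x => ‖f x‖ * v x) m := (Lp.memLp f).norm.integrable_mul hvL
  -- Where v > 0 one has Re φ > k ≥ 0, so l ≥ 1 gives -l Re φ + v = (1 - l) Re φ - k ≤ 0, and only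
  -- Re f survives.
  have hint : ∫ x, (((f - l • φ : Lp ℂ 2 m) x).re + v x) * v x ∂m ≤ ∫ x, ‖f x‖ * v x ∂m := by
    refine integral_mono_ae ?_ hfv ?_
    · exact ((Lp.memLp (f - l • φ)).re.add hvL).integrable_mul hvL
    · filter_upwards [Lp.coeFn_sub f (l • φ), Lp.coeFn_smul l φ] with x h1 h2
      simp only [h1, Pi.sub_apply, h2, Pi.smul_apply, Complex.sub_re, Complex.smul_re, smul_eq_mul]
      have h3 := Complex.re_le_norm (f x)
      rcases le_total ((φ x).re - k) 0 with h4 | h4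
      · have : v x = 0 := max_eq_right h4
        rw [this]; simp
      · have h5 : v x = (φ x).re - k := max_eq_left h4
        refine mul_le_mul_of_nonneg_right ?_ (hv0 x)
        nlinarith
  have hHolder : ENNReal.ofReal (∫ x, ‖f x‖ * v x ∂m) ≤
      eLpNorm f (ENNReal.ofReal p) m * eLpNorm v (ENNReal.ofReal r) m * m S ^ e := by
    have : ENNReal.HolderTriple (ENNReal.ofReal p) (ENNReal.ofReal r)
        (ENNReal.ofReal (p⁻¹ + r⁻¹)⁻¹) := (Real.HolderTriple.of_pos hp0 hr0).ennrealOfReal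
    have hs1 : 1 ≤ (p⁻¹ + r⁻¹)⁻¹ := by
      rw [one_le_inv₀ (by positivity)]
      rw [he, one_div, one_div] at he0
      linarith
    have hind : S.indicator (fun x => ‖f x‖ * v x) = fun x => ‖f x‖ * v x := by
      refine indicator_eq_self.2 fun x hx => ?_
      by_contra hxS
      have : v x = 0 := max_eq_right (by
        have : ¬ k < (φ x).re := hxS
        linarith)
      exact hx (by simp [this])
    have e1 : ENNReal.ofReal (∫ x, ‖f x‖ * v x ∂m) = eLpNorm (fun x => ‖f x‖ * v x) 1 m := by
      rw [ofReal_integral_eq_lintegral_ofReal hfv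
        (Eventually.of_forall fun x => mul_nonneg (norm_nonneg _) (hv0 x)),
        eLpNorm_one_eq_lintegral_enorm]
      refine lintegral_congr fun x => ?_
      rw [Real.enorm_of_nonneg (mul_nonneg (norm_nonneg _) (hv0 x))]
    rw [e1, ← hind, eLpNorm_indicator_eq_eLpNorm_restrict hSm]
    refine (eLpNorm_le_eLpNorm_mul_rpow_measure_univ (q := ENNReal.ofReal (p⁻¹ + r⁻¹)⁻¹)
      (by rwa [ENNReal.one_le_ofReal]) hfv.1.restrict).trans ?_
    have e2 : (1 / (1 : ℝ≥0∞).toReal - 1 / (ENNReal.ofReal (p⁻¹ + r⁻¹)⁻¹).toReal) = e := by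
      rw [ENNReal.toReal_ofReal (by positivity), he]
      simp
    rw [e2, Measure.restrict_apply_univ]
    gcongr
    have := eLpNorm_smul_le_mul_eLpNorm (p := ENNReal.ofReal p) (q := ENNReal.ofReal r)
      (r := ENNReal.ofReal (p⁻¹ + r⁻¹)⁻¹) (f := v) (φ := fun x => ‖f x‖) (μ := m)
      hvm (Lp.aestronglyMeasurable f).norm
    rw [eLpNorm_norm] at this
    exact (eLpNorm_mono_measure _ Measure.restrict_le_self).trans this
  have hsob := hS _ h k hk
  -- Finiteness, needed for the division by ‖v‖_r, comes from the Sobolev inequality itself: its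
  -- right-hand side is a real number.
  have hVtop : eLpNorm v (ENNReal.ofReal r) m ≠ ⊤ := by
    intro htop
    have := hsob.trans_lt ENNReal.ofReal_lt_top
    simp only [← hv] at this
    rw [htop] at this
    simp at this
  set V := (eLpNorm v (ENNReal.ofReal r) m).toReal with hV
  have hV0 : 0 ≤ V := ENNReal.toReal_nonneg
  have hmS : m S ^ e = ENNReal.ofReal (m.real S ^ e) := by
    rw [← ENNReal.ofReal_rpow_of_nonneg measureReal_nonneg he0.le, ofReal_measureReal]
  have h1 : V ^ 2 ≤ C * (F * V * m.real S ^ e) := by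
    have h2 : ENNReal.ofReal (V ^ 2) ≤ ENNReal.ofReal (C * (F * V * m.real S ^ e)) := by
      rw [ENNReal.ofReal_pow hV0, hV, ENNReal.ofReal_toReal hVtop]
      refine hsob.trans ?_
      rw [ENNReal.ofReal_mul hC, ENNReal.ofReal_mul hC]
      refine mul_le_mul' le_rfl ?_
      refine (ENNReal.ofReal_le_ofReal hint).trans (hHolder.trans ?_)
      rw [ENNReal.ofReal_mul (by positivity), ENNReal.ofReal_mul hF0, hmS,
        ENNReal.ofReal_toReal hVtop]
      gcongr
    exact (ENNReal.ofReal_le_ofReal_iff (by positivity)).1 h2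
  have h2 : V ≤ C * F * m.real S ^ e := by
    rcases hV0.eq_or_lt with h0 | h0
    · rw [← h0]; positivity
    · refine le_of_mul_le_mul_right ?_ h0
      nlinarith
  refine le_trans ?_ h2
  have hd : 0 < k' - k := by linarith
  have hcheb := mul_meas_ge_le_pow_eLpNorm' m (p := ENNReal.ofReal r) (by simpa using hr0)
    ENNReal.ofReal_ne_top hvm (ENNReal.ofReal (k' - k))
  rw [ENNReal.toReal_ofReal hr0.le] at hcheb
  have hsub : m {x | k' < (φ x).re} ≤ m {x | ENNReal.ofReal (k' - k) ≤ ‖v x‖ₑ} := by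
    refine measure_mono fun x hx => ?_
    have hx' : k' < (φ x).re := hx
    rw [mem_ofPred_eq, Real.enorm_of_nonneg (hv0 x)]
    exact ENNReal.ofReal_le_ofReal (le_max_of_le_left (by linarith))
  have h3 : ENNReal.ofReal (k' - k) ^ r * m {x | k' < (φ x).re} ≤
      eLpNorm v (ENNReal.ofReal r) m ^ r := le_trans (by gcongr) hcheb
  have h4 : ((k' - k) * m.real {x | k' < (φ x).re} ^ (1 / r)) ^ r ≤ V ^ r := by
    rw [Real.mul_rpow hd.le (by positivity), ← Real.rpow_mul measureReal_nonneg,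
      one_div_mul_cancel hr0.ne', Real.rpow_one]
    have := ENNReal.toReal_mono (ENNReal.rpow_ne_top_of_nonneg hr0.le hVtop) h3
    rwa [ENNReal.toReal_mul, ← ENNReal.toReal_rpow, ENNReal.toReal_ofReal hd.le,
      ← ENNReal.toReal_rpow] at this
  exact (Real.rpow_le_rpow_iff (by positivity) hV0 hr0).1 h4

/-- The `L^p`-`L^∞` estimate for the resolvents. -/
lemma HasSobolev.eLpNorm_top_resolvent_le {p r C : ℝ} (hp : 2 < p) (hr : 2 < r) (hC : 0 ≤ C)
    (hα : r / ((r - 2) * p) < 1) (hS : HasSobolev A r C) (hA : IsTruncationAccretive A) :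
    ∃ C' : ℝ, 0 < C' ∧ ∀ l : ℝ, 1 ≤ l → ∀ φ f : Lp ℂ 2 m, (φ, f - l • φ) ∈ A → ∀ F : ℝ, 0 < F →
      eLpNorm f (ENNReal.ofReal p) m ≤ ENNReal.ofReal F →
      eLpNorm φ ⊤ m ≤ ENNReal.ofReal (C' * l ^ (r / ((r - 2) * p) - 1) * F) := by
  have hp0 : 0 < p := by linarith
  have hr0 : 0 < r := by linarith
  have hr2 : 0 < r - 2 := by linarith
  set a := r / ((r - 2) * p) with ha
  have ha0 : 0 < a := by positivity
  -- With b(k) the measure of {Re φ > k} to the power 1/r, the level set estimate reads (k' - k)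
  -- b(k') ≤ C F b(k)^σ. Here σ - 1 = (1 - a)(r - 2), which is positive because a < 1.
  set σ := r * (1 - (1 / p + 1 / r)) with hσ
  have hσe : σ - 1 = (1 - a) * (r - 2) := by
    rw [hσ, ha]; field_simp; ring
  have hσ1 : 1 < σ := by
    have : 0 < (1 - a) * (r - 2) := mul_pos (by linarith) hr2
    linarith
  have hpa : p / r * (σ - 1) = (1 - a) / a := by
    rw [hσe, ha]; field_simp
  set q : ℝ := (1 / 2) ^ (1 / (σ - 1)) with hq
  have hq0 : 0 < q := Real.rpow_pos_of_pos (by norm_num) _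
  set B : ℝ := 2 * C * 4 ^ ((1 - a) / a) / q with hB
  have hB0 : 0 ≤ B := by positivity
  have key : ∀ l : ℝ, 1 ≤ l → ∀ φ f : Lp ℂ 2 m, (φ, f - l • φ) ∈ A → ∀ F : ℝ, 0 < F →
      eLpNorm f (ENNReal.ofReal p) m ≤ ENNReal.ofReal F →
      eLpNorm (fun x => max (φ x).re 0) ⊤ m ≤ ENNReal.ofReal ((B + 2) * l ^ (a - 1) * F) := by
    intro l hl φ f h F hF0 hF
    have hl0 : 0 < l := by linarith
    -- The starting level already has the size of the claimed bound. The `L^p` estimate and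
    -- Chebyshev give {Re φ > k₀} a measure of at most (4 l^(-a))^p, so b(k₀)^(σ-1) is at most a
    -- constant times l^(a-1). This is where the decay in l enters.
    set k₀ := l ^ (a - 1) * F with hk₀
    have hk₀0 : 0 < k₀ := by positivity
    let b : ℝ → ℝ := fun k => m.real {x | k < (φ x).re} ^ (1 / r)
    have hbσ : ∀ k, b k ^ σ = m.real {x | k < (φ x).re} ^ (1 - (1 / p + 1 / r)) := fun k => by
      simp only [b]
      rw [← Real.rpow_mul measureReal_nonneg, hσ]
      congr 1
      field_simp
    have hbk₀ : b k₀ ^ (σ - 1) ≤ 4 ^ ((1 - a) / a) * l ^ (a - 1) := by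
      have h1 := hA.eLpNorm_resolvent_le hl0 h hp
      have h2 : eLpNorm φ (ENNReal.ofReal p) m ≤ ENNReal.ofReal (4 * l⁻¹ * F) := by
        refine h1.trans ?_
        rw [mul_assoc, ENNReal.ofReal_mul (by norm_num), ENNReal.ofReal_mul (by positivity)]
        norm_num
        gcongr
      have hcheb := mul_meas_ge_le_pow_eLpNorm' m (p := ENNReal.ofReal p) (by simpa using hp0)
        ENNReal.ofReal_ne_top (Lp.aestronglyMeasurable φ) (ENNReal.ofReal k₀)
      rw [ENNReal.toReal_ofReal hp0.le] at hcheb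
      have hsub : m {x | k₀ < (φ x).re} ≤ m {x | ENNReal.ofReal k₀ ≤ ‖φ x‖ₑ} := by
        refine measure_mono fun x hx => ?_
        have hx' : k₀ < (φ x).re := hx
        rw [mem_ofPred_eq, ← ofReal_norm]
        exact ENNReal.ofReal_le_ofReal (hx'.le.trans (Complex.re_le_norm _))
      have h3 : ENNReal.ofReal k₀ ^ p * m {x | k₀ < (φ x).re} ≤
          ENNReal.ofReal (4 * l⁻¹ * F) ^ p :=
        le_trans (by gcongr) (hcheb.trans (by gcongr))
      have h4 : k₀ ^ p * m.real {x | k₀ < (φ x).re} ≤ (4 * l⁻¹ * F) ^ p := by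
        have := ENNReal.toReal_mono (ENNReal.rpow_ne_top_of_nonneg hp0.le ENNReal.ofReal_ne_top) h3
        rwa [ENNReal.toReal_mul, ← ENNReal.toReal_rpow, ENNReal.toReal_ofReal hk₀0.le,
          ← ENNReal.toReal_rpow, ENNReal.toReal_ofReal (by positivity)] at this
      have e5 : 4 * l⁻¹ * F = k₀ * (4 * l ^ (-a)) := by
        rw [hk₀]
        have : l⁻¹ = l ^ (a - 1) * l ^ (-a) := by
          rw [← Real.rpow_add hl0, ← Real.rpow_neg_one]; ring_nf
        rw [this]; ring
      rw [e5, Real.mul_rpow hk₀0.le (by positivity)] at h4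
      have h6 : m.real {x | k₀ < (φ x).re} ≤ (4 * l ^ (-a)) ^ p :=
        le_of_mul_le_mul_left h4 (by positivity)
      have h7 : b k₀ ^ (σ - 1) = m.real {x | k₀ < (φ x).re} ^ (1 / r * (σ - 1)) := by
        simp only [b]; rw [← Real.rpow_mul measureReal_nonneg]
      rw [h7]
      refine (Real.rpow_le_rpow measureReal_nonneg h6 (mul_nonneg (by positivity)
        (by linarith))).trans (le_of_eq ?_)
      rw [← Real.rpow_mul (by positivity), show p * (1 / r * (σ - 1)) = (1 - a) / a by
        rw [← hpa]; ring, Real.mul_rpow (by norm_num) (by positivity), ← Real.rpow_mul hl0.le]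
      congr 2
      field_simp
      ring
    -- The factor B + 1 instead of B keeps d positive when C = 0.
    have hvan := stampacchia_vanishing (b := b) (K := C * F) (σ := σ) (k₀ := k₀)
      (d := (B + 1) * l ^ (a - 1) * F) (fun k => Real.rpow_nonneg measureReal_nonneg _)
      (fun k k' hkk' => Real.rpow_le_rpow measureReal_nonneg (measureReal_mono
        fun x (hx : k' < (φ x).re) => lt_of_le_of_lt hkk' hx) (by positivity))
      (by positivity) hσ1 (by positivity) (fun k k' hk hkk' => by
        rw [hbσ]
        exact hS.level_set_estimate hp hr hC hl h hF0.le hF (hk₀0.le.trans hk) hkk') (by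
        calc 2 * (C * F) * b k₀ ^ (σ - 1)
            ≤ 2 * (C * F) * (4 ^ ((1 - a) / a) * l ^ (a - 1)) := by gcongr
          _ = B * l ^ (a - 1) * F * q := by rw [hB]; field_simp
          _ ≤ (B + 1) * l ^ (a - 1) * F * q := by gcongr; linarith)
    have hM : k₀ + (B + 1) * l ^ (a - 1) * F = (B + 2) * l ^ (a - 1) * F := by rw [hk₀]; ring
    rw [hM] at hvan
    have h8 : m.real {x | (B + 2) * l ^ (a - 1) * F < (φ x).re} = 0 :=
      (Real.rpow_eq_zero measureReal_nonneg (by positivity)).1 hvan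
    have h9 : ∀ᵐ x ∂m, (φ x).re ≤ (B + 2) * l ^ (a - 1) * F := by
      rw [ae_iff]
      simp only [not_le]
      exact (measureReal_eq_zero_iff).1 h8
    rw [eLpNorm_exponent_top]
    refine eLpNormEssSup_le_of_ae_bound (h9.mono fun x hx => ?_)
    rw [Real.norm_of_nonneg (le_max_right _ _)]
    exact max_le hx (by positivity)
  refine ⟨4 * (B + 2), by positivity, fun l hl φ f h F hF0 hF => ?_⟩
  have hl0 : 0 < l := by linarith
  have := eLpNorm_le_of_re_parts (m := m) (p := ⊤) le_top (g := φ)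
    (C := ENNReal.ofReal ((B + 2) * l ^ (a - 1) * F)) (Lp.aestronglyMeasurable φ) fun c hc => by
      have hcf : (c • φ, c • f - l • c • φ) ∈ A := by
        have := A.smul_mem c h
        rwa [Prod.smul_mk, smul_sub, smul_comm c l] at this
      have h1 := key l hl (c • φ) (c • f) hcf F hF0 (by
        rw [eLpNorm_congr_ae (Lp.coeFn_smul c f), eLpNorm_const_smul]
        rwa [show ‖c‖ₑ = 1 by rw [← ofReal_norm, hc, ENNReal.ofReal_one], one_mul])
      refine le_trans (le_of_eq (eLpNorm_congr_ae ?_)) h1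
      filter_upwards [Lp.coeFn_smul c φ] with x hx
      simp only [hx, Pi.smul_apply, smul_eq_mul]
  refine this.trans (le_of_eq ?_)
  rw [show 4 * (B + 2) * l ^ (a - 1) * F = 4 * ((B + 2) * l ^ (a - 1) * F) by ring,
    ENNReal.ofReal_mul (p := 4) (by norm_num), ENNReal.ofReal_ofNat]

end Stampacchia

/-! ### From the Balakrishnan integral to the power of 1 + A -/

section BalakrishnanIntegral

variable {H X : Type*} [NormedAddCommGroup H] [InnerProductSpace ℂ H] [CompleteSpace H]
  [NormedAddCommGroup X] [NormedSpace ℂ X] [CompleteSpace X] {A : Submodule ℂ (H × H)}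

/-- An integral representation of the elements of the domain of a Balakrishnan operator. -/
lemma MAccretive.exists_re_inner_eq_integral (hM : MAccretive A) (ι : X →L[ℂ] H)
    {B : Set (X × X)} (hB : ∀ z ∈ B, (ι z.1, ι z.2) ∈ A) {θ C : ℝ} (hθ0 : 0 < θ) (hθ1 : θ < 1)
    {u w : X} (huw : (u, w) ∈ balakrishnan B θ)
    (hqC : ∀ σ : ℝ, 0 < σ → ∀ y : X, ι y = (σ : ℂ) • hM.res σ (hM.res (σ + 1) (ι u)) →
      ‖y‖ ≤ C * ‖u‖ / (1 + σ)) :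
    ∃ W : X, ‖W‖ ≤ (Real.sin (Real.pi * θ) / Real.pi)⁻¹ * ‖w‖ +
        C * ‖u‖ * ∫ σ in Ioi (0 : ℝ), σ ^ (θ - 1) / (1 + σ) ∧
      ∀ h : H, ∫ s in Ioi (0 : ℝ), s ^ (-θ) * (inner ℂ h (hM.res (s + 1) (ι W))).re =
        (inner ℂ h (ι u)).re * fracConst θ := by
  obtain ⟨z, hz, R, hR, hRint, hw⟩ := huw
  set c := Real.sin (Real.pi * θ) / Real.pi with hc
  have hc0 : 0 < c := by
    refine div_pos (Real.sin_pos_of_pos_of_lt_pi (by positivity) ?_) Real.pi_pos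
    nlinarith [Real.pi_pos]
  set K₁ := ∫ σ in Ioi (0 : ℝ), σ ^ (θ - 1) / (1 + σ) with hK₁
  have hI₁ := integrableOn_rpow_div_one_add (a := θ - 1) (by linarith) (by linarith)
  have hz2 : (ι u, ι z) ∈ A := hB _ hz
  have hR2 : ∀ s : ℝ, 0 < s → hM.res s (ι z) = ι (R s) := fun s hs => by
    refine hM.res_eq hs ?_
    have := hB _ (hR s hs)
    rwa [map_sub, ContinuousLinearMap.map_smul_of_tower] at this
  set x := ι z + (1 : ℝ) • ι u with hx
  have hux : hM.res 1 x = ι u := hM.res_add one_pos hz2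
  -- This is (σ + 1 + A)⁻¹ (1 + A) u - (σ + A)⁻¹ A u, written in terms of R and u only, so that it
  -- is an element of X. The resolvent identity gives it the form σ (σ + A)⁻¹ (σ + 1 + A)⁻¹ u.
  let q : ℝ → X := fun σ => R (σ + 1) + (σ + 1)⁻¹ • (u - R (σ + 1)) - R σ
  have hN : ∀ σ : ℝ, 0 < σ → hM.res (σ + 1) x = ι (R σ) + ι (q σ) := fun σ hσ => by
    have h1 : 0 < σ + 1 := by linarith
    have h2 := hM.res_add h1 hz2
    rw [map_add, ContinuousLinearMap.map_smul_of_tower] at h2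
    have h3 : hM.res (σ + 1) (ι u) = (σ + 1)⁻¹ • (ι u - hM.res (σ + 1) (ι z)) := by
      rw [eq_inv_smul_iff₀ h1.ne', eq_sub_iff_add_eq, add_comm]; exact h2
    simp only [q]
    rw [hx, one_smul, map_add, h3, hR2 _ h1, map_sub, map_add,
      ContinuousLinearMap.map_smul_of_tower, map_sub]
    abel
  have hqι : ∀ σ : ℝ, 0 < σ → ι (q σ) = σ • hM.res σ (hM.res (σ + 1) (ι u)) := fun σ hσ => by
    have h1 : 0 < σ + 1 := by linarith
    have h2 := hM.res_add h1 hz2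
    have h3 := hM.res_add hσ hz2
    rw [map_add, ContinuousLinearMap.map_smul_of_tower] at h2 h3
    have h4 := hM.res_sub_res hσ h1 (ι u)
    rw [add_sub_cancel_left, one_smul] at h4
    rw [← h4, ← add_right_inj (ι (R σ)), ← hN σ hσ, hx, one_smul, map_add, ← hR2 σ hσ,
      eq_sub_of_add_eq h2, eq_sub_of_add_eq h3]
    module
  have hqn : ∀ σ : ℝ, 0 < σ → ‖q σ‖ ≤ C * ‖u‖ / (1 + σ) := fun σ hσ =>
    hqC σ hσ _ (hqι σ hσ)
  -- R enters only through the integrable function σ^(θ-1) R(σ); removing the power gives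
  -- measurability.
  have hRm : AEStronglyMeasurable R (volume.restrict (Ioi 0)) := by
    have h1 : ContinuousOn (fun σ : ℝ => σ ^ (1 - θ)) (Ioi 0) := fun x hx =>
      (Real.continuousAt_rpow_const _ _ (Or.inl (ne_of_gt hx))).continuousWithinAt
    refine ((h1.aestronglyMeasurable measurableSet_Ioi).smul hRint.1).congr
      ((ae_restrict_iff' measurableSet_Ioi).2 (Eventually.of_forall fun s (hs : 0 < s) => ?_))
    simp only [Pi.smul_apply', smul_smul]
    rw [← Real.rpow_add hs]
    ring_nf
    simp
  have hRm' : AEStronglyMeasurable (fun σ => R (σ + 1)) (volume.restrict (Ioi 0)) := by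
    have h1 : MeasurePreserving (fun σ : ℝ => σ + 1) (volume.restrict (Ioi 0))
        (volume.restrict (Ioi 1)) := by
      have := (measurePreserving_add_right (volume : Measure ℝ) 1).restrict_preimage
        (measurableSet_Ioi (a := (1 : ℝ)))
      simpa using this
    exact (hRm.mono_measure (Measure.restrict_mono (Ioi_subset_Ioi zero_le_one)
      le_rfl)).comp_measurePreserving h1
  have hqm : AEStronglyMeasurable q (volume.restrict (Ioi 0)) := by
    have h1 : ContinuousOn (fun σ : ℝ => (σ + 1)⁻¹) (Ioi 0) := fun x (hx : 0 < x) =>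
      ((continuousAt_id.add continuousAt_const).inv₀ (by simp; positivity)).continuousWithinAt
    exact (hRm'.add ((h1.aestronglyMeasurable measurableSet_Ioi).smul
      (aestronglyMeasurable_const.sub hRm'))).sub hRm
  have hrm : AEStronglyMeasurable (fun σ : ℝ => σ ^ (θ - 1)) (volume.restrict (Ioi 0)) :=
    ContinuousOn.aestronglyMeasurable (fun x hx =>
      (Real.continuousAt_rpow_const _ _ (Or.inl (ne_of_gt hx))).continuousWithinAt) measurableSet_Ioi
  have hqb : ∀ᵐ σ ∂(volume.restrict (Ioi (0 : ℝ))),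
      ‖σ ^ (θ - 1) • q σ‖ ≤ C * ‖u‖ * (σ ^ (θ - 1) / (1 + σ)) := by
    refine (ae_restrict_iff' measurableSet_Ioi).2 (Eventually.of_forall fun σ (hσ : 0 < σ) => ?_)
    rw [norm_smul, Real.norm_of_nonneg (by positivity)]
    calc _ ≤ σ ^ (θ - 1) * (C * ‖u‖ / (1 + σ)) := by gcongr; exact hqn σ hσ
      _ = _ := by ring
  have hqint : IntegrableOn (fun σ : ℝ => σ ^ (θ - 1) • q σ) (Ioi 0) :=
    (hI₁.const_mul (C * ‖u‖)).mono' (hrm.smul hqm) hqb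
  set I := ∫ s in Ioi (0 : ℝ), s ^ (θ - 1) • R s
  set Q := ∫ s in Ioi (0 : ℝ), s ^ (θ - 1) • q s
  have hQn : ‖Q‖ ≤ C * ‖u‖ * K₁ := by
    refine (norm_integral_le_of_norm_le (hI₁.const_mul (C * ‖u‖)) hqb).trans (le_of_eq ?_)
    rw [integral_const_mul]
  have hIn : ‖I‖ = c⁻¹ * ‖w‖ := by
    have hw' : w = c • I := hw
    rw [hw', norm_smul, Real.norm_of_nonneg hc0.le, inv_mul_cancel_left₀ hc0.ne']
  have hIQ : ∫ σ in Ioi (0 : ℝ), σ ^ (θ - 1) • hM.res (σ + 1) x = ι (I + Q) := by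
    have e1 : I + Q = ∫ s in Ioi (0 : ℝ), (s ^ (θ - 1) • R s + s ^ (θ - 1) • q s) :=
      (integral_add hRint hqint).symm
    rw [e1]
    refine Eq.trans ?_ ((ι.restrictScalars ℝ).integral_comp_comm (hRint.add hqint))
    refine setIntegral_congr_fun measurableSet_Ioi fun σ (hσ : 0 < σ) => ?_
    simp only [ContinuousLinearMap.coe_restrictScalars']
    rw [hN σ hσ, ← map_add, ← smul_add, ContinuousLinearMap.map_smul_of_tower]
  -- I is a multiple of w by the definition of the Balakrishnan operator, and Q is bounded in terms
  -- of u.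
  refine ⟨I + Q, (norm_add_le _ _).trans (by rw [hIn]; gcongr), fun h => ?_⟩
  have key := hM.integral_re_inner_res hθ0 hθ1 h x
  rwa [hux, hIQ] at key

end BalakrishnanIntegral

/-! ### The bound in `L^∞` by duality with `L^1` -/

section FractionalDomain

variable {α : Type*} [MeasurableSpace α] {m : Measure α} [IsFiniteMeasure m]

omit [IsFiniteMeasure m] in
lemma re_inner_le_of_eLpNorm_top_le {M : ℝ} (hM : 0 ≤ M) {h y : Lp ℂ 2 m} (hh : Integrable h m)
    (hy : eLpNorm y ⊤ m ≤ ENNReal.ofReal M) : |(inner ℂ h y).re| ≤ M * ∫ x, ‖h x‖ ∂m := by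
  refine (Complex.abs_re_le_norm _).trans ?_
  rw [L2.inner_def, ← integral_const_mul]
  refine norm_integral_le_of_norm_le (hh.norm.const_mul M) ?_
  rw [eLpNorm_exponent_top] at hy
  filter_upwards [ae_le_eLpNormEssSup (f := y) (μ := m)] with x hx
  refine (norm_inner_le_norm _ _).trans ?_
  rw [mul_comm]
  gcongr
  rw [← ofReal_norm] at hx
  exact (ENNReal.ofReal_le_ofReal_iff hM).1 (hx.trans hy)

/-- Test with the conjugate of c times the indicator of E = {Re (c u) > M}: the integral of Re (c u)
- M over E becomes nonpositive, so E is a null set. -/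
lemma eLpNorm_top_le_of_re_inner_le {M : ℝ} (hM : 0 ≤ M) {u : Lp ℂ 2 m}
    (h : ∀ h : Lp ℂ 2 m, (inner ℂ h u).re ≤ M * ∫ x, ‖h x‖ ∂m) :
    eLpNorm u ⊤ m ≤ 4 * ENNReal.ofReal M := by
  refine eLpNorm_le_of_re_parts le_top (Lp.aestronglyMeasurable u) fun c hc => ?_
  have hE : MeasurableSet {x | M < (c * u x).re} := measurableSet_lt measurable_const
    (Complex.measurable_re.comp ((Lp.stronglyMeasurable u).measurable.const_mul c))
  set E := {x | M < (c * u x).re} with hEdef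
  have hu : Integrable u m := Lp_integrable (by norm_num) u
  have hcu : Integrable (fun x => (c * u x).re) m := (hu.const_mul c).re
  have h1 := h (indicatorConstLp 2 hE (measure_ne_top m E) (starRingEnd ℂ c))
  have h2 : ∫ x, ‖(indicatorConstLp 2 hE (measure_ne_top m E) (starRingEnd ℂ c) : Lp ℂ 2 m) x‖ ∂m
      = ∫ x in E, (1 : ℝ) ∂m := by
    rw [← integral_indicator hE]
    refine integral_congr_ae ?_
    filter_upwards [indicatorConstLp_coeFn (p := 2) (hs := hE) (hμs := measure_ne_top m E)
      (c := starRingEnd ℂ c)] with x hx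
    rw [hx]
    by_cases hxE : x ∈ E <;> simp [hxE, hc]
  have h3 : (inner ℂ (indicatorConstLp 2 hE (measure_ne_top m E) (starRingEnd ℂ c)) u).re =
      ∫ x in E, (c * u x).re ∂m := by
    rw [L2.inner_indicatorConstLp_eq_inner_setIntegral]
    have : inner ℂ (starRingEnd ℂ c) (∫ x in E, u x ∂m) = ∫ x in E, c * u x ∂m := by
      rw [integral_const_mul]; simp [mul_comm]
    rw [this]
    exact (integral_re ((hu.const_mul c).integrableOn)).symm
  rw [h2, h3, ← integral_const_mul, mul_one] at h1
  have hint : IntegrableOn (fun x => (c * u x).re - M) E m :=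
    (hcu.sub (integrable_const M)).integrableOn
  have h4 : ∫ x in E, ((c * u x).re - M) ∂m ≤ 0 := by
    rw [integral_sub hcu.integrableOn (integrable_const M).integrableOn]; linarith
  have h5 : m E = 0 := by
    by_contra h0
    have : 0 < ∫ x in E, ((c * u x).re - M) ∂m := by
      rw [setIntegral_pos_iff_support_of_nonneg_ae
        ((ae_restrict_iff' hE).2 (Eventually.of_forall fun x (hx : M < _) => by
          simp only [Pi.zero_apply]; linarith)) hint]
      have hsupp : E ⊆ Function.support (fun x => (c * u x).re - M) :=
        fun x hx => (sub_pos.2 (show M < (c * u x).re from hx)).ne'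
      rw [inter_eq_self_of_subset_right hsupp]
      exact pos_iff_ne_zero.2 h0
    linarith
  rw [eLpNorm_exponent_top]
  refine eLpNormEssSup_le_of_ae_bound ?_
  have h6 : ∀ᵐ x ∂m, x ∉ E := measure_eq_zero_iff_ae_notMem.1 h5
  filter_upwards [h6] with x hx
  rw [Real.norm_of_nonneg (le_max_right _ _)]
  exact max_le (not_lt.1 hx) hM

variable {A : Submodule ℂ (Lp ℂ 2 m × Lp ℂ 2 m)}

/-- Functions in the domain of the Balakrishnan operator are bounded. -/
lemma balakrishnan_weak_bound (hM : MAccretive A) (hA : IsTruncationAccretive A)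
    {p r θ C : ℝ} (hp : 2 < p) (hr : 2 < r) (hθ0 : 0 < θ) (hθ1 : θ < 1)
    (hθ : r / ((r - 2) * p) < θ) (hC : 0 ≤ C) (hS : HasSobolev A r C)
    [Fact (1 ≤ ENNReal.ofReal p)] (hp2 : 2 ≤ ENNReal.ofReal p)
    {B : Set (Lp ℂ (ENNReal.ofReal p) m × Lp ℂ (ENNReal.ofReal p) m)}
    (hB : ∀ x y, (x, y) ∈ B → (LpToL2 m _ hp2 x, LpToL2 m _ hp2 y) ∈ A) :
    ∃ K : ℝ, 0 < K ∧ ∀ u w, (u, w) ∈ balakrishnan B θ → ∀ h : Lp ℂ 2 m,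
      (inner ℂ h (LpToL2 m _ hp2 u)).re ≤ K * (‖u‖ + ‖w‖) * ∫ x, ‖h x‖ ∂m := by
  obtain ⟨C', hC'0, hC'⟩ := hS.eLpNorm_top_resolvent_le hp hr hC (hθ.trans hθ1) hA
  set a := r / ((r - 2) * p) with ha
  set ι := LpToL2 m (ENNReal.ofReal p) hp2
  have hp0 : 0 < p := by linarith
  have hιn : ∀ f : Lp ℂ (ENNReal.ofReal p) m, eLpNorm (ι f) (ENNReal.ofReal p) m = ENNReal.ofReal ‖f‖ := fun f => by
    rw [eLpNorm_congr_ae (LpToL2_coe hp2 f), Lp.norm_def, ENNReal.ofReal_toReal (Lp.eLpNorm_ne_top f)]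
  have hresP : ∀ l : ℝ, 0 < l → ∀ g : Lp ℂ 2 m, ∀ G : ℝ, eLpNorm g (ENNReal.ofReal p) m ≤ ENNReal.ofReal G →
      eLpNorm (hM.res l g) (ENNReal.ofReal p) m ≤ ENNReal.ofReal (4 * l⁻¹ * G) := fun l hl g G hG => by
    refine (hA.eLpNorm_resolvent_le hl (hM.res_mem hl g) hp).trans ?_
    rw [mul_assoc, ENNReal.ofReal_mul (p := 4) (by norm_num), ENNReal.ofReal_mul (by positivity),
      ENNReal.ofReal_ofNat]
    gcongr
  set c := Real.sin (Real.pi * θ) / Real.pi with hc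
  have hc0 : 0 < c := by
    refine div_pos (Real.sin_pos_of_pos_of_lt_pi (by positivity) ?_) Real.pi_pos
    nlinarith [Real.pi_pos]
  set K₁ := ∫ σ in Ioi (0 : ℝ), σ ^ (θ - 1) / (1 + σ) with hK₁
  have hK₁0 : 0 < K₁ := integral_rpow_div_one_add_pos (by linarith) (by linarith)
  have hI₁ := integrableOn_rpow_div_one_add (a := θ - 1) (by linarith) (by linarith)
  -- This integral converges at 0 because θ < 1 and at infinity because a < θ. It is the only place
  -- where the strict inequality for θ is decisive.
  set K₂ := ∫ s in Ioi (0 : ℝ), s ^ (-θ) * (1 + s) ^ (a - 1) with hK₂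
  have hI₂ := integrableOn_rpow_mul_one_add_rpow (a := -θ) (b := a - 1) (by linarith)
    (by linarith) (by linarith)
  have hK₂0 : 0 ≤ K₂ := setIntegral_nonneg measurableSet_Ioi fun s (hs : 0 < s) => by positivity
  have hK₀ := fracConst_pos hθ0 hθ1
  set K₀ := fracConst θ
  -- The summand 1 makes the constant positive without a strict lower bound for K₂.
  refine ⟨K₀⁻¹ * C' * K₂ * (c⁻¹ + 16 * K₁) + 1, by positivity, ?_⟩
  intro u w huw h
  have hh0 : 0 ≤ ∫ x, ‖h x‖ ∂m := integral_nonneg fun _ => norm_nonneg _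
  rcases eq_or_ne u 0 with rfl | hu0
  · rw [map_zero, inner_zero_right, Complex.zero_re]; positivity
  have hu0' : 0 < ‖u‖ := norm_pos_iff.2 hu0
  -- The constant 16 is one factor 4 for each of the two resolvents.
  obtain ⟨W, hW, key⟩ := hM.exists_re_inner_eq_integral ι (fun z hz => hB z.1 z.2 hz) (C := 16)
    hθ0 hθ1 huw fun σ hσ y hy => by
      have h1 := hresP (σ + 1) (by linarith) (ι u) ‖u‖ (hιn u).le
      have h2 := hresP σ hσ _ _ h1
      have h3 : eLpNorm (ι y) (ENNReal.ofReal p) m ≤ ENNReal.ofReal (16 * ‖u‖ / (1 + σ)) := by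
        rw [hy, eLpNorm_congr_ae (Lp.coeFn_smul (σ : ℂ) _), eLpNorm_const_smul,
          ← ofReal_norm, Complex.norm_real, Real.norm_of_nonneg hσ.le]
        refine (mul_le_mul' le_rfl h2).trans (le_of_eq ?_)
        rw [← ENNReal.ofReal_mul hσ.le]
        congr 1
        field_simp
        ring
      rw [hιn] at h3
      exact (ENNReal.ofReal_le_ofReal_iff (by positivity)).1 h3
  set G := (c⁻¹ + 16 * K₁) * (‖u‖ + ‖w‖) with hG
  have hG0 : 0 < G := by positivity
  have hWG : ‖W‖ ≤ G := by
    refine hW.trans ?_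
    rw [hG]
    have h1 : 0 ≤ c⁻¹ * ‖u‖ := by positivity
    have h2 : 0 ≤ 16 * K₁ * ‖w‖ := by positivity
    linarith
  have hbound : ∀ᵐ s ∂(volume.restrict (Ioi (0 : ℝ))),
      ‖s ^ (-θ) * (inner ℂ h (hM.res (s + 1) (ι W))).re‖ ≤
      C' * G * (∫ x, ‖h x‖ ∂m) * (s ^ (-θ) * (1 + s) ^ (a - 1)) := by
    refine (ae_restrict_iff' measurableSet_Ioi).2 (Eventually.of_forall fun s (hs : 0 < s) => ?_)
    have h1 := hC' (s + 1) (by linarith) _ _ (hM.res_mem (by linarith : 0 < s + 1) (ι W)) G hG0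
      ((hιn _).le.trans (ENNReal.ofReal_le_ofReal hWG))
    have h2 := re_inner_le_of_eLpNorm_top_le (h := h) (by positivity)
      (Lp_integrable (by norm_num) h) h1
    rw [norm_mul, Real.norm_of_nonneg (by positivity), Real.norm_eq_abs]
    calc _ ≤ s ^ (-θ) * (C' * (s + 1) ^ (a - 1) * G * ∫ x, ‖h x‖ ∂m) := by gcongr
      _ = _ := by rw [add_comm s 1]; ring
  have h1 := norm_integral_le_of_norm_le (hI₂.const_mul _) hbound
  rw [integral_const_mul, key, Real.norm_eq_abs, abs_mul, abs_of_pos hK₀] at h1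
  have h2 : (inner ℂ h (ι u)).re ≤ K₀⁻¹ * (C' * G * (∫ x, ‖h x‖ ∂m) * K₂) := by
    refine (le_abs_self _).trans ?_
    rw [inv_mul_eq_div, le_div_iff₀ hK₀]
    exact h1
  refine h2.trans ?_
  have h3 : K₀⁻¹ * (C' * G * (∫ x, ‖h x‖ ∂m) * K₂) =
      (K₀⁻¹ * C' * K₂ * (c⁻¹ + 16 * K₁)) * (‖u‖ + ‖w‖) * ∫ x, ‖h x‖ ∂m := by rw [hG]; ring
  rw [h3]
  gcongr
  linarith

/-- The domain of the fractional power embeds into `L^∞`. -/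
theorem fracPow_bound (hM : MAccretive A) (hA : IsTruncationAccretive A)
    {p r θ C : ℝ} (hp : 2 < p) (hr : 2 < r) (hθ0 : 0 < θ) (hθ1 : θ < 1)
    (hθ : r / ((r - 2) * p) < θ) (hC : 0 ≤ C) (hS : HasSobolev A r C)
    [Fact (1 ≤ ENNReal.ofReal p)] (hp2 : 2 ≤ ENNReal.ofReal p)
    {B : Set (Lp ℂ (ENNReal.ofReal p) m × Lp ℂ (ENNReal.ofReal p) m)}
    (hB : ∀ x y, (x, y) ∈ B → (LpToL2 m _ hp2 x, LpToL2 m _ hp2 y) ∈ A) :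
    ∃ K : ℝ, 0 < K ∧ ∀ u w, (u, w) ∈ fracPow B θ →
      eLpNorm u ⊤ m ≤ ENNReal.ofReal (K * (‖u‖ + ‖w‖)) := by
  obtain ⟨K, hK0, hK⟩ := balakrishnan_weak_bound hM hA hp hr hθ0 hθ1 hθ hC hS hp2 hB
  refine ⟨4 * K, by positivity, fun u w huw => ?_⟩
  -- For fixed h both sides are continuous in the graph norm, so the weak form of the bound survives
  -- the closure in `fracPow`.
  have hcl : IsClosed {z : Lp ℂ (ENNReal.ofReal p) m × Lp ℂ (ENNReal.ofReal p) m |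
      ∀ h : Lp ℂ 2 m, (inner ℂ h (LpToL2 m _ hp2 z.1)).re ≤
        K * (‖z.1‖ + ‖z.2‖) * ∫ x, ‖h x‖ ∂m} := by
    rw [show {z : Lp ℂ (ENNReal.ofReal p) m × Lp ℂ (ENNReal.ofReal p) m |
      ∀ h : Lp ℂ 2 m, (inner ℂ h (LpToL2 m _ hp2 z.1)).re ≤
        K * (‖z.1‖ + ‖z.2‖) * ∫ x, ‖h x‖ ∂m} = ⋂ h : Lp ℂ 2 m,
        {z | (inner ℂ h (LpToL2 m _ hp2 z.1)).re ≤
        K * (‖z.1‖ + ‖z.2‖) * ∫ x, ‖h x‖ ∂m} by ext; simp]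
    refine isClosed_iInter fun h => isClosed_le ?_ (by fun_prop)
    exact Complex.continuous_re.comp
      (continuous_const.inner ((LpToL2 m _ hp2).continuous.comp continuous_fst))
  have := closure_minimal (s := balakrishnan B θ) (fun z hz => hK z.1 z.2 hz) hcl huw
  rw [← eLpNorm_congr_ae (LpToL2_coe hp2 u), mul_assoc, ENNReal.ofReal_mul (p := 4) (by norm_num),
    ENNReal.ofReal_ofNat]
  exact eLpNorm_top_le_of_re_inner_le (by positivity) this

end FractionalDomain

namespace DiffusionData

variable {n : ℕ} {D : DiffusionData n}

/-- The embedding `dom(A_p^θ) ⊂ 𝕃^∞` for an operator `A_2` with the properties of an elliptic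
operator in divergence form. -/
theorem fracPow_Ap_bound [IsFiniteMeasure D.total] {A : Submodule ℂ (D.LL 2 × D.LL 2)}
    (hA2 : D.A2 = A) (hM : MAccretive A) (hA : IsTruncationAccretive A)
    {p r θ C : ℝ} [Fact (1 ≤ ENNReal.ofReal p)] (hp : 2 < p) (hr : 2 < r)
    (hθ0 : 0 < θ) (hθ1 : θ < 1) (hθ : r / ((r - 2) * p) < θ) (hC : 0 ≤ C) (hS : HasSobolev A r C) :
    ∃ K : ℝ, 0 < K ∧ ∀ u w : D.LL (ENNReal.ofReal p),
      (u, w) ∈ fracPow (D.Ap (ENNReal.ofReal p)) θ →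
        eLpNorm u ∞ D.total ≤ ENNReal.ofReal (K * (‖u‖ + ‖w‖)) := by
  have hp2 : 2 ≤ ENNReal.ofReal p := by
    rw [← ENNReal.ofReal_ofNat]; exact ENNReal.ofReal_le_ofReal hp.le
  -- `T2` and `Tp` are choices; each has its defining property as soon as one semigroup with this
  -- property is exhibited.
  have hT2 : D.T2.negGenerator = A := by
    obtain ⟨T, hT⟩ := hM.exists_semigroup
    have : D.T2.negGenerator = D.A2 :=
      Classical.epsilon_spec (p := fun T : C0Semigroup (D.LL 2) => T.negGenerator = D.A2)
        ⟨T, hT.trans hA2.symm⟩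
    exact this.trans hA2
  have hex := fun t f => hA.excessLE_semigroup hM hT2 t f
  obtain ⟨S, hS'⟩ := exists_Lp_semigroup D.T2 hp hp2
    (fun t f => eLpNorm_le_of_excessLE hp (Lp_integrable (by norm_num) _)
      (Lp_integrable (by norm_num) _) (hex t f))
    (fun t f => eLpNorm_top_le_of_excessLE (Lp_integrable (by norm_num) _) (hex t f))
  have hcons : D.Consistent S := fun f g hfg t => by
    have := hS' t f
    rw [LpToL2_eq_of_ae hp2 hfg] at this
    rw [← this]
    exact (LpToL2_coe hp2 _).symm
  have hTp : D.Consistent (D.Tp (ENNReal.ofReal p)) :=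
    Classical.epsilon_spec
      (p := fun T : C0Semigroup (D.LL (ENNReal.ofReal p)) => D.Consistent T) ⟨S, hcons⟩
  have hTp' : ∀ t f, LpToL2 D.total _ hp2 ((D.Tp (ENNReal.ofReal p)).toFun t f) =
      D.T2.toFun t (LpToL2 D.total _ hp2 f) := fun t f =>
    LpToL2_eq_of_ae hp2 (hTp f _ (LpToL2_coe hp2 f).symm t)
  refine fracPow_bound hM hA hp hr hθ0 hθ1 hθ hC hS hp2 fun x y hxy => ?_
  have := negGenerator_LpToL2 hp2 hTp' hxy
  rwa [hT2] at this

end DiffusionData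

/-! ### Lipschitz hypersurfaces -/

namespace GraphCoord

variable {n : ℕ}

/-- The linear map `(y, t) ↦ (y, t)` from `ℝ^n × ℝ` to `ℝ^(n+1)`. -/
noncomputable def snocL (n : ℕ) : (RSpace n × ℝ) →L[ℝ] RSpace (n + 1) :=
  LinearMap.toContinuousLinearMap
    { toFun := fun v => WithLp.toLp 2 (Fin.snoc (α := fun _ => ℝ) (fun i => v.1 i) v.2)
      map_add' := fun v w => by
        ext i; refine Fin.lastCases ?_ (fun i => ?_) i <;> simp
      map_smul' := fun c v => by
        ext i; refine Fin.lastCases ?_ (fun i => ?_) i <;> simp }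

/-- The first `n` coordinates of a vector in `ℝ^(n+1)`. -/
noncomputable def initL (n : ℕ) : RSpace (n + 1) →L[ℝ] RSpace n :=
  LinearMap.toContinuousLinearMap
    { toFun := fun v => WithLp.toLp 2 fun i => v i.castSucc
      map_add' := fun v w => by ext i; simp
      map_smul' := fun c v => by ext i; simp }

lemma initL_snocL (v : RSpace n × ℝ) : initL n (snocL n v) = v.1 := by
  ext i
  simp [initL, snocL]

variable (c : GraphCoord n)

lemma g_eq (y : RSpace n) : c.g y = c.Q (snocL n (y, c.h y)) + c.base := rfl

/-- The inverse of graph coordinates. -/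
noncomputable def proj (x : RSpace (n + 1)) : RSpace n := initL n (c.Q.symm (x - c.base))

/-- The left inverse is affine and defined on the whole space. Injectivity of g, and of its
derivative wherever this exists, follows from it. -/
lemma proj_g (y : RSpace n) : c.proj (c.g y) = y := by
  simp [proj, g_eq, initL_snocL]

lemma continuous_proj : Continuous c.proj := by
  unfold proj; fun_prop

lemma differentiable_proj : Differentiable ℝ c.proj := by
  have h : Differentiable ℝ fun x => c.Q.symm.toContinuousLinearEquiv (x - c.base) := by fun_prop
  exact (initL n).differentiable.comp h

lemma injective_g : Function.Injective c.g := fun y z h => by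
  rw [← c.proj_g y, h, c.proj_g]

lemma lipschitzOn_g : ∃ K : ℝ≥0, LipschitzOnWith K c.g c.U := by
  obtain ⟨K, hK⟩ := c.lipschitz_h
  have h1 := (LipschitzWith.id.lipschitzOnWith (s := c.U)).prodMk hK
  have h2 := (snocL n).lipschitz.comp_lipschitzOnWith h1
  have h3 := c.Q.lipschitz.comp_lipschitzOnWith h2
  refine ⟨1 * (‖snocL n‖₊ * max 1 K), fun y hy z hz => ?_⟩
  rw [g_eq, g_eq, edist_add_right]
  exact h3 hy hz

lemma continuousOn_g : ContinuousOn c.g c.U := (c.lipschitzOn_g.choose_spec).continuousOn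

lemma measurableSet_image_g : MeasurableSet (c.g '' c.U) :=
  c.isOpen_U.measurableSet.image_of_continuousOn_injOn c.continuousOn_g c.injective_g.injOn

lemma ae_differentiableAt_g : ∀ᵐ y, y ∈ c.U → DifferentiableAt ℝ c.g y := by
  obtain ⟨K, hK⟩ := c.lipschitzOn_g
  filter_upwards [hK.ae_differentiableWithinAt_of_mem (μ := volume)] with y hy hyU
  exact (hy hyU).differentiableAt (c.isOpen_U.mem_nhds hyU)

end GraphCoord

lemma euclideanHausdorffMeasure_image_le {X Y : Type*} [EMetricSpace X] [EMetricSpace Y]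
    [MeasurableSpace X] [BorelSpace X] [MeasurableSpace Y] [BorelSpace Y] {K : ℝ≥0} {f : X → Y}
    {s : Set X} (h : LipschitzOnWith K f s) (d : ℕ) :
    Measure.euclideanHausdorffMeasure d (f '' s) ≤
      (K : ℝ≥0∞) ^ d * Measure.euclideanHausdorffMeasure d s := by
  rw [Measure.euclideanHausdorffMeasure_def, Measure.euclideanHausdorffMeasure_def,
    Measure.smul_apply, Measure.smul_apply, mul_smul_comm]
  have := h.hausdorffMeasure_image_le (d := d) (by positivity)
  rw [ENNReal.rpow_natCast] at this
  exact smul_le_smul_of_nonneg_left this zero_le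

/-- Rademacher's theorem in the parameter domain; the Lipschitz map g carries the exceptional null
set to a null set for the Hausdorff measure. -/
lemma GraphCoord.ae_differentiableAt_proj {n : ℕ} (c : GraphCoord n) :
    ∀ᵐ x ∂(Measure.euclideanHausdorffMeasure n).restrict (c.g '' c.U),
      DifferentiableAt ℝ c.g (c.proj x) := by
  rw [ae_restrict_iff' c.measurableSet_image_g]
  obtain ⟨K, hK⟩ := c.lipschitzOn_g
  set s := {y | y ∈ c.U ∧ ¬ DifferentiableAt ℝ c.g y} with hs
  have h0 : volume s = 0 := by
    have := c.ae_differentiableAt_g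
    rw [ae_iff] at this
    simpa [hs] using this
  have h1 : Measure.euclideanHausdorffMeasure n (c.g '' s) = 0 := by
    refine le_antisymm ((euclideanHausdorffMeasure_image_le
      (hK.mono fun y hy => hy.1) n).trans ?_) bot_le
    rw [EuclideanSpace.euclideanHausdorffMeasure_eq_volume, h0, mul_zero]
  rw [ae_iff]
  refine measure_mono_null ?_ h1
  rintro x hx
  simp only [mem_ofPred_eq, Classical.not_imp] at hx
  obtain ⟨⟨y, hy, rfl⟩, hd⟩ := hx
  rw [c.proj_g] at hd
  exact ⟨y, ⟨hy, hd⟩, rfl⟩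

namespace IsLipschitzHypersurface

variable {n : ℕ} {𝒮 : Set (RSpace (n + 1))}

/-- Lindelöf's property. Countability makes 𝒮 a Borel set and lets measurability be checked in one
chart at a time. -/
lemma exists_countable_cover (h : IsLipschitzHypersurface 𝒮) :
    ∃ t : Set (RSpace (n + 1)), t.Countable ∧ ∃ (c : RSpace (n + 1) → GraphCoord n)
      (V : RSpace (n + 1) → Set (RSpace (n + 1))), (∀ x ∈ t, IsOpen (V x) ∧
        BijOn (c x).g (c x).U (𝒮 ∩ V x)) ∧ 𝒮 = ⋃ x ∈ t, (c x).g '' (c x).U := by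
  classical
  rcases 𝒮.eq_empty_or_nonempty with rfl | ⟨x₀, hx₀⟩
  · obtain ⟨c⟩ : Nonempty (GraphCoord n) :=
      ⟨⟨∅, isOpen_empty, LinearIsometryEquiv.refl ℝ _, 0, 0, 0, fun x hx => hx.elim⟩⟩
    exact ⟨∅, countable_empty, fun _ => c, fun _ => ∅, by simp, by simp⟩
  have : Nonempty (GraphCoord n) := ⟨(h x₀ hx₀).choose⟩
  choose! c V hV using h
  obtain ⟨t, hts, htc, ht⟩ := TopologicalSpace.countable_cover_nhdsWithin (s := 𝒮) (f := V)
    fun x hx => mem_nhdsWithin_of_mem_nhds ((hV x hx).1.mem_nhds (hV x hx).2.1)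
  refine ⟨t, htc, c, V, fun x hx => ⟨(hV x (hts hx)).1, (hV x (hts hx)).2.2⟩, ?_⟩
  ext x
  simp only [mem_iUnion, exists_prop]
  constructor
  · intro hx
    obtain ⟨z, hz, hxz⟩ := mem_iUnion₂.1 (ht hx)
    exact ⟨z, hz, (hV z (hts hz)).2.2.image_eq.symm ▸ ⟨hx, hxz⟩⟩
  · rintro ⟨z, hz, hx⟩
    rw [(hV z (hts hz)).2.2.image_eq] at hx
    exact hx.1

lemma measurableSet (h : IsLipschitzHypersurface 𝒮) : MeasurableSet 𝒮 := by
  obtain ⟨t, htc, c, V, -, ht⟩ := h.exists_countable_cover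
  rw [ht]
  exact MeasurableSet.biUnion htc fun x _ => (c x).measurableSet_image_g

end IsLipschitzHypersurface

/-! ### The surface gradient as a projection of the gradient -/

open Matrix in
/-- The matrix `g' (g'ᵀ g')⁻¹ g'ᵀ` of the orthogonal projection to the tangent space. -/
noncomputable def GraphCoord.projMat {n : ℕ} (c : GraphCoord n) (y : RSpace n) :
    Matrix (Fin (n + 1)) (Fin (n + 1)) ℝ :=
  c.jac y * ((c.jac y)ᵀ * c.jac y)⁻¹ * (c.jac y)ᵀ

/-- Multiplication of a complex vector by a real matrix. -/
noncomputable def rmul {m : ℕ} (M : Matrix (Fin m) (Fin m) ℝ) (v : CSpace m) : CSpace m :=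
  WithLp.toLp 2 (Matrix.mulVec (M.map fun t : ℝ => (t : ℂ)) fun j => v j)

namespace GraphCoord

open Matrix

variable {n : ℕ} {c : GraphCoord n} {y : RSpace n}

lemma toLp_jac_mulVec (c : GraphCoord n) (y ξ : RSpace n) :
    (WithLp.toLp 2 (c.jac y *ᵥ fun j => ξ j) : RSpace (n + 1)) = fderiv ℝ c.g y ξ := by
  ext i
  conv_rhs => rw [← (EuclideanSpace.basisFun (Fin n) ℝ).sum_repr ξ]
  simp [Matrix.mulVec, dotProduct, jac, mul_comm]

/-- The chain rule gives ∇(u ∘ g) = g'ᵀ ∇u. So the surface gradient is a matrix independent of u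
applied to the full gradient. -/
lemma surfGradIn_eq (hd : DifferentiableAt ℝ c.g y) {u : RSpace (n + 1) → ℂ}
    (hu : DifferentiableAt ℝ u (c.g y)) :
    c.surfGradIn u y = rmul (c.projMat y) (cgrad u (c.g y)) := by
  have h : (fun j => cgrad (u ∘ c.g) y j) =
      ((c.jac y)ᵀ.map fun t : ℝ => (t : ℂ)) *ᵥ fun i => cgrad u (c.g y) i := by
    ext j
    have h1 : fderiv ℝ c.g y (EuclideanSpace.single j 1) =
        ∑ i, c.jac y i j • EuclideanSpace.single i (1 : ℝ) := by
      conv_lhs => rw [← (EuclideanSpace.basisFun (Fin (n + 1)) ℝ).sum_repr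
        (fderiv ℝ c.g y (EuclideanSpace.single j 1))]
      simp [jac]
    simp only [cgrad, Matrix.mulVec, dotProduct, Matrix.map_apply, Matrix.transpose_apply]
    rw [fderiv_comp _ hu hd, ContinuousLinearMap.comp_apply, h1, map_sum]
    simp
  simp only [surfGradIn, rmul, projMat]
  rw [h, Matrix.mulVec_mulVec, show (fun t : ℝ => (t : ℂ)) = Complex.ofRealHom from rfl, ← Matrix.map_mul]

lemma projMat_transpose : (c.projMat y)ᵀ = c.projMat y := by
  simp only [projMat, transpose_mul, transpose_transpose, transpose_nonsing_inv, Matrix.mul_assoc]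

/-- As `proj` ∘ g is the identity, g' is injective, and g'ᵀ g' has the same kernel as g'. -/
lemma isUnit_gram (hd : DifferentiableAt ℝ c.g y) :
    IsUnit ((c.jac y)ᵀ * c.jac y) := by
  rw [← Matrix.mulVec_injective_iff_isUnit, ← Matrix.coe_mulVecLin, ← LinearMap.ker_eq_bot,
    Matrix.ker_mulVecLin_transpose_mul_self, LinearMap.ker_eq_bot']
  intro v hv
  have h1 : fderiv ℝ c.g y (WithLp.toLp 2 v) = 0 := by
    rw [← toLp_jac_mulVec]
    have : c.jac y *ᵥ v = 0 := hv
    ext i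
    exact congrFun this i
  have h2 : fderiv ℝ (c.proj ∘ c.g) y = ContinuousLinearMap.id ℝ _ := by
    rw [show c.proj ∘ c.g = id from funext c.proj_g]; exact fderiv_id
  rw [fderiv_comp _ (c.differentiable_proj _) hd] at h2
  have h3 := congrArg (fun L => L (WithLp.toLp 2 v)) h2
  simp only [ContinuousLinearMap.comp_apply, h1, map_zero, ContinuousLinearMap.id_apply] at h3
  exact (congrArg WithLp.ofLp h3).symm

lemma projMat_mul_jac (hd : DifferentiableAt ℝ c.g y) :
    c.projMat y * c.jac y = c.jac y := by
  have := (Matrix.isUnit_iff_isUnit_det _).1 (isUnit_gram hd)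
  rw [projMat, Matrix.mul_assoc, Matrix.mul_assoc, Matrix.nonsing_inv_mul _ this, Matrix.mul_one]

lemma projMat_mul_self (hd : DifferentiableAt ℝ c.g y) :
    c.projMat y * c.projMat y = c.projMat y := by
  conv_lhs => enter [2]; rw [projMat]
  rw [← Matrix.mul_assoc, ← Matrix.mul_assoc, projMat_mul_jac hd]
  rfl

/-- The two charts differ by the change of parameters `c'.proj ∘ c.g`, which is differentiable.
Hence the range of the first Jacobian lies in that of the second, where the second projection acts
as the identity. -/
lemma projMat_mul_projMat {𝒮 : Set (RSpace (n + 1))} {x : RSpace (n + 1)} {c' : GraphCoord n}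
    {y' : RSpace n} (h : c.IsRegularAt 𝒮 x y) (h' : c'.IsRegularAt 𝒮 x y') :
    c'.projMat y' * c.projMat y = c.projMat y := by
  obtain ⟨⟨V, hV, hxV, hb⟩, hy, hyx, hd⟩ := h
  obtain ⟨⟨V', hV', hxV', hb'⟩, hy', hyx', hd'⟩ := h'
  have hyy : c'.proj x = y' := by rw [← hyx', c'.proj_g]
  have hev : c.g =ᶠ[𝓝 y] c'.g ∘ (c'.proj ∘ c.g) := by
    have h1 : ∀ᶠ z in 𝓝 y, c.g z ∈ V' :=
      hd.continuousAt.eventually (hV'.mem_nhds (by rw [hyx]; exact hxV'))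
    filter_upwards [h1, c.isOpen_U.mem_nhds hy] with z hz hzU
    have h2 : c.g z ∈ 𝒮 ∩ V' := ⟨(hb.mapsTo hzU).1, hz⟩
    obtain ⟨z', hz', hzz⟩ := hb'.surjOn h2
    simp only [Function.comp_apply]
    rw [← hzz, c'.proj_g]
  have hpd : DifferentiableAt ℝ (c'.proj ∘ c.g) y := (c'.differentiable_proj _).comp y hd
  have hval : (c'.proj ∘ c.g) y = y' := by rw [Function.comp_apply, hyx, hyy]
  have hJ : ∀ ξ, fderiv ℝ c.g y ξ = fderiv ℝ c'.g y' (fderiv ℝ (c'.proj ∘ c.g) y ξ) := fun ξ => by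
    rw [hev.fderiv_eq, fderiv_comp _ (by rw [hval]; exact hd') hpd, hval]
    rfl
  have hmat : c.jac y = c'.jac y' * Matrix.of fun i j =>
      fderiv ℝ (c'.proj ∘ c.g) y (EuclideanSpace.single j 1) i := by
    ext i j
    have := congrArg (fun v : RSpace (n + 1) => v i) (hJ (EuclideanSpace.single j 1))
    simp only [← toLp_jac_mulVec c'] at this
    exact this
  have h3 : c'.projMat y' * c.jac y = c.jac y := by
    rw [hmat, ← Matrix.mul_assoc, projMat_mul_jac hd']
  rw [projMat.eq_def c, ← Matrix.mul_assoc, ← Matrix.mul_assoc, h3]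

/-- With P and P' symmetric, P' P = P, and transposing P P' = P' gives P' P = P'. -/
lemma projMat_eq {𝒮 : Set (RSpace (n + 1))} {x : RSpace (n + 1)} {c' : GraphCoord n}
    {y' : RSpace n} (h : c.IsRegularAt 𝒮 x y) (h' : c'.IsRegularAt 𝒮 x y') :
    c.projMat y = c'.projMat y' := by
  have h1 := projMat_mul_projMat h h'
  have h2 := congrArg Matrix.transpose (projMat_mul_projMat h' h)
  rw [transpose_mul, projMat_transpose, projMat_transpose] at h2
  exact h1.symm.trans h2

/-- With the inverse Gram matrix expressed by adjugate and determinant, the entries are Borel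
functions of the Jacobian, which is itself measurable. The formula includes the default values at
points without a derivative. -/
lemma measurable_projMat (c : GraphCoord n) (i j : Fin (n + 1)) :
    Measurable fun y => c.projMat y i j := by
  have hJ : Measurable fun y => (fun i j => c.jac y i j : Fin (n + 1) → Fin n → ℝ) :=
    measurable_pi_lambda _ fun i => measurable_pi_lambda _ fun j =>
      ((EuclideanSpace.proj i : RSpace (n + 1) →L[ℝ] ℝ).continuous.measurable).comp
        (measurable_fderiv_apply_const ℝ c.g _)
  let F₁ : (Fin (n + 1) → Fin n → ℝ) → ℝ := fun J => ((of J)ᵀ * of J).det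
  let F₂ : (Fin (n + 1) → Fin n → ℝ) → ℝ := fun J =>
    (of J * ((of J)ᵀ * of J).adjugate * (of J)ᵀ) i j
  have h1 : Continuous F₁ := by
    have : Continuous fun J : Matrix (Fin (n + 1)) (Fin n) ℝ => (Jᵀ * J).det := by fun_prop
    exact this
  have h2 : Continuous F₂ := by
    have : Continuous fun J : Matrix (Fin (n + 1)) (Fin n) ℝ => J * (Jᵀ * J).adjugate * Jᵀ := by
      fun_prop
    exact (continuous_apply j).comp ((continuous_apply i).comp this)
  have h3 : (fun y => c.projMat y i j) = fun y => ((c.jac y)ᵀ * c.jac y).det⁻¹ *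
      (c.jac y * ((c.jac y)ᵀ * c.jac y).adjugate * (c.jac y)ᵀ) i j := by
    ext y
    rw [projMat, Matrix.inv_def, Ring.inverse_eq_inv', Matrix.mul_smul, Matrix.smul_mul]
    rfl
  rw [h3]
  exact ((h1.measurable.comp hJ).inv.mul (h2.measurable.comp hJ) :)

end GraphCoord

open Classical in
/-- The orthogonal projection to the tangent space at the regular points of `𝒮`. -/
noncomputable def surfProj {n : ℕ} (𝒮 : Set (RSpace (n + 1))) (x : RSpace (n + 1)) :
    Matrix (Fin (n + 1)) (Fin (n + 1)) ℝ :=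
  if H : ∃ p : GraphCoord n × RSpace n, p.1.IsRegularAt 𝒮 x p.2 then
    H.choose.1.projMat H.choose.2 else 0

section SurfProj

open Matrix

variable {n : ℕ} {𝒮 : Set (RSpace (n + 1))}

lemma surfGrad_eq {u : RSpace (n + 1) → ℂ} {x : RSpace (n + 1)} (hu : DifferentiableAt ℝ u x) :
    surfGrad 𝒮 u x = rmul (surfProj 𝒮 x) (cgrad u x) := by
  unfold surfGrad surfProj
  split_ifs with H
  · obtain ⟨-, -, h1, h2⟩ := H.choose_spec
    rw [GraphCoord.surfGradIn_eq h2 (by rwa [h1]), h1]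
  · ext i; simp [rmul]

lemma surfProj_transpose (x : RSpace (n + 1)) : (surfProj 𝒮 x)ᵀ = surfProj 𝒮 x := by
  unfold surfProj
  split_ifs with H
  · exact GraphCoord.projMat_transpose
  · simp

lemma surfProj_mul_self (x : RSpace (n + 1)) : surfProj 𝒮 x * surfProj 𝒮 x = surfProj 𝒮 x := by
  unfold surfProj
  split_ifs with H
  · exact GraphCoord.projMat_mul_self H.choose_spec.2.2.2
  · simp

/-- The alternative ξ = 0 covers the points that are not regular, where the projection is 0 and the
tangent set is empty. -/
lemma mem_tangentSet_of_surfProj {x ξ : RSpace (n + 1)}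
    (h : surfProj 𝒮 x *ᵥ (fun j => ξ j) = fun j => ξ j) : ξ ∈ tangentSet 𝒮 x ∨ ξ = 0 := by
  unfold surfProj at h
  split_ifs at h with H
  · left
    refine ⟨_, _, H.choose_spec, WithLp.toLp 2 ((((H.choose.1.jac H.choose.2)ᵀ *
      H.choose.1.jac H.choose.2)⁻¹ * (H.choose.1.jac H.choose.2)ᵀ) *ᵥ fun j => ξ j), ?_⟩
    rw [← GraphCoord.toLp_jac_mulVec]
    ext i
    simp only [Matrix.mulVec_mulVec, ← Matrix.mul_assoc]
    exact (congrFun h i).symm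
  · right
    ext i
    have := congrFun h i
    simpa using this.symm

lemma surfProj_eq {c : GraphCoord n} {x : RSpace (n + 1)} {y : RSpace n}
    (h : c.IsRegularAt 𝒮 x y) : surfProj 𝒮 x = c.projMat y := by
  have H : ∃ p : GraphCoord n × RSpace n, p.1.IsRegularAt 𝒮 x p.2 := ⟨(c, y), h⟩
  unfold surfProj
  rw [dif_pos H]
  exact GraphCoord.projMat_eq H.choose_spec h

/-- By independence of the chart, the chosen projection agrees almost everywhere in each chart with
the measurable function `projMat` ∘ `proj`. -/
lemma IsLipschitzHypersurface.aemeasurable_surfProj (h : IsLipschitzHypersurface 𝒮)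
    (i j : Fin (n + 1)) :
    AEMeasurable (fun x => surfProj 𝒮 x i j)
      ((Measure.euclideanHausdorffMeasure n).restrict 𝒮) := by
  obtain ⟨t, htc, c, V, hV, ht⟩ := h.exists_countable_cover
  have : Countable t := htc.to_subtype
  rw [show (Measure.euclideanHausdorffMeasure n).restrict 𝒮 =
    (Measure.euclideanHausdorffMeasure n).restrict (⋃ x : t, (c x).g '' (c x).U) by
      rw [← biUnion_eq_iUnion t fun x _ => (c x).g '' (c x).U, ← ht], aemeasurable_iUnion_iff]
  intro z
  refine ⟨fun x => (c z).projMat ((c z).proj x) i j,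
    ((c z).measurable_projMat i j).comp (c z).continuous_proj.measurable, ?_⟩
  filter_upwards [(c z).ae_differentiableAt_proj, ae_restrict_mem (c z).measurableSet_image_g]
    with x hd hx
  obtain ⟨y, hy, rfl⟩ := hx
  rw [(c z).proj_g] at hd ⊢
  have hy' := (hV z z.2).2.mapsTo hy
  rw [surfProj_eq ⟨⟨V z, (hV z z.2).1, hy'.2, (hV z z.2).2⟩, hy, rfl, hd⟩]

end SurfProj

/-! ### Hausdorff measure of Lipschitz submanifolds -/

section FiniteMeasure

variable {d : ℕ}

/-- A compact subset of an `m`-dimensional Lipschitz submanifold has finite measure. -/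
lemma IsLipschitzSubmanifold.measure_lt_top {m : ℕ} {M K : Set (RSpace d)}
    (hM : IsLipschitzSubmanifold m M) (hmd : m ≤ d) (hK : IsCompact K) (hKM : K ⊆ M) :
    Measure.euclideanHausdorffMeasure m K < ⊤ := by
  -- Compactness leaves a local statement: M ∩ V is covered by the image of the unit cube of ℝ^m
  -- under the inverse of φ, which is Lipschitz.
  have key : ∀ x ∈ K, ∃ t ∈ 𝓝[K] x, Measure.euclideanHausdorffMeasure m t < ⊤ := fun x hx => by
    obtain ⟨V, hV, hxV, φ, L, hL, hφ, him⟩ := hM x (hKM hx)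
    refine ⟨M ∩ V, ?_, ?_⟩
    · filter_upwards [self_mem_nhdsWithin, mem_nhdsWithin_of_mem_nhds (hV.mem_nhds hxV)]
        with z hz hzV using ⟨hKM hz, hzV⟩
    set Q : Set (RSpace m) := {y | ∀ i, 0 < y i ∧ y i < 1} with hQ
    let e : RSpace m → RSpace d := fun y => WithLp.toLp 2 fun i =>
      if h : (i : ℕ) < m then y ⟨i, h⟩ else 0
    have he : ∀ y z, dist (e y) (e z) ≤ dist y z := fun y z => by
      rw [EuclideanSpace.dist_eq, EuclideanSpace.dist_eq]
      refine Real.sqrt_le_sqrt ?_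
      rw [← Finset.sum_subset (Finset.subset_univ (Finset.univ.map (Fin.castLEEmb hmd)))]
      · rw [Finset.sum_map]
        refine Finset.sum_le_sum fun i _ => ?_
        simp [e]
      · intro i _ hi
        have : ¬ (i : ℕ) < m := fun h => hi (by
          simp only [Finset.mem_map, Finset.mem_univ, true_and]
          exact ⟨⟨i, h⟩, by ext; simp⟩)
        simp [e, this]
    have heQ : φ '' (M ∩ V) = e '' Q := by
      rw [him]
      ext y
      constructor
      · rintro ⟨h1, h2⟩
        refine ⟨WithLp.toLp 2 fun i => y (Fin.castLE hmd i), fun i => h1 _ (by simp), ?_⟩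
        ext i
        by_cases h : (i : ℕ) < m
        · simp [e, h]
        · simp [e, h, h2 i (not_lt.1 h)]
      · rintro ⟨z, hz, rfl⟩
        exact ⟨fun i hi => by simpa [e, hi] using hz ⟨i, hi⟩,
          fun i hi => by simp [e, not_lt.2 hi]⟩
    set f : RSpace m → RSpace d := fun y => Function.invFunOn φ (M ∩ V) (e y) with hf
    have hfm : ∀ y ∈ Q, f y ∈ M ∩ V ∧ φ (f y) = e y := fun y hy =>
      ⟨Function.invFunOn_mem (heQ.symm.subset (mem_image_of_mem e hy)),
        Function.invFunOn_eq (heQ.symm.subset (mem_image_of_mem e hy))⟩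
    have hlip : LipschitzOnWith L.toNNReal f Q := by
      refine LipschitzOnWith.of_dist_le_mul fun y hy z hz => ?_
      have h1 := (hφ _ (hfm y hy).1.2 _ (hfm z hz).1.2).1
      rw [(hfm y hy).2, (hfm z hz).2, inv_mul_le_iff₀ hL] at h1
      rw [Real.coe_toNNReal _ hL.le]
      exact h1.trans (mul_le_mul_of_nonneg_left (he y z) hL.le)
    have hsub : M ∩ V ⊆ f '' Q := fun z hz => by
      obtain ⟨y, hy, hyz⟩ := heQ.subset (mem_image_of_mem φ hz)
      refine ⟨y, hy, ?_⟩
      have h1 := (hφ _ (hfm y hy).1.2 _ hz.2).1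
      rw [(hfm y hy).2, hyz, dist_self, inv_mul_le_iff₀ hL, mul_zero] at h1
      exact dist_le_zero.1 h1
    have hQfin : volume Q < ⊤ := by
      refine Bornology.IsBounded.measure_lt_top ?_
      refine (Metric.isBounded_iff_subset_closedBall 0).2 ⟨√m, fun y hy => ?_⟩
      rw [mem_closedBall_zero_iff, EuclideanSpace.norm_eq]
      refine Real.sqrt_le_sqrt ?_
      calc ∑ i, ‖y i‖ ^ 2 ≤ ∑ _i : Fin m, (1 : ℝ) := Finset.sum_le_sum fun i _ => by
            have := hy i
            rw [Real.norm_of_nonneg this.1.le]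
            nlinarith
        _ = m := by simp
    refine (measure_mono hsub).trans_lt ((euclideanHausdorffMeasure_image_le hlip m).trans_lt ?_)
    rw [EuclideanSpace.euclideanHausdorffMeasure_eq_volume]
    exact ENNReal.mul_lt_top (by simp) hQfin
  exact hK.measure_lt_top_of_nhdsWithin key

end FiniteMeasure

namespace DiffusionData.Admissible

variable {n : ℕ} {D : DiffusionData n} (hD : D.Admissible)
include hD

lemma measure_Γd_lt_top : Measure.euclideanHausdorffMeasure n D.Γd < ⊤ := by
  obtain ⟨M, hM, hsub⟩ := hD.closure_Γd
  have hb : Bornology.IsBounded D.Γd := hD.isBounded_Ω.closure.subset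
    ((subset_union_right.trans hD.frontier_Ω.symm.subset).trans frontier_subset_closure)
  exact (measure_mono subset_closure).trans_lt
    (hM.measure_lt_top n.le_succ hb.isCompact_closure hsub)

lemma measure_Sig_lt_top : Measure.euclideanHausdorffMeasure n D.Sig < ⊤ := by
  obtain ⟨M, hM, hsub⟩ := hD.closure_Sig
  exact (measure_mono subset_closure).trans_lt
    (hM.measure_lt_top n.le_succ (hD.isBounded_Ω.subset hD.Sig_subset).isCompact_closure hsub)

/-- A set of finite (d-1)-dimensional measure is null in dimension d. Hence removing Σ from Ω does
not change the bulk measure. -/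
lemma volume_Sig : volume D.Sig = 0 := by
  rw [← EuclideanSpace.euclideanHausdorffMeasure_eq_volume]
  exact (Measure.euclideanHausdorffMeasure_zero_or_top n.lt_succ_self D.Sig).resolve_right
    hD.measure_Sig_lt_top.ne

lemma measurableSet_Γd : MeasurableSet D.Γd := hD.hypersurface_Γd.measurableSet

lemma measurableSet_Sig : MeasurableSet D.Sig := hD.hypersurface_Sig.measurableSet

lemma bulk_eq : D.bulk = volume.restrict (D.Ω \ D.Sig) :=
  Measure.restrict_congr_set (sdiff_null_ae_eq_self hD.volume_Sig).symm

lemma bulk_le_total : D.bulk ≤ D.total := by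
  rw [hD.bulk_eq, total, add_assoc]
  exact Measure.le_add_right le_rfl

lemma isFiniteMeasure_total : IsFiniteMeasure D.total := by
  have h1 : IsFiniteMeasure (volume.restrict (D.Ω \ D.Sig)) :=
    ⟨by rw [Measure.restrict_apply_univ]; exact (hD.isBounded_Ω.subset sdiff_subset).measure_lt_top⟩
  have h2 : IsFiniteMeasure D.surfd :=
    ⟨by rw [surfd, Measure.restrict_apply_univ]; exact hD.measure_Γd_lt_top⟩
  have h3 : IsFiniteMeasure D.surfs :=
    ⟨by rw [surfs, Measure.restrict_apply_univ]; exact hD.measure_Sig_lt_top⟩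
  unfold total
  infer_instance

omit hD in
lemma surfd_le_total : D.surfd ≤ D.total := by
  rw [total]
  exact Measure.le_add_right (Measure.le_add_left le_rfl)

omit hD in
lemma surfs_le_total : D.surfs ≤ D.total := by
  rw [total]
  exact Measure.le_add_left le_rfl

/-- The open set Ω does not meet its boundary, and Γd is disjoint from ΓD. This is why functions
vanishing near ΓD can be dense in 𝕃². -/
lemma total_ΓD : ∀ᵐ x ∂D.total, x ∉ D.ΓD := by
  have hΩ : Disjoint D.Ω D.ΓD := by
    refine Set.disjoint_of_subset_right ?_ (disjoint_frontier_iff_isOpen.2 hD.isOpen_Ω).symm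
    rw [hD.frontier_Ω, union_assoc]
    exact subset_union_left
  rw [total, ae_add_measure_iff, ae_add_measure_iff]
  refine ⟨⟨?_, ?_⟩, ?_⟩
  · filter_upwards [ae_restrict_mem (hD.isOpen_Ω.measurableSet.diff hD.measurableSet_Sig)] with x hx
    exact Set.disjoint_left.1 hΩ hx.1
  · filter_upwards [ae_restrict_mem hD.measurableSet_Γd] with x hx
    exact Set.disjoint_right.1 hD.disjoint_Dd hx
  · filter_upwards [ae_restrict_mem hD.measurableSet_Sig] with x hx
    exact Set.disjoint_left.1 hΩ (hD.Sig_subset hx)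

end DiffusionData.Admissible

/-! ### Real matrices acting on complex vectors -/

section ComplexVectors

open Matrix

variable {m : ℕ}

/-- The real part of a complex vector. -/
noncomputable def reV (v : CSpace m) : RSpace m := WithLp.toLp 2 fun i => (v i).re

/-- The imaginary part of a complex vector. -/
noncomputable def imV (v : CSpace m) : RSpace m := WithLp.toLp 2 fun i => (v i).im

/-- The real part of a complex vector, as a complex vector. -/
noncomputable def reC (m : ℕ) : CSpace m →L[ℝ] CSpace m :=
  LinearMap.mkContinuous
    { toFun := fun v => WithLp.toLp 2 fun i => ((v i).re : ℂ)
      map_add' := fun v w => by ext i; simp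
      map_smul' := fun c v => by ext i; simp } 1 fun v => by
        rw [one_mul, EuclideanSpace.norm_eq, EuclideanSpace.norm_eq]
        refine Real.sqrt_le_sqrt (Finset.sum_le_sum fun i _ => ?_)
        simp only [LinearMap.coe_mk, AddHom.coe_mk, Complex.norm_real]
        gcongr
        exact Complex.abs_re_le_norm _

lemma reC_apply (v : CSpace m) (i : Fin m) : reC m v i = ((v i).re : ℂ) := rfl

lemma norm_reC (v : CSpace m) : ‖reC m v‖ = ‖reV v‖ := by
  simp [EuclideanSpace.norm_eq, reC_apply, reV]

lemma norm_sq_eq_reV_add_imV (v : CSpace m) : ‖v‖ ^ 2 = ‖reV v‖ ^ 2 + ‖imV v‖ ^ 2 := by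
  rw [EuclideanSpace.norm_sq_eq, EuclideanSpace.norm_sq_eq, EuclideanSpace.norm_sq_eq,
    ← Finset.sum_add_distrib]
  refine Finset.sum_congr rfl fun i _ => ?_
  rw [← Complex.normSq_eq_norm_sq, Complex.normSq_apply]
  simp only [reV, imV, Real.norm_eq_abs, sq_abs]
  ring

variable (M N : Matrix (Fin m) (Fin m) ℝ) (v : CSpace m)

lemma rmul_apply (i : Fin m) : rmul M v i = ∑ j, (M i j : ℂ) * v j := by
  simp [rmul, Matrix.mulVec, dotProduct]

lemma reV_rmul : reV (rmul M v) = WithLp.toLp 2 (M *ᵥ fun j => reV v j) := by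
  ext i; simp [reV, rmul_apply, Matrix.mulVec, dotProduct]

lemma imV_rmul : imV (rmul M v) = WithLp.toLp 2 (M *ᵥ fun j => imV v j) := by
  ext i; simp [imV, rmul_apply, Matrix.mulVec, dotProduct]

lemma reC_rmul : reC m (rmul M v) = rmul M (reC m v) := by
  ext i; simp [reC_apply, rmul_apply]

lemma rmul_rmul : rmul M (rmul N v) = rmul (M * N) v := by
  ext i
  simp only [rmul]
  rw [Matrix.mulVec_mulVec, show (fun t : ℝ => (t : ℂ)) = Complex.ofRealHom from rfl,
    ← Matrix.map_mul]

lemma rmul_smul_left (c : ℝ) : rmul (c • M) v = (c : ℂ) • rmul M v := by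
  ext i; simp [rmul_apply, Finset.mul_sum, mul_assoc]

lemma rmul_add (v w : CSpace m) : rmul M (v + w) = rmul M v + rmul M w := by
  ext i; simp [rmul_apply, mul_add, Finset.sum_add_distrib]

lemma rmul_smul (c : ℂ) : rmul M (c • v) = c • rmul M v := by
  ext i; simp only [rmul_apply, PiLp.smul_apply, smul_eq_mul, Finset.mul_sum]
  exact Finset.sum_congr rfl fun j _ => by ring

lemma inner_rmul (w : CSpace m) : inner ℂ w (rmul M v) =
    ∑ i, ∑ j, (M i j : ℂ) * v j * (starRingEnd ℂ) (w i) := by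
  simp only [PiLp.inner_apply, rmul_apply, RCLike.inner_apply, Finset.sum_mul]

variable {M v}

lemma norm_rmul_le {c : ℝ} (h : ∀ ξ : RSpace m, ‖(WithLp.toLp 2 (M *ᵥ fun j => ξ j) : RSpace m)‖ ≤
    c * ‖ξ‖) : ‖rmul M v‖ ≤ c * ‖v‖ := by
  by_cases hv : v = 0
  · subst hv
    rw [norm_zero, mul_zero]
    refine le_of_eq (norm_eq_zero.2 ?_)
    ext i; simp [rmul_apply]
  -- A negative c would force the space to be trivial.
  have hc : 0 ≤ c := by
    by_contra hc
    have hz : ∀ ξ : RSpace m, ξ = 0 := fun ξ => by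
      by_contra hξ
      have := (norm_nonneg _).trans (h ξ)
      nlinarith [norm_pos_iff.2 hξ]
    apply hv
    rw [← norm_eq_zero, ← sq_eq_zero_iff, norm_sq_eq_reV_add_imV, hz (reV v), hz (imV v)]
    simp
  refine le_of_sq_le_sq ?_ (by positivity)
  rw [mul_pow, norm_sq_eq_reV_add_imV, norm_sq_eq_reV_add_imV v, reV_rmul, imV_rmul, mul_add,
    ← mul_pow, ← mul_pow]
  gcongr
  · exact h _
  · exact h _

lemma mulVec_reV_of_rmul_eq (h : rmul M v = v) : (M *ᵥ fun j => reV v j) = fun j => reV v j := by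
  have := congrArg reV h
  rw [reV_rmul] at this
  exact congrArg WithLp.ofLp this

lemma mulVec_imV_of_rmul_eq (h : rmul M v = v) : (M *ᵥ fun j => imV v j) = fun j => imV v j := by
  have := congrArg imV h
  rw [imV_rmul] at this
  exact congrArg WithLp.ofLp this

variable (M v)

/-- As M is real, pairing with Re v sees only the real part of M v. Testing with truncations of real
parts is therefore coercive without any symmetry of the coefficients. -/
lemma re_inner_reC_rmul : (inner ℂ (reC m v) (rmul M v)).re =
    ∑ i, (M *ᵥ fun j => reV v j) i * reV v i := by
  simp only [PiLp.inner_apply, rmul_apply, RCLike.inner_apply, reC_apply, Matrix.mulVec, dotProduct,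
    reV, Complex.re_sum, Complex.conj_ofReal, Complex.re_mul_ofReal]
  simp

lemma re_inner_rmul_self : (inner ℂ v (rmul M v)).re =
    ∑ i, (M *ᵥ fun j => reV v j) i * reV v i + ∑ i, (M *ᵥ fun j => imV v j) i * imV v i := by
  rw [← Finset.sum_add_distrib]
  simp only [PiLp.inner_apply, rmul_apply, RCLike.inner_apply, Matrix.mulVec, dotProduct,
    reV, imV, Complex.re_sum]
  refine Finset.sum_congr rfl fun i _ => ?_
  simp [Complex.mul_re]

variable {M}

lemma norm_mulVec_le_of_idempotent (h1 : Mᵀ = M) (h2 : M * M = M) (ξ : RSpace m) :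
    ‖(WithLp.toLp 2 (M *ᵥ fun j => ξ j) : RSpace m)‖ ≤ 1 * ‖ξ‖ := by
  set η : RSpace m := WithLp.toLp 2 (M *ᵥ fun j => ξ j) with hη
  have h3 : ‖η‖ ^ 2 = inner ℝ ξ η := by
    rw [← real_inner_self_eq_norm_sq]
    simp only [EuclideanSpace.inner_eq_star_dotProduct, star_trivial, hη]
    rw [dotProduct_comm, Matrix.dotProduct_mulVec, Matrix.vecMul_mulVec, ← dotProduct_comm]
    rw [h1, h2, dotProduct_comm, ← Matrix.mulVec_transpose, h1]
  have h4 := real_inner_le_norm ξ η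
  rw [one_mul]
  by_contra h5
  push Not at h5
  nlinarith [norm_nonneg ξ]

end ComplexVectors

/-! ### Bounded operators that represent the parts of the form -/

section MulOperator

open Matrix

variable {α : Type*} [MeasurableSpace α] {ν : Measure α} {m : ℕ}

lemma aestronglyMeasurable_rmul {B : α → Matrix (Fin m) (Fin m) ℝ} {f : α → CSpace m}
    (hB : ∀ i j, AEMeasurable (fun x => B x i j) ν) (hf : AEStronglyMeasurable f ν) :
    AEStronglyMeasurable (fun x => rmul (B x) (f x)) ν := by
  have h : ∀ i, AEMeasurable (fun x => rmul (B x) (f x) i) ν := fun i => by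
    simp only [rmul_apply]
    refine Finset.aemeasurable_fun_sum _ fun j _ => ?_
    exact (Complex.measurable_ofReal.comp_aemeasurable (hB i j)).mul
      ((EuclideanSpace.proj j : CSpace m →L[ℂ] ℂ).continuous.comp_aestronglyMeasurable hf).aemeasurable
  have h2 : AEMeasurable (fun x => fun i => rmul (B x) (f x) i) ν := aemeasurable_pi_lambda _ h
  exact ((MeasurableEquiv.toLp 2 (Fin m → ℂ)).measurable.comp_aemeasurable h2).aestronglyMeasurable

lemma memLp_rmul {B : α → Matrix (Fin m) (Fin m) ℝ} {C : ℝ}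
    (hB : ∀ i j, AEMeasurable (fun x => B x i j) ν)
    (hC : ∀ᵐ x ∂ν, ∀ v : CSpace m, ‖rmul (B x) v‖ ≤ C * ‖v‖) {f : α → CSpace m} (hf : MemLp f 2 ν) :
    MemLp (fun x => rmul (B x) (f x)) 2 ν :=
  MemLp.of_le_mul hf (aestronglyMeasurable_rmul hB hf.1) (hC.mono fun x hx => hx (f x))

/-- Multiplication by a bounded matrix valued function. -/
lemma exists_mulOperator {B : α → Matrix (Fin m) (Fin m) ℝ} {C : ℝ}
    (hB : ∀ i j, AEMeasurable (fun x => B x i j) ν)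
    (hC : ∀ᵐ x ∂ν, ∀ v : CSpace m, ‖rmul (B x) v‖ ≤ C * ‖v‖) :
    ∃ T : Lp (CSpace m) 2 ν →L[ℂ] Lp (CSpace m) 2 ν, ∀ F, T F =ᵐ[ν] fun x => rmul (B x) (F x) := by
  have hm := fun F : Lp (CSpace m) 2 ν => memLp_rmul hB hC (Lp.memLp F)
  refine ⟨LinearMap.mkContinuous
    { toFun := fun F => (hm F).toLp _
      map_add' := fun F G => by
        ext1
        filter_upwards [(hm (F + G)).coeFn_toLp, (hm F).coeFn_toLp, (hm G).coeFn_toLp,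
          Lp.coeFn_add F G, Lp.coeFn_add ((hm F).toLp _) ((hm G).toLp _)] with x h1 h2 h3 h4 h5
        rw [h1, h5, Pi.add_apply, h2, h3, h4, Pi.add_apply, rmul_add]
      map_smul' := fun c F => by
        ext1
        filter_upwards [(hm (c • F)).coeFn_toLp, (hm F).coeFn_toLp,
          Lp.coeFn_smul c F, Lp.coeFn_smul c ((hm F).toLp _)] with x h1 h2 h4 h5
        rw [h1, RingHom.id_apply, h5, Pi.smul_apply, h2, h4, Pi.smul_apply, rmul_smul] }
    C fun F => ?_, fun F => (hm F).coeFn_toLp⟩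
  refine Lp.norm_le_mul_norm_of_ae_le_mul ?_
  filter_upwards [(hm F).coeFn_toLp, hC] with x h1 h2
  exact (congrArg norm h1).trans_le (h2 _)

end MulOperator

namespace DiffusionData

open Matrix

variable {n : ℕ}

/-- The properties of a part of the form (in the bulk or on a hypersurface), where the gradient is
projected by `P`. -/
structure FormPart (ν : Measure (RSpace (n + 1))) (w : RSpace (n + 1) → ℝ)
    (μ P : RSpace (n + 1) → Matrix (Fin (n + 1)) (Fin (n + 1)) ℝ) : Prop where
  finite : IsFiniteMeasure ν
  aemeasurable_w : AEMeasurable w ν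
  nonneg_w : ∀ᵐ x ∂ν, 0 ≤ w x
  bounded_w : ∃ C : ℝ, ∀ᵐ x ∂ν, w x ≤ C
  aemeasurable_μ : ∀ i j, AEMeasurable (fun x => μ x i j) ν
  aemeasurable_P : ∀ i j, AEMeasurable (fun x => P x i j) ν
  transpose_P : ∀ x, (P x)ᵀ = P x
  mul_self_P : ∀ x, P x * P x = P x
  upper : ∃ c₂ : ℝ, 0 < c₂ ∧ ∀ᵐ x ∂ν, ∀ ξ : RSpace (n + 1),
    ‖(WithLp.toLp 2 (μ x *ᵥ fun j => ξ j) : RSpace (n + 1))‖ ≤ c₂ * w x * ‖ξ‖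
  lower : ∃ c₁ : ℝ, 0 < c₁ ∧ ∀ᵐ x ∂ν, ∀ ξ : RSpace (n + 1),
    (P x *ᵥ fun j => ξ j) = (fun j => ξ j) →
    c₁ * w x * ‖ξ‖ ^ 2 ≤ ∑ i, (μ x *ᵥ fun j => ξ j) i * ξ i

lemma weighted_absolutelyContinuous (ν : Measure (RSpace (n + 1))) (w : RSpace (n + 1) → ℝ) :
    weighted ν w ≪ ν := withDensity_absolutelyContinuous _ _

namespace FormPart

variable {ν : Measure (RSpace (n + 1))} {w : RSpace (n + 1) → ℝ}
  {μ P : RSpace (n + 1) → Matrix (Fin (n + 1)) (Fin (n + 1)) ℝ} (h : FormPart ν w μ P)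
include h

lemma isFiniteMeasure_weighted : IsFiniteMeasure (weighted ν w) := by
  obtain ⟨C, hC⟩ := h.bounded_w
  have := h.finite
  refine isFiniteMeasure_withDensity (ne_of_lt ?_)
  calc ∫⁻ x, ENNReal.ofReal (w x) ∂ν ≤ ∫⁻ _, ENNReal.ofReal C ∂ν :=
        lintegral_mono_ae (hC.mono fun x hx => ENNReal.ofReal_le_ofReal hx)
    _ < ⊤ := by
      rw [lintegral_const]
      exact ENNReal.mul_lt_top ENNReal.ofReal_lt_top (measure_lt_top _ _)

lemma norm_rmul_P_le (x : RSpace (n + 1)) (v : CSpace (n + 1)) : ‖rmul (P x) v‖ ≤ 1 * ‖v‖ :=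
  norm_rmul_le (norm_mulVec_le_of_idempotent (h.transpose_P x) (h.mul_self_P x))

/-- The operator which represents a part of the form. -/
theorem exists_operator :
    ∃ (T Q : Lp (CSpace (n + 1)) 2 (weighted ν w) →L[ℂ] Lp (CSpace (n + 1)) 2 (weighted ν w))
      (c : ℝ), 0 < c ∧ (∀ F, Q F =ᵐ[weighted ν w] fun x => rmul (P x) (F x)) ∧
      (∀ F G : Lp (CSpace (n + 1)) 2 (weighted ν w), coeffForm ν μ F G = inner ℂ G (T F)) ∧
      (∀ F, Q F = F → c * ‖F‖ ^ 2 ≤ (inner ℂ F (T F)).re) ∧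
      ∀ F, Q F = F → ∀ (s : Set (RSpace (n + 1))) (G : Lp (CSpace (n + 1)) 2 (weighted ν w)),
        G =ᵐ[weighted ν w] s.indicator (fun x => reC (n + 1) (F x)) →
        c * ‖G‖ ^ 2 ≤ (inner ℂ G (T F)).re := by
  have hac := weighted_absolutelyContinuous ν w
  obtain ⟨c₂, hc₂, hup⟩ := h.upper
  obtain ⟨c₁, hc₁, hlo⟩ := h.lower
  -- In the weighted space the coefficient becomes μ/w, which is bounded above, and below on the
  -- range of P, since w > 0 almost everywhere for the weighted measure.
  let B : RSpace (n + 1) → Matrix (Fin (n + 1)) (Fin (n + 1)) ℝ := fun x => (w x)⁻¹ • μ x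
  have hBm : ∀ i j, AEMeasurable (fun x => B x i j) (weighted ν w) := fun i j =>
    (h.aemeasurable_w.inv.mul (h.aemeasurable_μ i j)).mono_ac hac
  have hpos : ∀ᵐ x ∂(weighted ν w), 0 < w x := by
    refine (ae_withDensity_iff' h.aemeasurable_w.ennreal_ofReal).2 (Eventually.of_forall fun x hx => ?_)
    by_contra h0
    exact hx (ENNReal.ofReal_of_nonpos (not_lt.1 h0))
  have hBup : ∀ᵐ x ∂(weighted ν w), ∀ v : CSpace (n + 1), ‖rmul (B x) v‖ ≤ c₂ * ‖v‖ := by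
    filter_upwards [hac.ae_le hup, hpos] with x hx hw v
    have := norm_rmul_le (v := v) hx
    rw [rmul_smul_left, norm_smul, Complex.norm_real, norm_inv, Real.norm_of_nonneg hw.le,
      inv_mul_le_iff₀ hw]
    exact this.trans (le_of_eq (by ring))
  have hBlo : ∀ᵐ x ∂(weighted ν w), ∀ ξ : RSpace (n + 1),
      (P x *ᵥ fun j => ξ j) = (fun j => ξ j) →
      c₁ * ‖ξ‖ ^ 2 ≤ ∑ i, (B x *ᵥ fun j => ξ j) i * ξ i := by
    filter_upwards [hac.ae_le hlo, hpos] with x hx hw ξ hξ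
    simp only [B, Matrix.smul_mulVec, Pi.smul_apply, smul_eq_mul, mul_assoc]
    rw [← Finset.mul_sum, le_inv_mul_iff₀ hw]
    exact (le_of_eq (by ring)).trans (hx ξ hξ)
  obtain ⟨T, hT⟩ := exists_mulOperator hBm hBup
  obtain ⟨Q, hQ⟩ := exists_mulOperator (ν := weighted ν w)
    (fun i j => (h.aemeasurable_P i j).mono_ac hac) (C := 1)
    (Eventually.of_forall fun x v => h.norm_rmul_P_le x v)
  have key : ∀ (F G : Lp (CSpace (n + 1)) 2 (weighted ν w)),
      (∀ᵐ x ∂(weighted ν w), c₁ * ‖G x‖ ^ 2 ≤ (inner ℂ (G x) (rmul (B x) (F x))).re) →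
      c₁ * ‖G‖ ^ 2 ≤ (inner ℂ G (T F)).re := fun F G hb => by
    have hint := L2.integrable_inner (𝕜 := ℂ) G (T F)
    have e1 : (inner ℂ G (T F)).re = ∫ x, (inner ℂ (G x) (T F x)).re ∂(weighted ν w) := by
      rw [L2.inner_def]; exact (integral_re hint).symm
    have e2 : ‖G‖ ^ 2 = ∫ x, ‖G x‖ ^ 2 ∂(weighted ν w) := by
      have h1 : (inner ℂ G G).re = ‖G‖ ^ 2 := re_inner_self G
      rw [← h1, L2.inner_def]
      have h2 := integral_re (L2.integrable_inner (𝕜 := ℂ) G G)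
      refine h2.symm.trans (integral_congr_ae (Eventually.of_forall fun x => ?_))
      exact re_inner_self (G x)
    rw [e1, e2, ← integral_const_mul]
    refine integral_mono_ae ?_ hint.re ?_
    · exact ((Lp.memLp G).integrable_norm_pow (by norm_num)).const_mul _
    · filter_upwards [hb, hT F] with x h1 h2
      rw [h2]
      exact h1
  refine ⟨T, Q, c₁, hc₁, hQ, fun F G => ?_, fun F hF => key F F ?_, fun F hF s G hG =>
    key F G ?_⟩
  · rw [L2.inner_def, coeffForm]
    refine Eq.trans ?_ (integral_withDensity_eq_integral_toReal_smul₀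
      h.aemeasurable_w.ennreal_ofReal (Eventually.of_forall fun x => ENNReal.ofReal_lt_top) _).symm
    have hT' := (ae_withDensity_iff' h.aemeasurable_w.ennreal_ofReal).1 (hT F)
    refine integral_congr_ae ?_
    filter_upwards [hT', h.nonneg_w, hup] with x h1 h2 h3
    rw [← inner_rmul, ENNReal.toReal_ofReal h2]
    -- Where w vanishes the upper bound forces μ to vanish, so both integrands are 0.
    rcases h2.eq_or_lt with h0 | h0
    · rw [← h0, zero_smul]
      have h4 : rmul (μ x) (F x) = 0 := by
        have := norm_rmul_le (v := F x) h3
        rw [← h0, mul_zero, zero_mul] at this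
        exact norm_le_zero_iff.1 this
      rw [h4, inner_zero_right]
    · rw [h1 (by simpa using h0), rmul_smul_left, inner_smul_right, Complex.ofReal_inv,
        Complex.real_smul, mul_inv_cancel_left₀ (by exact_mod_cast h0.ne')]
  · have h1 := hQ F
    rw [hF] at h1
    filter_upwards [h1, hBlo] with x h2 h3
    rw [re_inner_rmul_self, norm_sq_eq_reV_add_imV, mul_add]
    exact add_le_add (h3 _ (mulVec_reV_of_rmul_eq h2.symm)) (h3 _ (mulVec_imV_of_rmul_eq h2.symm))
  · have h1 := hQ F
    rw [hF] at h1
    filter_upwards [h1, hBlo, hG] with x h2 h3 h4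
    rw [h4]
    by_cases hx : x ∈ s
    · rw [indicator_of_mem hx, re_inner_reC_rmul, norm_reC]
      exact h3 _ (mulVec_reV_of_rmul_eq h2.symm)
    · rw [indicator_of_notMem hx]
      simp

end FormPart

end DiffusionData

/-! ### Test functions, their gradients and the chain rule -/

section Cgrad

variable {m : ℕ} {u : RSpace m → ℂ}

lemma continuous_cgrad (hu : ContDiff ℝ ∞ u) : Continuous (cgrad u) := by
  have h := hu.continuous_fderiv (by simp)
  refine (PiLp.continuous_toLp 2 _).comp (continuous_pi fun i => ?_)
  exact h.clm_apply continuous_const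

lemma exists_norm_cgrad_le (hu : ContDiff ℝ ∞ u) (hs : HasCompactSupport u) :
    ∃ C : ℝ, ∀ x, ‖cgrad u x‖ ≤ C := by
  refine (hs.fderiv ℝ).mono' (f' := cgrad u) (fun x hx => subset_closure fun h0 => hx ?_)
    |>.exists_bound_of_continuous (continuous_cgrad hu)
  ext i
  simp [cgrad, h0]

lemma cgrad_comp_re {F : ℝ → ℝ} (hF : ContDiff ℝ ∞ F) (hu : ContDiff ℝ ∞ u) (x : RSpace m) :
    cgrad (fun y => (F (u y).re : ℂ)) x = ((deriv F (u x).re : ℝ) : ℂ) • reC m (cgrad u x) := by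
  have h1 : HasFDerivAt u (fderiv ℝ u x) x := (hu.differentiable (by simp) x).hasFDerivAt
  have h2 := Complex.reCLM.hasFDerivAt.comp x h1
  have h3 := (hF.differentiable (by simp) (u x).re).hasDerivAt.hasFDerivAt.comp x h2
  have h4 := Complex.ofRealCLM.hasFDerivAt.comp x h3
  ext i
  have h5 : fderiv ℝ (fun y => (F (u y).re : ℂ)) x = _ := h4.fderiv
  simp only [cgrad, h5, PiLp.smul_apply, reC_apply]
  simp [mul_comm]

end Cgrad

namespace DiffusionData

open Matrix

variable {n : ℕ} {D : DiffusionData n}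

lemma TestFun.comp_re {u : RSpace (n + 1) → ℂ} (hu : u ∈ D.TestFun) {F : ℝ → ℝ}
    (hF : ContDiff ℝ ∞ F) (h0 : F 0 = 0) : (fun x => (F (u x).re : ℂ)) ∈ D.TestFun := by
  obtain ⟨h1, h2, h3⟩ := hu
  have hsub : Function.support (fun x => (F (u x).re : ℂ)) ⊆ Function.support u := fun x hx h => by
    apply hx
    simp [h, h0]
  refine ⟨?_, h2.mono hsub, h3.mono_left (closure_mono hsub)⟩
  exact Complex.ofRealCLM.contDiff.comp (hF.comp (Complex.reCLM.contDiff.comp h1))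

lemma formPart_of_hypersurface {𝒮 : Set (RSpace (n + 1))} (h : IsLipschitzHypersurface 𝒮)
    (hfin : Measure.euclideanHausdorffMeasure n 𝒮 < ⊤) {w : RSpace (n + 1) → ℝ}
    {μ : RSpace (n + 1) → Matrix (Fin (n + 1)) (Fin (n + 1)) ℝ}
    (hμ : IsDiffusionCoeff 𝒮 (tangentSet 𝒮) w μ) (hw : Measurable fun x : 𝒮 => w x)
    (hw0 : ∀ x ∈ 𝒮, 0 ≤ w x) (hwb : ∃ C, ∀ x ∈ 𝒮, w x ≤ C) :
    FormPart ((Measure.euclideanHausdorffMeasure n).restrict 𝒮) w μ (surfProj 𝒮) := by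
  have hm := h.measurableSet
  obtain ⟨h1, ⟨c₁, hc₁, h2⟩, c₂, hc₂, h3⟩ := hμ
  obtain ⟨C, hC⟩ := hwb
  have hmem := ae_restrict_mem (μ := Measure.euclideanHausdorffMeasure n) hm
  exact
    { finite := ⟨by rwa [Measure.restrict_apply_univ]⟩
      aemeasurable_w := aemeasurable_restrict_of_measurable_subtype hm hw
      nonneg_w := hmem.mono hw0
      bounded_w := ⟨C, hmem.mono hC⟩
      aemeasurable_μ := fun i j => aemeasurable_restrict_of_measurable_subtype hm (h1 i j)
      aemeasurable_P := fun i j => h.aemeasurable_surfProj i j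
      transpose_P := surfProj_transpose
      mul_self_P := surfProj_mul_self
      upper := ⟨c₂, hc₂, hmem.mono h3⟩
      lower := ⟨c₁, hc₁, hmem.mono fun x hx ξ hξ => by
        rcases mem_tangentSet_of_surfProj hξ with h4 | h4
        · exact h2 x hx ξ h4
        · simp [h4]⟩ }

namespace Admissible

variable (hD : D.Admissible)
include hD

lemma formPart_Γd : FormPart D.surfd D.wd D.μd (surfProj D.Γd) :=
  formPart_of_hypersurface hD.hypersurface_Γd hD.measure_Γd_lt_top hD.coeff_Γd hD.measurable_wd
    hD.nonneg_wd hD.bounded_wd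

lemma formPart_Sig : FormPart D.surfs D.ws D.μs (surfProj D.Sig) :=
  formPart_of_hypersurface hD.hypersurface_Sig hD.measure_Sig_lt_top hD.coeff_Sig hD.measurable_ws
    hD.nonneg_ws hD.bounded_ws

lemma formPart_Ω : FormPart D.bulk D.wΩ D.μΩ fun _ => 1 := by
  have hm := hD.isOpen_Ω.measurableSet
  have hmem := ae_restrict_mem (μ := (volume : Measure (RSpace (n + 1)))) hm
  obtain ⟨h1, ⟨c₁, hc₁, h2⟩, c₂, hc₂, h3⟩ := hD.coeff_Ω
  have hcont : Continuous D.wΩ :=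
    (Metric.continuous_infDist_pt D.S).rpow_const fun _ => Or.inr hD.zero_le_γ
  obtain ⟨C, hC⟩ := hD.isBounded_Ω.isCompact_closure.exists_bound_of_continuousOn hcont.continuousOn
  exact
    { finite := ⟨by
        rw [bulk, Measure.restrict_apply_univ]; exact hD.isBounded_Ω.measure_lt_top⟩
      aemeasurable_w := hcont.measurable.aemeasurable
      nonneg_w := Eventually.of_forall fun x => Real.rpow_nonneg Metric.infDist_nonneg _
      bounded_w := ⟨C, hmem.mono fun x hx => (le_abs_self _).trans (hC x (subset_closure hx))⟩
      aemeasurable_μ := fun i j => aemeasurable_restrict_of_measurable_subtype hm (h1 i j)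
      aemeasurable_P := fun i j => aemeasurable_const
      transpose_P := fun _ => Matrix.transpose_one
      mul_self_P := fun _ => Matrix.one_mul _
      upper := ⟨c₂, hc₂, hmem.mono h3⟩
      lower := ⟨c₁, hc₁, hmem.mono fun x hx ξ _ => h2 x hx ξ (mem_univ _)⟩ }

end Admissible

lemma rmul_one {m : ℕ} (v : CSpace m) : rmul 1 v = v := by
  ext i
  rw [rmul_apply, Finset.sum_eq_single i (fun j _ hj => by simp [Matrix.one_apply_ne hj.symm])
    (by simp)]
  simp

/-- The gradients of test functions in terms of the projections to the tangent spaces. -/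
lemma represents_iff {u : RSpace (n + 1) → ℂ} (hu : Differentiable ℝ u) (U : D.FormSpace) :
    D.Represents u U ↔ U.1 =ᵐ[D.bulk] u ∧
      U.2.1 =ᵐ[weighted D.bulk D.wΩ] (fun x => rmul 1 (cgrad u x)) ∧
      U.2.2.1 =ᵐ[weighted D.surfd D.wd] (fun x => rmul (surfProj D.Γd x) (cgrad u x)) ∧
      U.2.2.2 =ᵐ[weighted D.surfs D.ws] fun x => rmul (surfProj D.Sig x) (cgrad u x) := by
  have h1 : surfGrad D.Γd u = fun x => rmul (surfProj D.Γd x) (cgrad u x) :=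
    funext fun x => surfGrad_eq (hu x)
  have h2 : surfGrad D.Sig u = fun x => rmul (surfProj D.Sig x) (cgrad u x) :=
    funext fun x => surfGrad_eq (hu x)
  simp only [Represents, h1, h2, rmul_one]

lemma FormPart.memLp_rmul_cgrad {ν : Measure (RSpace (n + 1))} {w : RSpace (n + 1) → ℝ}
    {μ P : RSpace (n + 1) → Matrix (Fin (n + 1)) (Fin (n + 1)) ℝ} (h : FormPart ν w μ P)
    {u : RSpace (n + 1) → ℂ} (hu : ContDiff ℝ ∞ u) (hs : HasCompactSupport u) :
    MemLp (fun x => rmul (P x) (cgrad u x)) 2 (weighted ν w) := by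
  have := h.isFiniteMeasure_weighted
  obtain ⟨C, hC⟩ := exists_norm_cgrad_le hu hs
  exact memLp_rmul (fun i j => (h.aemeasurable_P i j).mono_ac (weighted_absolutelyContinuous ν w))
    (Eventually.of_forall h.norm_rmul_P_le)
    (MemLp.of_bound (continuous_cgrad hu).aestronglyMeasurable C (Eventually.of_forall hC))

/-- The canonical copy of the test functions in the graph of `J`. -/
lemma Admissible.exists_represents (hD : D.Admissible) {u : RSpace (n + 1) → ℂ}
    (hu : u ∈ D.TestFun) :
    ∃ z : D.FormSpace × D.LL 2, D.Represents u z.1 ∧ z.2 =ᵐ[D.total] u := by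
  obtain ⟨h1, h2, -⟩ := hu
  have := hD.isFiniteMeasure_total
  have := hD.formPart_Ω.finite
  have hu : ∀ ν : Measure (RSpace (n + 1)), IsFiniteMeasure ν → MemLp u 2 ν := fun ν _ => by
    obtain ⟨C, hC⟩ := h2.exists_bound_of_continuous h1.continuous
    exact MemLp.of_bound h1.continuous.aestronglyMeasurable C (Eventually.of_forall hC)
  obtain ⟨a, ha⟩ : ∃ a : Lp ℂ 2 D.total, a =ᵐ[D.total] u := ⟨_, (hu _ inferInstance).coeFn_toLp⟩
  obtain ⟨b, hb⟩ : ∃ b : Lp ℂ 2 D.bulk, b =ᵐ[D.bulk] u := ⟨_, (hu _ inferInstance).coeFn_toLp⟩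
  refine ⟨((b, (hD.formPart_Ω.memLp_rmul_cgrad h1 h2).toLp _,
    (hD.formPart_Γd.memLp_rmul_cgrad h1 h2).toLp _,
    (hD.formPart_Sig.memLp_rmul_cgrad h1 h2).toLp _), a), ?_, ha⟩
  rw [represents_iff (h1.differentiable (by simp))]
  exact ⟨hb, (hD.formPart_Ω.memLp_rmul_cgrad h1 h2).coeFn_toLp,
    (hD.formPart_Γd.memLp_rmul_cgrad h1 h2).coeFn_toLp,
    (hD.formPart_Sig.memLp_rmul_cgrad h1 h2).coeFn_toLp⟩

end DiffusionData

/-! ### Truncation of the elements of the form domain -/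

section LpMultipliers

variable {α E : Type*} [MeasurableSpace α] {ν : Measure α} [NormedAddCommGroup E] [NormedSpace ℂ E]

lemma exists_Lp_smul {a : α → ℝ} (ha : AEStronglyMeasurable a ν) (hb : ∀ᵐ x ∂ν, |a x| ≤ 1)
    (X : Lp E 2 ν) : ∃ Y : Lp E 2 ν, Y =ᵐ[ν] fun x => (a x : ℂ) • X x := by
  have h : MemLp (fun x => (a x : ℂ) • X x) 2 ν := by
    refine (Lp.memLp X).of_le ((Complex.continuous_ofReal.comp_aestronglyMeasurable ha).smul
      (Lp.aestronglyMeasurable X)) ?_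
    filter_upwards [hb] with x hx
    rw [norm_smul, Complex.norm_real, Real.norm_eq_abs]
    exact mul_le_of_le_one_left (norm_nonneg _) hx
  exact ⟨h.toLp _, h.coeFn_toLp⟩

/-- Split a_k X_k - a' X' = a_k (X_k - X') + (a_k - a') X'. The first term is small because |a_k| ≤
1, the second by dominated convergence. -/
lemma tendsto_Lp_of_smul {a : ℕ → α → ℝ} {a' : α → ℝ} {X Y : ℕ → Lp E 2 ν} {X' Y' : Lp E 2 ν}
    (ham : ∀ k, AEStronglyMeasurable (a k) ν) (hab : ∀ k, ∀ᵐ x ∂ν, |a k x| ≤ 1)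
    (ha : ∀ᵐ x ∂ν, Tendsto (fun k => a k x) atTop (𝓝 (a' x))) (hX : Tendsto X atTop (𝓝 X'))
    (hY : ∀ k, Y k =ᵐ[ν] fun x => (a k x : ℂ) • X k x)
    (hY' : Y' =ᵐ[ν] fun x => (a' x : ℂ) • X' x) : Tendsto Y atTop (𝓝 Y') := by
  rw [Lp.tendsto_Lp_iff_tendsto_eLpNorm'] at hX ⊢
  have ha'm : AEStronglyMeasurable a' ν := aestronglyMeasurable_of_tendsto_ae atTop ham ha
  have ha'b : ∀ᵐ x ∂ν, |a' x| ≤ 1 := by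
    filter_upwards [ha, ae_all_iff.2 hab] with x h1 h2
    exact le_of_tendsto h1.abs (Eventually.of_forall h2)
  have hZ : Tendsto (fun k => eLpNorm (fun x => ((a k x - a' x : ℝ) : ℂ) • X' x) 2 ν) atTop
      (𝓝 0) := by
    have h1 : Tendsto (fun k => ∫⁻ x, ‖((a k x - a' x : ℝ) : ℂ) • X' x‖ₑ ^ (2 : ℝ) ∂ν) atTop
        (𝓝 (∫⁻ _, 0 ∂ν)) := by
      refine tendsto_lintegral_of_dominated_convergence' (fun x => (2 * ‖X' x‖ₑ) ^ (2 : ℝ)) ?_ ?_ ?_ ?_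
      · exact fun k => ((Complex.continuous_ofReal.comp_aestronglyMeasurable
          ((ham k).sub ha'm)).smul (Lp.aestronglyMeasurable X')).enorm.pow_const _
      · intro k
        filter_upwards [hab k, ha'b] with x h1 h2
        refine ENNReal.rpow_le_rpow ?_ (by norm_num)
        rw [enorm_smul]
        gcongr
        rw [← ofReal_norm, Complex.norm_real, Real.norm_eq_abs, ← ENNReal.ofReal_ofNat]
        refine ENNReal.ofReal_le_ofReal ((abs_sub _ _).trans ?_)
        linarith
      · simp_rw [ENNReal.mul_rpow_of_nonneg _ _ (show (0 : ℝ) ≤ 2 by norm_num)]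
        rw [lintegral_const_mul' _ _ (by simp)]
        refine ENNReal.mul_ne_top (by simp) ?_
        have := lintegral_rpow_enorm_lt_top_of_eLpNorm_lt_top (by norm_num) (by norm_num)
          (Lp.eLpNorm_lt_top X')
        simpa using this.ne
      · filter_upwards [ha] with x hx
        have h2 : Tendsto (fun k => ((a k x - a' x : ℝ) : ℂ) • X' x) atTop (𝓝 0) := by
          have h3 : Tendsto (fun k => a k x - a' x) atTop (𝓝 0) := by
            simpa using hx.sub_const (a' x)
          have := ((Complex.continuous_ofReal.tendsto 0).comp h3).smul_const (X' x)
          simpa using this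
        have h4 := (ENNReal.continuous_rpow_const (y := 2)).tendsto _ |>.comp h2.enorm
        simpa [Function.comp_def] using h4
    have h5 := (ENNReal.continuous_rpow_const (y := 1 / 2)).tendsto _ |>.comp h1
    simp only [lintegral_zero, ENNReal.zero_rpow_of_pos (show (0 : ℝ) < 1 / 2 by norm_num)] at h5
    refine h5.congr fun k => ?_
    rw [eLpNorm_eq_lintegral_rpow_enorm_toReal (by norm_num) (by norm_num)]
    simp
  have hsum := hX.add hZ
  rw [add_zero] at hsum
  refine tendsto_of_tendsto_of_tendsto_of_le_of_le tendsto_const_nhds hsum (fun _ => bot_le)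
    fun k => ?_
  have e : (Y k - Y' : α → E) =ᵐ[ν] (fun x => (a k x : ℂ) • (X k x - X' x)) +
      fun x => ((a k x - a' x : ℝ) : ℂ) • X' x := by
    filter_upwards [hY k, hY'] with x h1 h2
    simp only [Pi.sub_apply, Pi.add_apply, h1, h2]
    push_cast
    module
  refine (eLpNorm_congr_ae e).trans_le ((eLpNorm_add_le ?_ ?_ (by norm_num)).trans ?_)
  · exact (Complex.continuous_ofReal.comp_aestronglyMeasurable (ham k)).smul
      ((Lp.aestronglyMeasurable _).sub (Lp.aestronglyMeasurable _))
  · exact (Complex.continuous_ofReal.comp_aestronglyMeasurable ((ham k).sub ha'm)).smul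
      (Lp.aestronglyMeasurable _)
  gcongr
  refine eLpNorm_mono_ae ?_
  filter_upwards [hab k] with x hx
  rw [norm_smul, Complex.norm_real, Real.norm_eq_abs]
  exact mul_le_of_le_one_left (norm_nonneg _) hx

end LpMultipliers

/-- Smooth approximations of `s ↦ (s - k)⁺`. -/
lemma exists_smooth_truncation {k : ℝ} (hk : 0 ≤ k) : ∃ F : ℕ → ℝ → ℝ, ∀ s,
    (∀ j, ContDiff ℝ ∞ (F j) ∧ F j 0 = 0 ∧ |deriv (F j) s| ≤ 1) ∧
    Tendsto (fun j => deriv (F j) s) atTop (𝓝 ((Ioi k).indicator 1 s)) ∧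
    Tendsto (fun j => F j s) atTop (𝓝 (max (s - k) 0)) := by
  -- The derivatives rise from 0 to 1 between k and k + 1/(j+1), hence to the right of k, and
  -- converge at every point, with limit 0 at k. So nothing needs to be known about gradients on {Re
  -- φ = k}. As k ≥ 0, the primitives starting at 0 vanish up to k.
  let f : ℕ → ℝ → ℝ := fun j s => Real.smoothTransition ((s - k) * (j + 1))
  have hf : ∀ j, ContDiff ℝ ∞ (f j) := fun j =>
    Real.smoothTransition.contDiff.comp (by fun_prop)
  have hd : ∀ j s, HasDerivAt (fun s => ∫ τ in (0 : ℝ)..s, f j τ) (f j s) s := fun j s =>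
    ((hf j).continuous.integral_hasStrictDerivAt 0 s).hasDerivAt
  have hderiv : ∀ j, deriv (fun s => ∫ τ in (0 : ℝ)..s, f j τ) = f j := fun j =>
    funext fun s => (hd j s).deriv
  have hf0 : ∀ j s, s ≤ k → f j s = 0 := fun j s hs =>
    Real.smoothTransition.zero_of_nonpos
      (mul_nonpos_of_nonpos_of_nonneg (by linarith) (by positivity))
  have hlim : ∀ s, Tendsto (fun j => f j s) atTop (𝓝 ((Ioi k).indicator 1 s)) := fun s => by
    by_cases hs : s ∈ Ioi k
    · rw [indicator_of_mem hs]
      have hsk : 0 < s - k := sub_pos.2 hs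
      have h1 : Tendsto (fun j : ℕ => (s - k) * ((j : ℝ) + 1)) atTop atTop :=
        (tendsto_natCast_atTop_atTop.atTop_add tendsto_const_nhds).const_mul_atTop hsk
      refine tendsto_const_nhds.congr' ?_
      filter_upwards [h1.eventually_ge_atTop 1] with j hj
      exact (Real.smoothTransition.one_of_one_le hj).symm
    · rw [indicator_of_notMem hs]
      exact tendsto_const_nhds.congr fun j => (hf0 j s (not_lt.1 hs)).symm
  refine ⟨fun j s => ∫ τ in (0 : ℝ)..s, f j τ, fun s => ⟨fun j => ⟨?_, ?_, ?_⟩, ?_, ?_⟩⟩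
  · rw [contDiff_infty_iff_deriv, hderiv]
    exact ⟨fun s => (hd j s).differentiableAt, hf j⟩
  · simp
  · rw [hderiv, abs_of_nonneg (Real.smoothTransition.nonneg _)]
    exact Real.smoothTransition.le_one _
  · simp only [hderiv]
    exact hlim s
  · rcases le_or_gt s k with hs | hs
    · rw [max_eq_right (by linarith)]
      refine tendsto_const_nhds.congr fun j => ?_
      symm
      change ∫ τ in (0 : ℝ)..s, f j τ = 0
      rw [intervalIntegral.integral_congr (g := fun _ => 0), intervalIntegral.integral_zero]
      intro τ hτ
      refine hf0 j τ ?_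
      rcases mem_uIcc.1 hτ with h | h <;> linarith
    · have h1 : ∀ j, ∫ τ in (0 : ℝ)..s, f j τ = ∫ τ in k..s, f j τ := fun j => by
        rw [← intervalIntegral.integral_add_adjacent_intervals (b := k)
          ((hf j).continuous.intervalIntegrable _ _) ((hf j).continuous.intervalIntegrable _ _),
          intervalIntegral.integral_congr (g := fun _ => 0) (a := 0), intervalIntegral.integral_zero,
          zero_add]
        intro τ hτ
        refine hf0 j τ ?_
        rcases mem_uIcc.1 hτ with h | h <;> linarith
      simp only [h1]
      have h2 : max (s - k) 0 = ∫ _ in k..s, (1 : ℝ) := by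
        rw [intervalIntegral.integral_const, smul_eq_mul, mul_one, max_eq_left (by linarith)]
      rw [h2]
      refine intervalIntegral.tendsto_integral_filter_of_dominated_convergence (fun _ => 1)
        (Eventually.of_forall fun j => (hf j).continuous.aestronglyMeasurable)
        (Eventually.of_forall fun j => Eventually.of_forall fun τ _ => ?_)
        intervalIntegrable_const (Eventually.of_forall fun τ hτ => ?_)
      · rw [Real.norm_of_nonneg (Real.smoothTransition.nonneg _)]
        exact Real.smoothTransition.le_one _
      · have := hlim τ
        rwa [indicator_of_mem (by rw [uIoc_of_le hs.le] at hτ; exact hτ.1)] at this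

namespace DiffusionData

variable {n : ℕ} {D : DiffusionData n}

lemma Admissible.weighted_bulk_ac (hD : D.Admissible) : weighted D.bulk D.wΩ ≪ D.total :=
  (weighted_absolutelyContinuous _ _).trans
    (Measure.absolutelyContinuous_of_le hD.bulk_le_total)

lemma weighted_surfd_ac : weighted D.surfd D.wd ≪ D.total :=
  (weighted_absolutelyContinuous _ _).trans
    (Measure.absolutelyContinuous_of_le Admissible.surfd_le_total)

lemma weighted_surfs_ac : weighted D.surfs D.ws ≪ D.total :=
  (weighted_absolutelyContinuous _ _).trans
    (Measure.absolutelyContinuous_of_le Admissible.surfs_le_total)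

lemma tendsto_truncated_gradient {ν : Measure (RSpace (n + 1))} (hac : ν ≪ D.total)
    {a : ℕ → RSpace (n + 1) → ℝ} {a' : RSpace (n + 1) → ℝ}
    (ham : ∀ k, AEStronglyMeasurable (a k) D.total) (hab : ∀ k x, |a k x| ≤ 1)
    (ha : ∀ᵐ x ∂D.total, Tendsto (fun k => a k x) atTop (𝓝 (a' x)))
    {X Y : ℕ → Lp (CSpace (n + 1)) 2 ν} {X' Y' : Lp (CSpace (n + 1)) 2 ν}
    (hX : Tendsto X atTop (𝓝 X'))
    (hY : ∀ k, Y k =ᵐ[ν] fun x => (a k x : ℂ) • reC (n + 1) (X k x))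
    (hY' : Y' =ᵐ[ν] fun x => (a' x : ℂ) • reC (n + 1) (X' x)) : Tendsto Y atTop (𝓝 Y') := by
  refine tendsto_Lp_of_smul (X := fun k => (reC (n + 1)).compLp (X k))
    (X' := (reC (n + 1)).compLp X') (fun k => (ham k).mono_ac hac)
    (fun k => Eventually.of_forall (hab k)) (hac.ae_le ha) ?_ (fun k => ?_) ?_
  · exact (((reC (n + 1)).compLpL 2 ν).continuous.tendsto X').comp hX
  · filter_upwards [hY k, (reC (n + 1)).coeFn_compLp (X k)] with x h1 h2
    rw [h1, h2]
  · filter_upwards [hY', (reC (n + 1)).coeFn_compLp X'] with x h1 h2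
    rw [h1, h2]

lemma exists_Lp_smul_reC {ν : Measure (RSpace (n + 1))} (hac : ν ≪ D.total)
    {a : RSpace (n + 1) → ℝ} (ha : AEStronglyMeasurable a D.total) (hb : ∀ᵐ x ∂D.total, |a x| ≤ 1)
    (X : Lp (CSpace (n + 1)) 2 ν) :
    ∃ Y : Lp (CSpace (n + 1)) 2 ν, Y =ᵐ[ν] fun x => (a x : ℂ) • reC (n + 1) (X x) := by
  obtain ⟨Y, hY⟩ := exists_Lp_smul (ha.mono_ac hac) (hac.ae_le hb) ((reC (n + 1)).compLp X)
  refine ⟨Y, ?_⟩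
  filter_upwards [hY, (reC (n + 1)).coeFn_compLp X] with x h1 h2
  rw [h1, h2]

lemma comp_re_gradient {ν : Measure (RSpace (n + 1))} (hac : ν ≪ D.total)
    {P : RSpace (n + 1) → Matrix (Fin (n + 1)) (Fin (n + 1)) ℝ}
    {F : ℝ → ℝ} (hF : ContDiff ℝ ∞ F) {u : RSpace (n + 1) → ℂ} (hu : ContDiff ℝ ∞ u)
    {φ : D.LL 2} (hφ : φ =ᵐ[D.total] u) {X Y : Lp (CSpace (n + 1)) 2 ν}
    (hX : X =ᵐ[ν] fun x => rmul (P x) (cgrad u x))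
    (hY : Y =ᵐ[ν] fun x => rmul (P x) (cgrad (fun y => (F (u y).re : ℂ)) x)) :
    Y =ᵐ[ν] fun x => ((deriv F (φ x).re : ℝ) : ℂ) • reC (n + 1) (X x) := by
  filter_upwards [hX, hY, hac.ae_eq hφ] with x h1 h2 h3
  rw [h2, h1, h3, cgrad_comp_re hF hu, rmul_smul, reC_rmul]

/-- The form domain is invariant under smooth truncations of the real part. -/
lemma Admissible.exists_comp_re_mem_graphJ (hD : D.Admissible) {U : D.FormSpace} {φ : D.LL 2}
    (h : (U, φ) ∈ D.graphJ) {F : ℝ → ℝ} (hF : ContDiff ℝ ∞ F) (h0 : F 0 = 0)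
    (hd : ∀ s, |deriv F s| ≤ 1) :
    ∃ (V : D.FormSpace) (χ : D.LL 2), (V, χ) ∈ D.graphJ ∧
      χ =ᵐ[D.total] (fun x => (F (φ x).re : ℂ)) ∧
      V.1 =ᵐ[D.bulk] (fun x => (F (U.1 x).re : ℂ)) ∧
      V.2.1 =ᵐ[weighted D.bulk D.wΩ]
        (fun x => ((deriv F (φ x).re : ℝ) : ℂ) • reC (n + 1) (U.2.1 x)) ∧
      V.2.2.1 =ᵐ[weighted D.surfd D.wd]
        (fun x => ((deriv F (φ x).re : ℝ) : ℂ) • reC (n + 1) (U.2.2.1 x)) ∧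
      V.2.2.2 =ᵐ[weighted D.surfs D.ws]
        (fun x => ((deriv F (φ x).re : ℝ) : ℂ) • reC (n + 1) (U.2.2.2 x)) := by
  have hcd : Continuous (deriv F) := hF.continuous_deriv (by simp)
  have hFl : LipschitzWith 1 F := lipschitzWith_of_nnnorm_deriv_le
    (hF.differentiable (by simp)) fun s => by
      rw [← NNReal.coe_le_coe, coe_nnnorm]; exact hd s
  have hgl : LipschitzWith (1 * (1 * 1)) fun z : ℂ => (F z.re : ℂ) :=
    (Complex.isometry_ofReal.lipschitz).comp
      (hFl.comp (LipschitzWith.of_dist_le_mul fun z w => by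
        rw [NNReal.coe_one, one_mul, Real.dist_eq, Complex.dist_eq, ← Complex.sub_re]
        exact Complex.abs_re_le_norm _))
  have hg0 : (fun z : ℂ => (F z.re : ℂ)) 0 = 0 := by simp [h0]
  have hdm : ∀ ψ : D.LL 2, AEStronglyMeasurable (fun x => deriv F (ψ x).re) D.total := fun ψ =>
    (hcd.comp Complex.continuous_re).comp_aestronglyMeasurable (Lp.aestronglyMeasurable ψ)
  obtain ⟨z, hz, hzlim⟩ := mem_closure_iff_seq_limit.1 h
  have hlim1 := (continuous_fst.tendsto _).comp hzlim
  have hlim2 := (continuous_snd.tendsto _).comp hzlim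
  -- The multiplier is evaluated at φ = J U, which carries the traces on Γd and Σ as well. One
  -- subsequence converging almost everywhere for the total measure thus serves all three gradient
  -- components.
  obtain ⟨ns, hns, hae⟩ := (tendstoInMeasure_of_tendsto_Lp hlim2).exists_seq_tendsto_ae
  have hlim1' := hlim1.comp hns.tendsto_atTop
  have hlim2' := hlim2.comp hns.tendsto_atTop
  choose u hu hrep hval using hz
  have hcomp : ∀ k, ∃ y : D.FormSpace × D.LL 2, D.Represents (fun x => (F (u k x).re : ℂ)) y.1 ∧
      y.2 =ᵐ[D.total] fun x => (F (u k x).re : ℂ) := fun k =>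
    hD.exists_represents (TestFun.comp_re (hu k) hF h0)
  choose y hy1 hy2 using hcomp
  have hyG : ∀ k, y k ∈ D.graphJ := fun k =>
    subset_closure ⟨_, TestFun.comp_re (hu k) hF h0, hy1 k, hy2 k⟩
  have hr1 := fun k => (represents_iff ((hu k).1.differentiable (by simp)) _).1 (hrep k)
  have hr2 := fun k => (represents_iff
    ((TestFun.comp_re (hu k) hF h0).1.differentiable (by simp)) _).1 (hy1 k)
  have hb := Eventually.of_forall (f := ae D.total) fun x => hd (φ x).re
  obtain ⟨V1, hV1⟩ := exists_Lp_smul_reC hD.weighted_bulk_ac (hdm φ) hb U.2.1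
  obtain ⟨V2, hV2⟩ := exists_Lp_smul_reC weighted_surfd_ac (hdm φ) hb U.2.2.1
  obtain ⟨V3, hV3⟩ := exists_Lp_smul_reC weighted_surfs_ac (hdm φ) hb U.2.2.2
  have hconv : ∀ᵐ x ∂D.total, Tendsto (fun k => deriv F ((z (ns k)).2 x).re) atTop
      (𝓝 (deriv F (φ x).re)) := by
    filter_upwards [hae] with x hx
    exact ((hcd.comp Complex.continuous_re).tendsto _).comp hx
  refine ⟨(hgl.compLp hg0 U.1, V1, V2, V3), hgl.compLp hg0 φ, ?_, hgl.coeFn_compLp hg0 φ,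
    hgl.coeFn_compLp hg0 U.1, hV1, hV2, hV3⟩
  refine isClosed_closure.mem_of_tendsto (f := fun k => y (ns k)) (b := atTop) ?_
    (Eventually.of_forall fun k => hyG (ns k))
  refine Tendsto.prodMk_nhds (mx := fun k => (y (ns k)).1) (my := fun k => (y (ns k)).2)
    (Tendsto.prodMk_nhds (mx := fun k => (y (ns k)).1.1) (my := fun k => (y (ns k)).1.2) ?_
    (Tendsto.prodMk_nhds (mx := fun k => (y (ns k)).1.2.1) (my := fun k => (y (ns k)).1.2.2) ?_
    (Tendsto.prodMk_nhds (mx := fun k => (y (ns k)).1.2.2.1) (my := fun k => (y (ns k)).1.2.2.2)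
      ?_ ?_))) ?_
  · refine (((hgl.continuous_compLp hg0).tendsto U.1).comp
      ((continuous_fst.tendsto _).comp hlim1')).congr fun k => ?_
    refine Lp.ext ((hgl.coeFn_compLp hg0 _).trans ?_)
    filter_upwards [(hr1 (ns k)).1, (hr2 (ns k)).1] with x h1 h2
    rw [h2, Function.comp_apply, ← h1]
    rfl
  · exact tendsto_truncated_gradient hD.weighted_bulk_ac (fun k => hdm (z (ns k)).2)
      (fun k x => hd _) hconv (((continuous_fst.comp continuous_snd).tendsto _).comp hlim1')
      (fun k => comp_re_gradient hD.weighted_bulk_ac hF (hu _).1 (hval _) (hr1 _).2.1 (hr2 _).2.1)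
      hV1
  · exact tendsto_truncated_gradient weighted_surfd_ac (fun k => hdm (z (ns k)).2)
      (fun k x => hd _) hconv
      (((continuous_fst.comp (continuous_snd.comp continuous_snd)).tendsto _).comp hlim1')
      (fun k => comp_re_gradient weighted_surfd_ac hF (hu _).1 (hval _) (hr1 _).2.2.1 (hr2 _).2.2.1)
      hV2
  · exact tendsto_truncated_gradient weighted_surfs_ac (fun k => hdm (z (ns k)).2)
      (fun k x => hd _) hconv
      (((continuous_snd.comp (continuous_snd.comp continuous_snd)).tendsto _).comp hlim1')
      (fun k => comp_re_gradient weighted_surfs_ac hF (hu _).1 (hval _) (hr1 _).2.2.2 (hr2 _).2.2.2)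
      hV3
  · refine (((hgl.continuous_compLp hg0).tendsto φ).comp hlim2').congr fun k => ?_
    refine Lp.ext ((hgl.coeFn_compLp hg0 _).trans ?_)
    filter_upwards [hval (ns k), hy2 (ns k)] with x h1 h2
    rw [h2, Function.comp_apply, ← h1]
    rfl

end DiffusionData

lemma abs_le_abs_of_abs_deriv_le_one {F : ℝ → ℝ} (hF : ContDiff ℝ ∞ F) (h0 : F 0 = 0)
    (hd : ∀ s, |deriv F s| ≤ 1) (s : ℝ) : |F s| ≤ |s| := by
  have hFl : LipschitzWith 1 F := lipschitzWith_of_nnnorm_deriv_le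
    (hF.differentiable (by simp)) fun s => by
      rw [← NNReal.coe_le_coe, coe_nnnorm]; exact hd s
  have := hFl.dist_le_mul s 0
  simpa [Real.dist_eq, h0] using this

lemma exists_tendsto_comp_re {α : Type*} [MeasurableSpace α] {ν : Measure α} {F : ℕ → ℝ → ℝ}
    {F' : ℝ → ℝ} (hF : ∀ j, Continuous (F j)) (hb : ∀ j s, |F j s| ≤ |s|)
    (hlim : ∀ s, Tendsto (fun j => F j s) atTop (𝓝 (F' s))) {Y : ℕ → Lp ℂ 2 ν} {ψ : Lp ℂ 2 ν}
    (hY : ∀ j, Y j =ᵐ[ν] fun x => (F j (ψ x).re : ℂ)) :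
    ∃ Y' : Lp ℂ 2 ν, Y' =ᵐ[ν] (fun x => (F' (ψ x).re : ℂ)) ∧ Tendsto Y atTop (𝓝 Y') := by
  have hb' : ∀ s, |F' s| ≤ |s| := fun s =>
    le_of_tendsto (hlim s).abs (Eventually.of_forall fun j => hb j s)
  have hF'm : Measurable F' := measurable_of_tendsto_metrizable (fun j => (hF j).measurable)
    (tendsto_pi_nhds.2 hlim)
  have hre : AEMeasurable (fun x => (ψ x).re) ν :=
    Complex.measurable_re.comp_aemeasurable (Lp.aestronglyMeasurable ψ).aemeasurable
  -- G(s) is the multiplier G(s)/s, bounded by 1 and equal to 0 at s = 0, times s. This brings the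
  -- functions themselves under `tendsto_Lp_of_smul`.
  have hquot : ∀ G : ℝ → ℝ, (∀ s, |G s| ≤ |s|) → ∀ s, |G s / s| ≤ 1 ∧
      ((G s / s : ℝ) : ℂ) • (s : ℂ) = G s := fun G hG s => by
    rcases eq_or_ne s 0 with rfl | hs
    · have := hG 0
      rw [abs_zero, abs_nonpos_iff] at this
      simp [this]
    · refine ⟨?_, ?_⟩
      · rw [abs_div]; exact div_le_one_of_le₀ (hG s) (abs_nonneg s)
      · rw [smul_eq_mul, ← Complex.ofReal_mul, div_mul_cancel₀ _ hs]
  let L : ℂ →L[ℝ] ℂ := Complex.ofRealCLM.comp Complex.reCLM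
  have hLψ : L.compLp ψ =ᵐ[ν] fun x => (((ψ x).re : ℝ) : ℂ) := L.coeFn_compLp ψ
  have ham : ∀ G : ℝ → ℝ, Measurable G →
      AEStronglyMeasurable (fun x => G (ψ x).re / (ψ x).re) ν := fun G hG =>
    ((hG.comp_aemeasurable hre).div hre).aestronglyMeasurable
  obtain ⟨Y', hY'⟩ := exists_Lp_smul (ham F' hF'm)
    (Eventually.of_forall fun x => (hquot F' hb' (ψ x).re).1) (L.compLp ψ)
  refine ⟨Y', ?_, ?_⟩
  · filter_upwards [hY', hLψ] with x h1 h2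
    rw [h1, h2, (hquot F' hb' _).2]
  · refine tendsto_Lp_of_smul (fun j => ham _ (hF j).measurable)
      (fun j => Eventually.of_forall fun x => (hquot _ (hb j) (ψ x).re).1)
      (Eventually.of_forall fun x => (hlim _).div_const _)
      (tendsto_const_nhds (x := L.compLp ψ)) (fun j => ?_) hY'
    filter_upwards [hY j, hLψ] with x h1 h2
    rw [h1, h2, (hquot _ (hb j) _).2]

namespace DiffusionData

variable {n : ℕ} {D : DiffusionData n}

/-- The form domain is invariant under truncations of the real part. -/
lemma Admissible.exists_truncation (hD : D.Admissible) {U : D.FormSpace} {φ : D.LL 2}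
    (h : (U, φ) ∈ D.graphJ) {k : ℝ} (hk : 0 ≤ k) :
    ∃ (V : D.FormSpace) (χ : D.LL 2), (V, χ) ∈ D.graphJ ∧
      χ =ᵐ[D.total] (fun x => (rePart k φ x : ℂ)) ∧
      V.2.1 =ᵐ[weighted D.bulk D.wΩ]
        {x | k < (φ x).re}.indicator (fun x => reC (n + 1) (U.2.1 x)) ∧
      V.2.2.1 =ᵐ[weighted D.surfd D.wd]
        {x | k < (φ x).re}.indicator (fun x => reC (n + 1) (U.2.2.1 x)) ∧
      V.2.2.2 =ᵐ[weighted D.surfs D.ws]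
        {x | k < (φ x).re}.indicator (fun x => reC (n + 1) (U.2.2.2 x)) := by
  obtain ⟨F, hF⟩ := exists_smooth_truncation hk
  have hFc : ∀ j, ContDiff ℝ ∞ (F j) := fun j => ((hF 0).1 j).1
  have hF0 : ∀ j, F j 0 = 0 := fun j => ((hF 0).1 j).2.1
  have hFd : ∀ j s, |deriv (F j) s| ≤ 1 := fun j s => ((hF s).1 j).2.2
  have hFb := fun j => abs_le_abs_of_abs_deriv_le_one (hFc j) (hF0 j) (hFd j)
  have hcd : ∀ j, Continuous (deriv (F j)) := fun j => (hFc j).continuous_deriv (by simp)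
  choose V χ hVG hχ hV0 hV1 hV2 hV3 using
    fun j => hD.exists_comp_re_mem_graphJ h (hFc j) (hF0 j) (hFd j)
  obtain ⟨χ', hχ', hχlim⟩ := exists_tendsto_comp_re (fun j => (hFc j).continuous) hFb
    (fun s => (hF s).2.2) hχ
  obtain ⟨V0', -, hV0lim⟩ := exists_tendsto_comp_re (fun j => (hFc j).continuous) hFb
    (fun s => (hF s).2.2) hV0
  set a' : RSpace (n + 1) → ℝ := fun x => (Ioi k).indicator 1 (φ x).re with ha'
  have ham : ∀ j, AEStronglyMeasurable (fun x => deriv (F j) (φ x).re) D.total := fun j =>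
    ((hcd j).comp Complex.continuous_re).comp_aestronglyMeasurable (Lp.aestronglyMeasurable φ)
  have hlim : ∀ᵐ x ∂D.total, Tendsto (fun j => deriv (F j) (φ x).re) atTop (𝓝 (a' x)) :=
    Eventually.of_forall fun x => (hF _).2.1
  have ha'm : AEStronglyMeasurable a' D.total := aestronglyMeasurable_of_tendsto_ae atTop ham hlim
  have ha'b : ∀ᵐ x ∂D.total, |a' x| ≤ 1 := Eventually.of_forall fun x => by
    by_cases hx : (φ x).re ∈ Ioi k <;> simp [ha', hx]
  have hind : ∀ X : RSpace (n + 1) → CSpace (n + 1), (fun x => (a' x : ℂ) • X x) =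
      {x | k < (φ x).re}.indicator X := fun X => by
    ext1 x
    by_cases hx : k < (φ x).re
    · rw [indicator_of_mem (show x ∈ {x | k < (φ x).re} from hx), ha']
      simp [indicator_of_mem (show (φ x).re ∈ Ioi k from hx)]
    · rw [indicator_of_notMem (show x ∉ {x | k < (φ x).re} from hx), ha']
      simp [indicator_of_notMem (show (φ x).re ∉ Ioi k from hx)]
  obtain ⟨V1', hV1'⟩ := exists_Lp_smul_reC hD.weighted_bulk_ac ha'm ha'b U.2.1
  obtain ⟨V2', hV2'⟩ := exists_Lp_smul_reC weighted_surfd_ac ha'm ha'b U.2.2.1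
  obtain ⟨V3', hV3'⟩ := exists_Lp_smul_reC weighted_surfs_ac ha'm ha'b U.2.2.2
  refine ⟨(V0', V1', V2', V3'), χ', ?_, hχ', hV1'.trans (EventuallyEq.of_eq (hind _)),
    hV2'.trans (EventuallyEq.of_eq (hind _)), hV3'.trans (EventuallyEq.of_eq (hind _))⟩
  refine isClosed_closure.mem_of_tendsto (f := fun j => (V j, χ j)) (b := atTop) ?_
    (Eventually.of_forall hVG)
  refine Tendsto.prodMk_nhds (Tendsto.prodMk_nhds (mx := fun j => (V j).1) (my := fun j => (V j).2)
    hV0lim (Tendsto.prodMk_nhds (mx := fun j => (V j).2.1) (my := fun j => (V j).2.2) ?_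
    (Tendsto.prodMk_nhds (mx := fun j => (V j).2.2.1) (my := fun j => (V j).2.2.2) ?_ ?_))) hχlim
  · exact tendsto_truncated_gradient hD.weighted_bulk_ac ham (fun j x => hFd j _) hlim
      (tendsto_const_nhds (x := U.2.1)) hV1 hV1'
  · exact tendsto_truncated_gradient weighted_surfd_ac ham (fun j x => hFd j _) hlim
      (tendsto_const_nhds (x := U.2.2.1)) hV2 hV2'
  · exact tendsto_truncated_gradient weighted_surfs_ac ham (fun j x => hFd j _) hlim
      (tendsto_const_nhds (x := U.2.2.2)) hV3 hV3'

end DiffusionData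

/-! ### The graph of `J` and the representation of the form -/

section Cgrad

variable {m : ℕ} {u v : RSpace m → ℂ}

lemma cgrad_add (hu : Differentiable ℝ u) (hv : Differentiable ℝ v) (x : RSpace m) :
    cgrad (u + v) x = cgrad u x + cgrad v x := by
  ext i
  simp [cgrad, fderiv_add (hu x) (hv x)]

lemma cgrad_const_smul (c : ℂ) (hu : Differentiable ℝ u) (x : RSpace m) :
    cgrad (c • u) x = c • cgrad u x := by
  ext i
  simp [cgrad, fderiv_const_smul (hu x) c]

end Cgrad

namespace DiffusionData

variable {n : ℕ} {D : DiffusionData n}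

lemma TestFun.zero_mem : (0 : RSpace (n + 1) → ℂ) ∈ D.TestFun :=
  ⟨contDiff_const, HasCompactSupport.zero, by
    rw [tsupport_eq_empty_iff.2 rfl]
    exact Set.empty_disjoint _⟩

lemma TestFun.add_mem {u v : RSpace (n + 1) → ℂ} (hu : u ∈ D.TestFun) (hv : v ∈ D.TestFun) :
    u + v ∈ D.TestFun := by
  refine ⟨hu.1.add hv.1, hu.2.1.add hv.2.1, ?_⟩
  refine Set.disjoint_of_subset_left (closure_mono (Function.support_add u v)) ?_
  rw [closure_union]
  exact Disjoint.union_left hu.2.2 hv.2.2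

lemma TestFun.smul_mem (c : ℂ) {u : RSpace (n + 1) → ℂ} (hu : u ∈ D.TestFun) :
    c • u ∈ D.TestFun := by
  have hsub : Function.support (c • u) ⊆ Function.support u := Function.support_const_smul_subset c u
  exact ⟨contDiff_const.smul hu.1, hu.2.1.mono hsub, hu.2.2.mono_left (closure_mono hsub)⟩

lemma Represents.add {u v : RSpace (n + 1) → ℂ} {U V : D.FormSpace} (hu : Differentiable ℝ u)
    (hv : Differentiable ℝ v) (hU : D.Represents u U) (hV : D.Represents v V) :
    D.Represents (u + v) (U + V) := by
  rw [represents_iff (hu.add hv)]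
  rw [represents_iff hu] at hU
  rw [represents_iff hv] at hV
  refine ⟨?_, ?_, ?_, ?_⟩
  · filter_upwards [Lp.coeFn_add U.1 V.1, hU.1, hV.1] with x h1 h2 h3
    exact h1.trans (by rw [Pi.add_apply, h2, h3]; rfl)
  · filter_upwards [Lp.coeFn_add U.2.1 V.2.1, hU.2.1, hV.2.1] with x h1 h2 h3
    exact h1.trans (by rw [Pi.add_apply, h2, h3, cgrad_add hu hv, rmul_add])
  · filter_upwards [Lp.coeFn_add U.2.2.1 V.2.2.1, hU.2.2.1, hV.2.2.1] with x h1 h2 h3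
    exact h1.trans (by rw [Pi.add_apply, h2, h3, cgrad_add hu hv, rmul_add])
  · filter_upwards [Lp.coeFn_add U.2.2.2 V.2.2.2, hU.2.2.2, hV.2.2.2] with x h1 h2 h3
    exact h1.trans (by rw [Pi.add_apply, h2, h3, cgrad_add hu hv, rmul_add])

lemma Represents.smul (c : ℂ) {u : RSpace (n + 1) → ℂ} {U : D.FormSpace}
    (hu : Differentiable ℝ u) (hU : D.Represents u U) : D.Represents (c • u) (c • U) := by
  rw [represents_iff (hu.const_smul c)]
  rw [represents_iff hu] at hU
  refine ⟨?_, ?_, ?_, ?_⟩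
  · filter_upwards [Lp.coeFn_smul c U.1, hU.1] with x h1 h2
    exact h1.trans (by rw [Pi.smul_apply, h2]; rfl)
  · filter_upwards [Lp.coeFn_smul c U.2.1, hU.2.1] with x h1 h2
    exact h1.trans (by rw [Pi.smul_apply, h2, cgrad_const_smul c hu, rmul_smul])
  · filter_upwards [Lp.coeFn_smul c U.2.2.1, hU.2.2.1] with x h1 h2
    exact h1.trans (by rw [Pi.smul_apply, h2, cgrad_const_smul c hu, rmul_smul])
  · filter_upwards [Lp.coeFn_smul c U.2.2.2, hU.2.2.2] with x h1 h2
    exact h1.trans (by rw [Pi.smul_apply, h2, cgrad_const_smul c hu, rmul_smul])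

lemma Represents.zero : D.Represents 0 (0 : D.FormSpace) := by
  refine (represents_iff (u := 0) (differentiable_const (0 : ℂ)) _).2 ?_
  have h : ∀ (M : Matrix (Fin (n + 1)) (Fin (n + 1)) ℝ) (x : RSpace (n + 1)),
      rmul M (cgrad 0 x) = 0 := fun M x => by
    have : cgrad (0 : RSpace (n + 1) → ℂ) x = 0 := by
      ext i; simp [cgrad]
    rw [this]
    ext i; simp [rmul_apply]
  simp only [h]
  exact ⟨Lp.coeFn_zero _ _ _, Lp.coeFn_zero _ _ _, Lp.coeFn_zero _ _ _, Lp.coeFn_zero _ _ _⟩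

/-- The pairs `(U, J U)` for test functions. -/
noncomputable def testGraph (D : DiffusionData n) : Submodule ℂ (D.FormSpace × D.LL 2) where
  carrier := {z | ∃ u ∈ D.TestFun, D.Represents u z.1 ∧ z.2 =ᵐ[D.total] u}
  zero_mem' := ⟨0, TestFun.zero_mem, Represents.zero, Lp.coeFn_zero _ _ _⟩
  add_mem' := by
    rintro z z' ⟨u, hu, h1, h2⟩ ⟨v, hv, h3, h4⟩
    refine ⟨u + v, TestFun.add_mem hu hv, Represents.add (hu.1.differentiable (by simp))
      (hv.1.differentiable (by simp)) h1 h3, ?_⟩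
    filter_upwards [Lp.coeFn_add z.2 z'.2, h2, h4] with x h5 h6 h7
    exact h5.trans (by rw [Pi.add_apply, h6, h7]; rfl)
  smul_mem' := by
    rintro c z ⟨u, hu, h1, h2⟩
    refine ⟨c • u, TestFun.smul_mem c hu, Represents.smul c (hu.1.differentiable (by simp)) h1, ?_⟩
    filter_upwards [Lp.coeFn_smul c z.2, h2] with x h5 h6
    exact h5.trans (by rw [Pi.smul_apply, h6]; rfl)

/-- The graph of `J` as a closed subspace. -/
noncomputable def graphSub (D : DiffusionData n) : Submodule ℂ (D.FormSpace × D.LL 2) :=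
  D.testGraph.topologicalClosure

lemma isClosed_graphSub : IsClosed (D.graphSub : Set (D.FormSpace × D.LL 2)) :=
  Submodule.isClosed_topologicalClosure _

lemma mem_formDom_of_mem_graphJ {z : D.FormSpace × D.LL 2} (h : z ∈ D.graphJ) :
    z.1 ∈ D.formDom := by
  have := image_closure_subset_closure_image (continuous_fst (X := D.FormSpace) (Y := D.LL 2))
    (mem_image_of_mem Prod.fst h)
  refine closure_mono ?_ this
  rintro _ ⟨z, ⟨u, hu, h1, -⟩, rfl⟩
  exact ⟨u, hu, h1⟩

lemma mem_graphJ_of_isClosed {p : D.FormSpace × D.LL 2 → Prop} (hp : IsClosed {z | p z})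
    (h : ∀ u ∈ D.TestFun, ∀ z : D.FormSpace × D.LL 2, D.Represents u z.1 → z.2 =ᵐ[D.total] u → p z)
    {z : D.FormSpace × D.LL 2} (hz : z ∈ D.graphJ) : p z := by
  refine closure_minimal (t := {z | p z}) ?_ hp hz
  rintro z ⟨u, hu, h1, h2⟩
  exact h u hu z h1 h2

/-- The bulk measure is a part of the total measure. So the component in L²(Ω) is controlled by J U,
and coercivity only has to supply the gradients. -/
lemma Admissible.norm_fst_le (hD : D.Admissible) {z : D.FormSpace × D.LL 2} (hz : z ∈ D.graphJ) :
    ‖z.1.1‖ ≤ ‖z.2‖ := by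
  refine mem_graphJ_of_isClosed (p := fun z => ‖z.1.1‖ ≤ ‖z.2‖)
    (isClosed_le (by fun_prop) (by fun_prop)) (fun u _ z h1 h2 => ?_) hz
  rw [Lp.norm_def, Lp.norm_def, eLpNorm_congr_ae h1.1]
  refine ENNReal.toReal_mono (Lp.eLpNorm_ne_top _) ?_
  rw [eLpNorm_congr_ae h2]
  exact eLpNorm_mono_measure _ hD.bulk_le_total

/-- The form is represented by bounded operators, it is coercive with respect to the gradients,
and it is compatible with truncations. -/
theorem Admissible.exists_formOperator (hD : D.Admissible) :
    ∃ (T₁ : Lp (CSpace (n + 1)) 2 (weighted D.bulk D.wΩ) →L[ℂ]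
        Lp (CSpace (n + 1)) 2 (weighted D.bulk D.wΩ))
      (T₂ : Lp (CSpace (n + 1)) 2 (weighted D.surfd D.wd) →L[ℂ]
        Lp (CSpace (n + 1)) 2 (weighted D.surfd D.wd))
      (T₃ : Lp (CSpace (n + 1)) 2 (weighted D.surfs D.ws) →L[ℂ]
        Lp (CSpace (n + 1)) 2 (weighted D.surfs D.ws)) (c : ℝ), 0 < c ∧
      (∀ U V, D.form U V = inner ℂ V.2.1 (T₁ U.2.1) + inner ℂ V.2.2.1 (T₂ U.2.2.1) +
        inner ℂ V.2.2.2 (T₃ U.2.2.2)) ∧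
      (∀ U φ, (U, φ) ∈ D.graphJ →
        c * (‖U.2.1‖ ^ 2 + ‖U.2.2.1‖ ^ 2 + ‖U.2.2.2‖ ^ 2) ≤ (D.form U U).re) ∧
      ∀ U φ, (U, φ) ∈ D.graphJ → ∀ (s : Set (RSpace (n + 1))) (V : D.FormSpace),
        V.2.1 =ᵐ[weighted D.bulk D.wΩ] s.indicator (fun x => reC (n + 1) (U.2.1 x)) →
        V.2.2.1 =ᵐ[weighted D.surfd D.wd] s.indicator (fun x => reC (n + 1) (U.2.2.1 x)) →
        V.2.2.2 =ᵐ[weighted D.surfs D.ws] s.indicator (fun x => reC (n + 1) (U.2.2.2 x)) →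
        c * (‖V.2.1‖ ^ 2 + ‖V.2.2.1‖ ^ 2 + ‖V.2.2.2‖ ^ 2) ≤ (D.form U V).re := by
  obtain ⟨T₁, Q₁, c₁, hc₁, hQ₁, hT₁, hself₁, htr₁⟩ := hD.formPart_Ω.exists_operator
  obtain ⟨T₂, Q₂, c₂, hc₂, hQ₂, hT₂, hself₂, htr₂⟩ := hD.formPart_Γd.exists_operator
  obtain ⟨T₃, Q₃, c₃, hc₃, hQ₃, hT₃, hself₃, htr₃⟩ := hD.formPart_Sig.exists_operator
  have hform : ∀ U V, D.form U V = inner ℂ V.2.1 (T₁ U.2.1) + inner ℂ V.2.2.1 (T₂ U.2.2.1) +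
      inner ℂ V.2.2.2 (T₃ U.2.2.2) := fun U V => by rw [form, hT₁, hT₂, hT₃]
  -- Gradients of test functions are fixed by the projections, and this closed condition extends to
  -- the whole graph. It is needed because the coefficients are bounded below on tangential vectors
  -- only.
  have hfix : ∀ z : D.FormSpace × D.LL 2, z ∈ D.graphJ →
      Q₁ z.1.2.1 = z.1.2.1 ∧ Q₂ z.1.2.2.1 = z.1.2.2.1 ∧ Q₃ z.1.2.2.2 = z.1.2.2.2 := fun z hz => by
    refine mem_graphJ_of_isClosed (p := fun z : D.FormSpace × D.LL 2 => Q₁ z.1.2.1 = z.1.2.1 ∧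
      Q₂ z.1.2.2.1 = z.1.2.2.1 ∧ Q₃ z.1.2.2.2 = z.1.2.2.2)
      ((isClosed_eq (by fun_prop) (by fun_prop)).inter ((isClosed_eq (by fun_prop)
        (by fun_prop)).inter (isClosed_eq (by fun_prop) (by fun_prop)))) (fun u hu z h1 _ => ?_) hz
    obtain ⟨-, h2, h3, h4⟩ := (represents_iff (hu.1.differentiable (by simp)) _).1 h1
    refine ⟨Lp.ext ?_, Lp.ext ?_, Lp.ext ?_⟩
    · filter_upwards [hQ₁ z.1.2.1, h2] with x h5 h6
      rw [h5, h6, rmul_rmul, Matrix.one_mul]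
    · filter_upwards [hQ₂ z.1.2.2.1, h3] with x h5 h6
      rw [h5, h6, rmul_rmul, surfProj_mul_self]
    · filter_upwards [hQ₃ z.1.2.2.2, h4] with x h5 h6
      rw [h5, h6, rmul_rmul, surfProj_mul_self]
  set c := min c₁ (min c₂ c₃)
  have hcc₁ : c ≤ c₁ := min_le_left _ _
  have hcc₂ : c ≤ c₂ := (min_le_right _ _).trans (min_le_left _ _)
  have hcc₃ : c ≤ c₃ := (min_le_right _ _).trans (min_le_right _ _)
  have hsum : ∀ a b d A B E : ℝ, c₁ * a ^ 2 ≤ A → c₂ * b ^ 2 ≤ B → c₃ * d ^ 2 ≤ E →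
      c * (a ^ 2 + b ^ 2 + d ^ 2) ≤ A + B + E := fun a b d A B E h1 h2 h3 => by
    have h4 := mul_le_mul_of_nonneg_right hcc₁ (sq_nonneg a)
    have h5 := mul_le_mul_of_nonneg_right hcc₂ (sq_nonneg b)
    have h6 := mul_le_mul_of_nonneg_right hcc₃ (sq_nonneg d)
    linarith
  refine ⟨T₁, T₂, T₃, c, lt_min hc₁ (lt_min hc₂ hc₃), hform, fun U φ h => ?_,
    fun U φ h s V h1 h2 h3 => ?_⟩
  · obtain ⟨h1, h2, h3⟩ := hfix _ h
    rw [hform, Complex.add_re, Complex.add_re]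
    exact hsum _ _ _ _ _ _ (hself₁ _ h1) (hself₂ _ h2) (hself₃ _ h3)
  · obtain ⟨h4, h5, h6⟩ := hfix _ h
    rw [hform, Complex.add_re, Complex.add_re]
    exact hsum _ _ _ _ _ _ (htr₁ _ h4 s _ h1) (htr₂ _ h5 s _ h2) (htr₃ _ h6 s _ h3)

end DiffusionData

/-! ### Lax–Milgram and the m-accretivity of `A_2` -/

section HilbertModels

/-- Normed spaces which are isomorphic to a Hilbert space. -/
def IsHilbertable (Y : Type) [NormedAddCommGroup Y] [NormedSpace ℂ Y] : Prop :=
  ∃ (K : Type) (_ : NormedAddCommGroup K) (_ : InnerProductSpace ℂ K) (_ : CompleteSpace K),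
    Nonempty (K ≃L[ℂ] Y)

lemma isHilbertable_of_inner (K : Type) [NormedAddCommGroup K] [InnerProductSpace ℂ K]
    [CompleteSpace K] : IsHilbertable K :=
  ⟨K, inferInstance, inferInstance, inferInstance, ⟨ContinuousLinearEquiv.refl ℂ K⟩⟩

lemma IsHilbertable.prod {X Y : Type} [NormedAddCommGroup X] [NormedSpace ℂ X]
    [NormedAddCommGroup Y] [NormedSpace ℂ Y] (hX : IsHilbertable X) (hY : IsHilbertable Y) :
    IsHilbertable (X × Y) := by
  obtain ⟨K, _, _, _, ⟨e⟩⟩ := hX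
  obtain ⟨L, _, _, _, ⟨f⟩⟩ := hY
  exact ⟨WithLp 2 (K × L), inferInstance, inferInstance, inferInstance,
    ⟨(WithLp.prodContinuousLinearEquiv 2 ℂ K L).trans (e.prodCongr f)⟩⟩

/-- Products carry the maximum norm, so G is only isomorphic to a Hilbert space. The model K makes
adjoints, and with them Lax–Milgram, available. -/
lemma IsHilbertable.exists_model {Y : Type} [NormedAddCommGroup Y] [NormedSpace ℂ Y]
    (hY : IsHilbertable Y) {G : Submodule ℂ Y} (hG : IsClosed (G : Set Y)) :
    ∃ (K : Type) (_ : NormedAddCommGroup K) (_ : InnerProductSpace ℂ K) (_ : CompleteSpace K)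
      (e : K →L[ℂ] Y) (C : ℝ), 0 < C ∧ (∀ z, e z ∈ G) ∧ (∀ y ∈ G, ∃ z, e z = y) ∧
        ∀ z, ‖z‖ ≤ C * ‖e z‖ := by
  obtain ⟨K, _, _, _, ⟨e⟩⟩ := hY
  let G' : Submodule ℂ K := G.comap (e : K →L[ℂ] Y).toLinearMap
  have hG' : IsClosed (G' : Set K) := hG.preimage e.continuous
  have : CompleteSpace G' := hG'.completeSpace_coe
  refine ⟨G', inferInstance, inferInstance, inferInstance, (e : K →L[ℂ] Y).comp G'.subtypeL,
    ‖(e.symm : Y →L[ℂ] K)‖ + 1, by positivity, fun z => z.2, fun y hy => ?_, fun z => ?_⟩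
  · exact ⟨⟨e.symm y, by simpa [G'] using hy⟩, by simp⟩
  · have h := (e.symm : Y →L[ℂ] K).le_opNorm (e z)
    simp only [ContinuousLinearEquiv.coe_coe, ContinuousLinearEquiv.symm_apply_apply] at h
    refine (show ‖z‖ ≤ _ from h).trans ?_
    change _ ≤ (‖(e.symm : Y →L[ℂ] K)‖ + 1) * ‖e z‖
    gcongr
    linarith

/-- The Lax–Milgram lemma, for a form which is coercive relative to `J`. -/
lemma exists_solution_of_coercive {K L : Type*} [NormedAddCommGroup K] [InnerProductSpace ℂ K]
    [CompleteSpace K] [NormedAddCommGroup L] [InnerProductSpace ℂ L] [CompleteSpace L]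
    (S : K →L[ℂ] K) (J : K →L[ℂ] L) {l c : ℝ} (hc : 0 < c)
    (h : ∀ z, c * ‖z‖ ^ 2 ≤ (inner ℂ z (S z)).re + l * ‖J z‖ ^ 2) (f : L) :
    ∃ z, ∀ v, inner ℂ v (S z) + l * inner ℂ (J v) (J z) = inner ℂ (J v) f := by
  let M : K →L[ℂ] K := S + (l : ℂ) • (ContinuousLinearMap.adjoint J).comp J
  have hM : ∀ v z, inner ℂ v (M z) = inner ℂ v (S z) + l * inner ℂ (J v) (J z) := fun v z => by
    simp only [M, add_apply, smul_apply,
      ContinuousLinearMap.comp_apply, inner_add_right, inner_smul_right,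
      ContinuousLinearMap.adjoint_inner_right]
  have hu : IsUnit M := by
    refine ContinuousLinearMap.isUnit_of_forall_le_norm_inner_map M (c := c.toNNReal)
      (by simpa using hc) fun x => ?_
    rw [Real.coe_toNNReal _ hc.le, norm_inner_symm, mul_comm]
    refine (h x).trans ((le_of_eq ?_).trans (Complex.re_le_norm _))
    rw [hM, Complex.add_re, Complex.re_ofReal_mul, re_inner_self]
  obtain ⟨N, hN⟩ := hu.exists_right_inv
  refine ⟨N (ContinuousLinearMap.adjoint J f), fun v => ?_⟩
  rw [← hM, ← mul_apply_eq_comp, hN, one_apply_eq_self,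
    ContinuousLinearMap.adjoint_inner_right]

/-- The maximum norm on the graph of J, where the component a in L²(Ω) is dominated by the component
e in 𝕃². -/
lemma max_sq_le_add {a b c d e : ℝ} (ha : 0 ≤ a)
    (hae : a ≤ e) : max (max a (max b (max c d))) e ^ 2 ≤ b ^ 2 + c ^ 2 + d ^ 2 + e ^ 2 := by
  have he := ha.trans hae
  rw [← Real.le_sqrt (he.trans (le_max_right _ _)) (by positivity)]
  refine max_le (max_le ?_ (max_le ?_ (max_le ?_ ?_))) ?_ <;>
    exact Real.le_sqrt_of_sq_le (by nlinarith)

lemma MAccretive.of_complex {H : Type*} [NormedAddCommGroup H] [InnerProductSpace ℂ H]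
    {A : Submodule ℂ (H × H)} (h1 : ∀ z ∈ A, 0 ≤ (inner ℂ z.1 z.2).re)
    (h2 : ∀ l : ℝ, 0 < l → ∀ f : H, ∃ φ : H, (φ, f - (l : ℂ) • φ) ∈ A)
    (h3 : Dense {φ : H | ∃ ψ, (φ, ψ) ∈ A}) : MAccretive A :=
  ⟨h1, fun l hl f => by
    obtain ⟨φ, hφ⟩ := h2 l hl f
    exact ⟨φ, by rwa [← Complex.coe_smul]⟩, h3⟩

end HilbertModels

namespace DiffusionData

variable {n : ℕ} {D : DiffusionData n}

lemma isHilbertable_formSpace : IsHilbertable (D.FormSpace × D.LL 2) :=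
  ((isHilbertable_of_inner _).prod ((isHilbertable_of_inner _).prod
    ((isHilbertable_of_inner _).prod (isHilbertable_of_inner _)))).prod (isHilbertable_of_inner _)

namespace Admissible

variable (hD : D.Admissible)
include hD

lemma form_add_left (U U' V : D.FormSpace) : D.form (U + U') V = D.form U V + D.form U' V := by
  obtain ⟨T₁, T₂, T₃, c, hc, hform, -, -⟩ := hD.exists_formOperator
  simp only [hform, Prod.snd_add, Prod.fst_add, map_add, inner_add_right]
  ring

lemma form_smul_left (a : ℂ) (U V : D.FormSpace) : D.form (a • U) V = a * D.form U V := by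
  obtain ⟨T₁, T₂, T₃, c, hc, hform, -, -⟩ := hD.exists_formOperator
  simp only [hform, Prod.smul_snd, Prod.smul_fst, map_smul, inner_smul_right]
  ring

omit hD in
lemma mem_A2_iff {z : D.LL 2 × D.LL 2} : z ∈ D.A2 ↔ ∃ U, (U, z.1) ∈ D.graphJ ∧
    ∀ V χ, (V, χ) ∈ D.graphJ → inner ℂ χ z.2 = D.form U V :=
  ⟨fun ⟨U, _, h1, h2⟩ => ⟨U, h1, fun V χ h => h2 V (mem_formDom_of_mem_graphJ h) χ h⟩,
    fun ⟨U, h1, h2⟩ => ⟨U, mem_formDom_of_mem_graphJ h1, h1, fun V _ χ h => h2 V χ h⟩⟩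

/-- The graph of `A_2` as a subspace. -/
noncomputable def A2Sub : Submodule ℂ (D.LL 2 × D.LL 2) where
  carrier := D.A2
  zero_mem' := by
    refine mem_A2_iff.2 ⟨0, D.graphSub.zero_mem, fun V χ _ => ?_⟩
    have := hD.form_smul_left 0 0 V
    rw [zero_smul, zero_mul] at this
    rw [this]
    exact inner_zero_right _
  add_mem' := by
    intro z z' hz hz'
    obtain ⟨U, h1, h2⟩ := mem_A2_iff.1 hz
    obtain ⟨U', h3, h4⟩ := mem_A2_iff.1 hz'
    refine mem_A2_iff.2 ⟨U + U', D.graphSub.add_mem h1 h3, fun V χ h => ?_⟩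
    rw [hD.form_add_left, ← h2 V χ h, ← h4 V χ h]
    exact inner_add_right _ _ _
  smul_mem' := by
    intro a z hz
    obtain ⟨U, h1, h2⟩ := mem_A2_iff.1 hz
    refine mem_A2_iff.2 ⟨a • U, D.graphSub.smul_mem a h1, fun V χ h => ?_⟩
    rw [hD.form_smul_left, ← h2 V χ h]
    exact inner_smul_right _ _ _

lemma re_form_self_nonneg {U : D.FormSpace} {φ : D.LL 2} (h : (U, φ) ∈ D.graphJ) :
    0 ≤ (D.form U U).re := by
  obtain ⟨T₁, T₂, T₃, c, hc, hform, hself, -⟩ := hD.exists_formOperator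
  exact le_trans (by positivity) (hself U φ h)

lemma accretive_A2 {z : D.LL 2 × D.LL 2} (hz : z ∈ D.A2) : 0 ≤ (inner ℂ z.1 z.2).re := by
  obtain ⟨U, h1, h2⟩ := mem_A2_iff.1 hz
  rw [h2 U z.1 h1]
  exact hD.re_form_self_nonneg h1

lemma norm_sq_le {z : D.FormSpace × D.LL 2} (hz : z ∈ D.graphJ) : ‖z‖ ^ 2 ≤
    ‖z.1.2.1‖ ^ 2 + ‖z.1.2.2.1‖ ^ 2 + ‖z.1.2.2.2‖ ^ 2 + ‖z.2‖ ^ 2 := by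
  exact max_sq_le_add (norm_nonneg _)
    (hD.norm_fst_le hz)

/-- The range condition for `A_2`. -/
lemma exists_mem_A2 {l : ℝ} (hl : 0 < l) (f : D.LL 2) : ∃ φ : D.LL 2, (φ, f - (l : ℂ) • φ) ∈ D.A2 := by
  obtain ⟨T₁, T₂, T₃, c, hc, hform, hself, -⟩ := hD.exists_formOperator
  -- Lax–Milgram is applied on the graph of J: there the gradients and the component in 𝕃² control
  -- the norm, and neither single-valuedness nor injectivity of J is required.
  obtain ⟨K, _, _, _, e, C, hC, heG, heG', hCe⟩ := (isHilbertable_formSpace (D := D)).exists_model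
    (isClosed_graphSub (D := D))
  let F := ContinuousLinearMap.fst ℂ D.FormSpace (D.LL 2)
  let p := (ContinuousLinearMap.snd ℂ _ _).comp (F.comp e)
  let p₁ := (ContinuousLinearMap.fst ℂ _ _).comp p
  let p₂ := (ContinuousLinearMap.fst ℂ _ _).comp ((ContinuousLinearMap.snd ℂ _ _).comp p)
  let p₃ := (ContinuousLinearMap.snd ℂ _ _).comp ((ContinuousLinearMap.snd ℂ _ _).comp p)
  let J := (ContinuousLinearMap.snd ℂ D.FormSpace (D.LL 2)).comp e
  let S : K →L[ℂ] K := (ContinuousLinearMap.adjoint p₁).comp (T₁.comp p₁) +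
    (ContinuousLinearMap.adjoint p₂).comp (T₂.comp p₂) +
    (ContinuousLinearMap.adjoint p₃).comp (T₃.comp p₃)
  have hS : ∀ v z, inner ℂ v (S z) = D.form (e z).1 (e v).1 := fun v z => by
    simp only [S, hform, add_apply, ContinuousLinearMap.comp_apply,
      inner_add_right, ContinuousLinearMap.adjoint_inner_right]
    rfl
  obtain ⟨z, hz⟩ := exists_solution_of_coercive S J (l := l) (c := min c l / C ^ 2)
    (div_pos (lt_min hc hl) (by positivity)) (fun z => by
      rw [hS]
      have h1 := hself (e z).1 (e z).2 (heG z)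
      have h2 := hD.norm_sq_le (heG z)
      have h3 : ‖z‖ ^ 2 ≤ C ^ 2 * ‖e z‖ ^ 2 := by
        rw [← mul_pow]; exact pow_le_pow_left₀ (norm_nonneg _) (hCe z) 2
      have h4 : min c l / C ^ 2 * ‖z‖ ^ 2 ≤ min c l * ‖e z‖ ^ 2 := by
        rw [div_mul_eq_mul_div, div_le_iff₀ (by positivity), mul_assoc]
        exact mul_le_mul_of_nonneg_left (h3.trans_eq (mul_comm _ _)) (lt_min hc hl).le
      refine h4.trans ((mul_le_mul_of_nonneg_left h2 (lt_min hc hl).le).trans ?_)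
      rw [mul_add]
      refine add_le_add ((mul_le_mul_of_nonneg_right (min_le_left _ _) (by positivity)).trans h1)
        (mul_le_mul_of_nonneg_right (min_le_right _ _) (by positivity))) f
  refine ⟨(e z).2, mem_A2_iff.2 ⟨(e z).1, heG z, fun V χ h => ?_⟩⟩
  obtain ⟨v, hv⟩ := heG' _ h
  have h1 := hz v
  rw [hS, hv, show J v = χ from congrArg Prod.snd hv] at h1
  refine (inner_sub_right χ f _).trans ?_
  rw [← h1, inner_smul_right]
  exact add_sub_cancel_right _ _

/-- The range of `J` is dense. -/
lemma eq_zero_of_forall_inner_eq_zero {f : D.LL 2}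
    (h : ∀ V χ, (V, χ) ∈ D.graphJ → inner ℂ χ f = 0) : f = 0 := by
  have := hD.isFiniteMeasure_total
  have hU : IsOpen D.ΓDᶜ := hD.isClosed_ΓD.isOpen_compl
  -- Smooth real functions with compact support off ΓD determine f there, and ΓD is a null set.
  have h1 : ∀ᵐ x ∂D.total, x ∈ D.ΓDᶜ → f x = 0 := by
    refine hU.ae_eq_zero_of_integral_contDiff_smul_eq_zero
      ((Lp_integrable (by norm_num) f).locallyIntegrable.locallyIntegrableOn _) fun g hg hgs hgU => ?_
    have hsub : Function.support (fun x => (g x : ℂ)) ⊆ Function.support g := fun x hx h0 => by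
      apply hx; simp [h0]
    have hu : (fun x => (g x : ℂ)) ∈ D.TestFun :=
      ⟨Complex.ofRealCLM.contDiff.comp hg, hgs.mono hsub,
        (Set.disjoint_left.2 fun x hx => hgU hx).mono_left (closure_mono hsub)⟩
    obtain ⟨z, hz1, hz2⟩ := hD.exists_represents hu
    have h2 := h z.1 z.2 (subset_closure ⟨_, hu, hz1, hz2⟩)
    rw [L2.inner_def] at h2
    rw [← h2]
    refine integral_congr_ae ?_
    filter_upwards [hz2] with x hx
    simp [hx, mul_comm]
  refine Lp.ext ?_
  filter_upwards [h1, hD.total_ΓD, Lp.coeFn_zero ℂ 2 D.total] with x h2 h3 h4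
  rw [h2 h3, h4]
  rfl

/-- Density of the domain: let f be orthogonal to it and solve (1 + A_2) φ = f. Then (φ, f) = 0, and
accretivity yields φ = 0, so (0, f) is in the graph through some U with J U = 0. Now t(U, U) = 0
kills the gradients of U, hence t(U, ·) = 0, and f is orthogonal to the dense range of J. -/
lemma mAccretive_A2 : MAccretive hD.A2Sub := by
  refine MAccretive.of_complex (fun z hz => hD.accretive_A2 hz)
    (fun l hl f => hD.exists_mem_A2 hl f) ?_
  let M : Submodule ℂ (D.LL 2) := hD.A2Sub.map (LinearMap.fst ℂ _ _)
  have hMset : {φ : D.LL 2 | ∃ ψ, (φ, ψ) ∈ hD.A2Sub} = (M : Set (D.LL 2)) := by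
    ext φ
    simp [M]
  rw [hMset, Submodule.dense_iff_topologicalClosure_eq_top, Submodule.topologicalClosure_eq_top_iff,
    Submodule.eq_bot_iff]
  intro f hf
  obtain ⟨φ, hφ⟩ := hD.exists_mem_A2 one_pos f
  have hφM : φ ∈ M := ⟨(φ, _), hφ, rfl⟩
  have h1 : inner ℂ φ f = 0 := Submodule.mem_orthogonal M f |>.1 hf φ hφM
  have h2 := hD.accretive_A2 hφ
  simp only [Complex.ofReal_one, one_smul] at h2 hφ
  rw [inner_sub_right, h1, zero_sub, Complex.neg_re, re_inner_self] at h2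
  have h3 : φ = 0 := by
    rw [← norm_eq_zero, ← sq_eq_zero_iff]
    exact le_antisymm (by linarith) (by positivity)
  subst h3
  rw [sub_zero] at hφ
  obtain ⟨U, hU, hUV⟩ := mem_A2_iff.1 hφ
  refine hD.eq_zero_of_forall_inner_eq_zero fun V χ hV => ?_
  rw [hUV V χ hV]
  obtain ⟨T₁, T₂, T₃, c, hc, hform, hself, -⟩ := hD.exists_formOperator
  have h4 := hself U 0 hU
  rw [← hUV U 0 hU, inner_zero_left, Complex.zero_re] at h4
  have h5 : ‖U.2.1‖ ^ 2 + ‖U.2.2.1‖ ^ 2 + ‖U.2.2.2‖ ^ 2 ≤ 0 :=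
    le_of_mul_le_mul_left (h4.trans_eq (mul_zero c).symm) hc
  have h6 := sq_nonneg ‖U.2.1‖
  have h7 := sq_nonneg ‖U.2.2.1‖
  have h8 := sq_nonneg ‖U.2.2.2‖
  have e1 : U.2.1 = 0 := norm_eq_zero.1 (sq_eq_zero_iff.1 (by linarith))
  have e2 : U.2.2.1 = 0 := norm_eq_zero.1 (sq_eq_zero_iff.1 (by linarith))
  have e3 : U.2.2.2 = 0 := norm_eq_zero.1 (sq_eq_zero_iff.1 (by linarith))
  rw [hform, e1, e2, e3]
  simp

end Admissible

end DiffusionData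

/-! ### Truncation accretivity and the Sobolev inequality for `A_2` -/

section RealParts

variable {α : Type*} [MeasurableSpace α] {m : Measure α}

lemma re_inner_of_ae_eq_ofReal {χ ψ : Lp ℂ 2 m} {v : α → ℝ} (h : χ =ᵐ[m] fun x => (v x : ℂ)) :
    (inner ℂ χ ψ).re = ∫ x, v x * (ψ x).re ∂m := by
  rw [L2.inner_def]
  refine (integral_re (L2.integrable_inner (𝕜 := ℂ) χ ψ)).symm.trans (integral_congr_ae ?_)
  filter_upwards [h] with x hx
  simp [hx, mul_comm]

lemma integrable_mul_re {χ ψ : Lp ℂ 2 m} {v : α → ℝ} (h : χ =ᵐ[m] fun x => (v x : ℂ)) :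
    Integrable (fun x => v x * (ψ x).re) m := by
  refine (L2.integrable_inner (𝕜 := ℂ) χ ψ).re.congr ?_
  filter_upwards [h] with x hx
  simp [hx, mul_comm]

end RealParts

lemma abs_scaled_sub_le (k s : ℝ) (j : ℕ) :
    |((j : ℝ) + 1) * (max (s - k) 0 - max (s - (k + 1 / ((j : ℝ) + 1))) 0)| ≤ 1 := by
  have hj : (0 : ℝ) < (j : ℝ) + 1 := by positivity
  have h := abs_max_sub_max_le_abs (s - k) (s - (k + 1 / ((j : ℝ) + 1))) 0
  rw [show s - k - (s - (k + 1 / ((j : ℝ) + 1))) = 1 / ((j : ℝ) + 1) by ring,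
    abs_of_pos (show 0 < 1 / ((j : ℝ) + 1) by positivity)] at h
  rw [abs_mul, abs_of_pos hj]
  calc _ ≤ ((j : ℝ) + 1) * (1 / ((j : ℝ) + 1)) := by gcongr
    _ = 1 := by field_simp

lemma tendsto_scaled_sub (k s : ℝ) :
    Tendsto (fun j : ℕ => ((j : ℝ) + 1) * (max (s - k) 0 - max (s - (k + 1 / ((j : ℝ) + 1))) 0))
      atTop (𝓝 ((Ioi k).indicator 1 s)) := by
  by_cases hs : s ∈ Ioi k
  · rw [indicator_of_mem hs]
    have hs' : k < s := hs
    refine tendsto_const_nhds.congr' ?_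
    filter_upwards [tendsto_one_div_add_atTop_nhds_zero_nat.eventually_le_const (sub_pos.2 hs')]
      with j hj
    have hj0 : (0 : ℝ) < (j : ℝ) + 1 := by positivity
    rw [max_eq_left (by linarith), max_eq_left (by linarith)]
    simp only [Pi.one_apply]
    field_simp
    ring
  · rw [indicator_of_notMem hs]
    have hs' : s ≤ k := not_lt.1 hs
    refine tendsto_const_nhds.congr fun j => ?_
    have hj0 : (0 : ℝ) < 1 / ((j : ℝ) + 1) := by positivity
    rw [max_eq_right (by linarith), max_eq_right (by linarith)]
    ring

/-- A bounded operator into `L²` which maps a closed subspace into `L^r` is bounded into `L^r`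
there, by the closed graph theorem. -/
lemma exists_eLpNorm_le_of_forall_memLp {α Y : Type*} [MeasurableSpace α] {m : Measure α}
    [IsFiniteMeasure m] [NormedAddCommGroup Y] [NormedSpace ℂ Y] [CompleteSpace Y]
    {G : Submodule ℂ Y} (hG : IsClosed (G : Set Y)) (J : Y →L[ℂ] Lp ℂ 2 m) {r : ℝ} (hr : 2 < r)
    (hJ : ∀ z ∈ G, MemLp (J z) (ENNReal.ofReal r) m) :
    ∃ N : ℝ, 0 ≤ N ∧ ∀ z ∈ G, eLpNorm (J z) (ENNReal.ofReal r) m ≤ ENNReal.ofReal (N * ‖z‖) := by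
  have hr2 : 2 ≤ ENNReal.ofReal r := by
    rw [← ENNReal.ofReal_ofNat]; exact ENNReal.ofReal_le_ofReal hr.le
  have : Fact (1 ≤ ENNReal.ofReal r) := ⟨le_trans (by norm_num) hr2⟩
  have : CompleteSpace G := hG.completeSpace_coe
  let L : G →ₗ[ℂ] Lp ℂ (ENNReal.ofReal r) m :=
    { toFun := fun z => (hJ z.1 z.2).toLp _
      map_add' := fun z w => by
        refine Lp.ext ?_
        filter_upwards [(hJ _ (z + w).2).coeFn_toLp, (hJ _ z.2).coeFn_toLp,
          (hJ _ w.2).coeFn_toLp, Lp.coeFn_add ((hJ _ z.2).toLp _) ((hJ _ w.2).toLp _),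
          Lp.coeFn_add (J z.1) (J w.1)] with x h1 h2 h3 h4 h5
        rw [h1, h4, Pi.add_apply, h2, h3, Submodule.coe_add, map_add, h5, Pi.add_apply]
      map_smul' := fun a z => by
        refine Lp.ext ?_
        filter_upwards [(hJ _ (a • z).2).coeFn_toLp, (hJ _ z.2).coeFn_toLp,
          Lp.coeFn_smul a ((hJ _ z.2).toLp _), Lp.coeFn_smul a (J z.1)] with x h1 h2 h3 h4
        rw [h1, RingHom.id_apply, h3, Pi.smul_apply, h2, Submodule.coe_smul, map_smul, h4,
          Pi.smul_apply] }
  have hL : ∀ z, L z =ᵐ[m] J z.1 := fun z => (hJ _ z.2).coeFn_toLp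
  have hL2 : ∀ z, LpToL2 m _ hr2 (L z) = J z.1 := fun z => LpToL2_eq_of_ae hr2 (hL z)
  have hcont : Continuous L := by
    refine L.continuous_of_seq_closed_graph fun u x y hu hy => ?_
    have h1 : Tendsto (fun k => J (u k).1) atTop (𝓝 (LpToL2 m _ hr2 y)) := by
      refine (((LpToL2 m _ hr2).continuous.tendsto y).comp hy).congr fun k => ?_
      exact hL2 (u k)
    have h2 : Tendsto (fun k => J (u k).1) atTop (𝓝 (J x.1)) :=
      ((J.continuous.comp continuous_subtype_val).tendsto x).comp hu
    have h3 := tendsto_nhds_unique h1 h2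
    refine Lp.ext ((LpToL2_coe hr2 y).symm.trans ?_)
    rw [h3]
    exact (hL x).symm
  let L' : G →L[ℂ] Lp ℂ (ENNReal.ofReal r) m := ⟨L, hcont⟩
  refine ⟨‖L'‖, L'.opNorm_nonneg, fun z hz => ?_⟩
  have h1 := L'.le_opNorm ⟨z, hz⟩
  rw [← eLpNorm_congr_ae (hL ⟨z, hz⟩), ← ENNReal.ofReal_toReal (Lp.eLpNorm_ne_top (L ⟨z, hz⟩)),
    ← Lp.norm_def]
  exact ENNReal.ofReal_le_ofReal h1

namespace DiffusionData

variable {n : ℕ} {D : DiffusionData n}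

namespace Admissible

variable (hD : D.Admissible)
include hD

/-- Test with the difference of the truncations at k and k' > k. Its gradients are those of Re U
restricted to {k < Re φ ≤ k'}, so the form is nonnegative. After division by k' - k the test
functions tend to the indicator of {Re φ > k} as k' decreases to k. -/
lemma isTruncationAccretive_A2 : IsTruncationAccretive hD.A2Sub := by
  have := hD.isFiniteMeasure_total
  obtain ⟨T₁, T₂, T₃, c, hc, hform, -, htr⟩ := hD.exists_formOperator
  rintro ⟨φ, ψ⟩ hz k hk
  obtain ⟨U, hU, hUV⟩ := mem_A2_iff.1 hz
  have hstep : ∀ k' : ℝ, k ≤ k' → 0 ≤ ∫ x, (rePart k φ x - rePart k' φ x) * (ψ x).re ∂D.total := by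
    intro k' hk'
    obtain ⟨V, χ, hV, hχ, hV1, hV2, hV3⟩ := hD.exists_truncation hU hk
    obtain ⟨V', χ', hV', hχ', hV1', hV2', hV3'⟩ := hD.exists_truncation hU (hk.trans hk')
    have hind : ∀ (X : RSpace (n + 1) → CSpace (n + 1)) (x : RSpace (n + 1)),
        {x | k < (φ x).re}.indicator X x - {x | k' < (φ x).re}.indicator X x =
        ({x | k < (φ x).re} \ {x | k' < (φ x).re}).indicator X x := fun X x => by
      have hsub : {x | k' < (φ x).re} ⊆ {x | k < (φ x).re} := fun x (hx : k' < _) => hk'.trans_lt hx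
      rw [indicator_sdiff hsub]
      rfl
    have h1 := htr U φ hU ({x | k < (φ x).re} \ {x | k' < (φ x).re}) (V - V')
      (by filter_upwards [hV1, hV1', Lp.coeFn_sub V.2.1 V'.2.1] with x h1 h2 h3
          exact h3.trans (by rw [Pi.sub_apply, h1, h2, hind]))
      (by filter_upwards [hV2, hV2', Lp.coeFn_sub V.2.2.1 V'.2.2.1] with x h1 h2 h3
          exact h3.trans (by rw [Pi.sub_apply, h1, h2, hind]))
      (by filter_upwards [hV3, hV3', Lp.coeFn_sub V.2.2.2 V'.2.2.2] with x h1 h2 h3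
          exact h3.trans (by rw [Pi.sub_apply, h1, h2, hind]))
    have h2 := hUV (V - V') (χ - χ') (D.graphSub.sub_mem hV hV')
    rw [← h2] at h1
    have h3 : 0 ≤ (inner ℂ (χ - χ') ψ).re := le_trans (by positivity) h1
    rwa [re_inner_of_ae_eq_ofReal (v := fun x => rePart k φ x - rePart k' φ x)] at h3
    filter_upwards [hχ, hχ', Lp.coeFn_sub χ χ'] with x h4 h5 h6
    rw [h6, Pi.sub_apply, h4, h5, Complex.ofReal_sub]
  have hψ : Integrable ψ D.total := Lp_integrable (by norm_num) ψ
  have hm := measurableSet_re_gt k φ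
  have hlim : Tendsto (fun j : ℕ => ∫ x, (((j : ℝ) + 1) *
      (rePart k φ x - rePart (k + 1 / ((j : ℝ) + 1)) φ x)) * (ψ x).re ∂D.total) atTop
      (𝓝 (∫ x, {x | k < (φ x).re}.indicator (fun x => (ψ x).re) x ∂D.total)) := by
    refine tendsto_integral_of_dominated_convergence (fun x => ‖ψ x‖) (fun j => ?_) hψ.norm
      (fun j => Eventually.of_forall fun x => ?_) (Eventually.of_forall fun x => ?_)
    · exact (((aestronglyMeasurable_rePart k φ).sub
        (aestronglyMeasurable_rePart _ φ)).const_mul _).mul hψ.re.1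
    · rw [norm_mul, Real.norm_eq_abs, Real.norm_eq_abs]
      refine (mul_le_mul (abs_scaled_sub_le k _ j) (Complex.abs_re_le_norm _) (abs_nonneg _)
        zero_le_one).trans (one_mul _).le
    · have h1 := (tendsto_scaled_sub k (φ x).re).mul_const (ψ x).re
      have h2 : (Ioi k).indicator 1 (φ x).re * (ψ x).re =
          {x | k < (φ x).re}.indicator (fun x => (ψ x).re) x := by
        by_cases hx : k < (φ x).re
        · rw [indicator_of_mem (show (φ x).re ∈ Ioi k from hx),
            indicator_of_mem (show x ∈ {x | k < (φ x).re} from hx)]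
          simp
        · rw [indicator_of_notMem (show (φ x).re ∉ Ioi k from hx),
            indicator_of_notMem (show x ∉ {x | k < (φ x).re} from hx), zero_mul]
      rw [h2] at h1
      exact h1
  rw [integral_indicator hm] at hlim
  refine ge_of_tendsto' hlim fun j => ?_
  have h1 := hstep (k + 1 / ((j : ℝ) + 1)) (le_add_of_nonneg_right (by positivity))
  simp only [mul_assoc]
  rw [integral_const_mul]
  positivity

/-- The Sobolev inequality for the range of `J`. -/
lemma exists_eLpNorm_le {r : ℝ} (hr : 2 < r)
    (hJ : ∀ U ∈ D.formDom, ∀ φ : D.LL 2, (U, φ) ∈ D.graphJ → MemLp φ (ENNReal.ofReal r) D.total) :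
    ∃ N : ℝ, 0 ≤ N ∧ ∀ z ∈ D.graphJ, eLpNorm z.2 (ENNReal.ofReal r) D.total ≤
      ENNReal.ofReal (N * ‖z‖) := by
  have := hD.isFiniteMeasure_total
  exact exists_eLpNorm_le_of_forall_memLp (isClosed_graphSub (D := D))
    (ContinuousLinearMap.snd ℂ D.FormSpace (D.LL 2)) hr
    fun z hz => hJ z.1 (mem_formDom_of_mem_graphJ hz) z.2 hz

/-- Coercivity bounds c times the squared gradient norms of the truncation V by Re (J V, ψ). Adding
‖J V‖² controls the graph norm of V, and the constant N from the closed graph theorem converts this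
into the 𝕃^r norm. -/
lemma exists_hasSobolev_A2 {r : ℝ} (hr : 2 < r)
    (hJ : ∀ U ∈ D.formDom, ∀ φ : D.LL 2, (U, φ) ∈ D.graphJ → MemLp φ (ENNReal.ofReal r) D.total) :
    ∃ C : ℝ, 0 ≤ C ∧ HasSobolev hD.A2Sub r C := by
  have := hD.isFiniteMeasure_total
  obtain ⟨N, hN, hNr⟩ := hD.exists_eLpNorm_le hr hJ
  obtain ⟨T₁, T₂, T₃, c, hc, hform, -, htr⟩ := hD.exists_formOperator
  refine ⟨N ^ 2 * max c⁻¹ 1, by positivity, ?_⟩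
  rintro ⟨φ, ψ⟩ hz k hk
  obtain ⟨U, hU, hUV⟩ := mem_A2_iff.1 hz
  obtain ⟨V, χ, hV, hχ, hV1, hV2, hV3⟩ := hD.exists_truncation hU hk
  have h1 := htr U φ hU _ V hV1 hV2 hV3
  rw [← hUV V χ hV] at h1
  have h2 : eLpNorm (rePart k φ) (ENNReal.ofReal r) D.total =
      eLpNorm χ (ENNReal.ofReal r) D.total := by
    refine eLpNorm_congr_norm_ae ?_
    filter_upwards [hχ] with x hx
    rw [hx, Complex.norm_real]
  have h3 : ‖χ‖ ^ 2 = ∫ x, rePart k φ x * rePart k φ x ∂D.total := by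
    have h : (inner ℂ χ χ).re = ‖χ‖ ^ 2 := re_inner_self χ
    rw [← h, re_inner_of_ae_eq_ofReal hχ]
    refine integral_congr_ae ?_
    filter_upwards [hχ] with x hx
    rw [hx, Complex.ofReal_re]
  have h4 : ∫ x, ((ψ x).re + rePart k φ x) * rePart k φ x ∂D.total =
      (inner ℂ χ ψ).re + ‖χ‖ ^ 2 := by
    have hi : Integrable (fun x => rePart k φ x * rePart k φ x) D.total := by
      refine (integrable_mul_re (ψ := χ) hχ).congr ?_
      filter_upwards [hχ] with x hx
      rw [hx, Complex.ofReal_re]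
    rw [h3, re_inner_of_ae_eq_ofReal (ψ := ψ) hχ, ← integral_add (integrable_mul_re hχ) hi]
    refine integral_congr_ae (Eventually.of_forall fun x => ?_)
    simp only
    ring
  change eLpNorm (rePart k φ) _ _ ^ 2 ≤ ENNReal.ofReal
    (_ * ∫ x, ((ψ x).re + rePart k φ x) * rePart k φ x ∂D.total)
  rw [h2, h4]
  have h5 := hNr (V, χ) hV
  have h6 := hD.norm_sq_le hV
  refine (pow_le_pow_left₀ bot_le h5 2).trans ?_
  rw [← ENNReal.ofReal_pow (by positivity)]
  refine ENNReal.ofReal_le_ofReal ?_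
  rw [mul_pow, mul_assoc]
  refine mul_le_mul_of_nonneg_left (h6.trans ?_) (sq_nonneg N)
  rw [mul_add]
  refine add_le_add ?_ (le_mul_of_one_le_left (sq_nonneg _) (le_max_right _ _))
  have h7 : 0 ≤ (inner ℂ χ ψ).re := le_trans (by positivity) h1
  refine le_trans ?_ (mul_le_mul_of_nonneg_right (le_max_left _ _) h7)
  rwa [le_inv_mul_iff₀ hc]

end Admissible

end DiffusionData

theorem lemma6p1 {n : ℕ} (D : DiffusionData n) (hD : D.Admissible)
    (p r θ : ℝ) [Fact (1 ≤ ENNReal.ofReal p)] (hp : 2 < p) (hr : 2 < r)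
    (hθ0 : 0 < θ) (hθ1 : θ < 1) (hθ : r / ((r - 2) * p) < θ)
    (hJ : ∀ U ∈ D.formDom, ∀ φ : D.LL 2, (U, φ) ∈ D.graphJ →
      MemLp φ (ENNReal.ofReal r) D.total) :
    (∀ u w : D.LL (ENNReal.ofReal p), (u, w) ∈ fracPow (D.Ap (ENNReal.ofReal p)) θ →
      MemLp u ∞ D.total) ∧
    ∃ C : ℝ, 0 < C ∧ ∀ u w : D.LL (ENNReal.ofReal p),
      (u, w) ∈ fracPow (D.Ap (ENNReal.ofReal p)) θ →
        eLpNorm u ∞ D.total ≤ ENNReal.ofReal (C * (‖u‖ + ‖w‖)) := by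
  have := hD.isFiniteMeasure_total
  obtain ⟨C, hC, hS⟩ := hD.exists_hasSobolev_A2 hr hJ
  obtain ⟨K, hK, hKb⟩ := DiffusionData.fracPow_Ap_bound (A := hD.A2Sub) rfl hD.mAccretive_A2
    hD.isTruncationAccretive_A2 hp hr hθ0 hθ1 hθ hC hS
  exact ⟨fun u w h => ⟨Lp.aestronglyMeasurable u, (hKb u w h).trans_lt ENNReal.ofReal_lt_top⟩,
    K, hK, hKb⟩
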